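/- **Setting.** Let $\mathcal M_+$ be the set of finite non-negative measures on $[-1,1]$, and $\Pr[-1,1]\subset\mathcal M_+$ the probability measures. Let $\mathrm{TV}(\mu,\nu)=\sup_A|\mu(A)-\nu(A)|$ (sup over measurable $A$) and $W(\mathbb P,\mathbb Q)=\sup\{|\int h\,d\mathbb P-\int h\,d\mathbb Q| : \|h\|_{\mathrm{Lip}}\le 1\}$. For $x,y\in\mathbb R^d$ put $|||x|||_1=\frac1d\sum_k|x_k|$ and $|||y|||_{1,*}=\max_k d|y_k|$. For an integer $K\ge1$ let $\mathcal D_K=\{i2^{-K}: -2^K\le i<2^K\}$, $d=|\mathcal D_K|=2^{K+1}$. For $\mu\in\mathcal M_+$ let $x^{(K)}(\mu)=\big(|\mathcal D_K|\,\mu[k,k+2^{-K})\big)_{k\in\mathcal D_K}$; for $x\in\mathbb R_{\ge0}^{\mathcal D_K}$ let $\mu^{(K)}_x=\frac1{|\mathcal D_K|}\sum_k x_k\delta_k$. Given $g:[-1,1]\to\mathbb R$ and $\psi:\mathcal M_+\to\mathbb R$, let $\psi^{(K)}(x)=\psi(\mu_x^{(K)})$, $G^{(K)}=|\mathcal D_K|^{-2}(g(kk'))_{k,k'\in\mathcal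 D_K}$, $\mathcal C_K=\{G^{(K)}x: x\in\mathbb R^{\mathcal D_K}_{\ge0}\}$, $\mathsf C_K(G^{(K)}x)=\frac12G^{(K)}x\cdot x$ on $\mathcal C_K$, and, for $a>0$, $\mathcal K_{a,K}'=\{y: |||y-G^{(K)}x|||_{1,*}\le d^{-1/2}\text{ for some }x\ge0\text{ with }|||x|||_1\le a\}$. **Hypotheses.** (H1) $g$ is continuously differentiable and $g\ge m$ on $[-1,1]$ for some constant $m>0$. (H2) $\psi$ is Lipschitz continuous with respect to $\mathrm{TV}$ on $\mathcal M_+$; $\|\psi\|_{\mathrm{Lip},\mathrm{TV}}$ denotes its Lipschitz semi-norm. (H3) There is $a>0$ such that for every $K\ge1$, $\nabla\psi^{(K)}\in\mathcal K'_{a,K}$ almost everywhere on $\mathbb R_{\ge0}^{\mathcal D_K}$. (H4) $\psi$ restricted to $\Pr[-1,1]$ is Lipschitz continuous with respect to $W$. **Projected equations.** For $R>0$, call $\mathsf H:\mathbb R^{\mathcal D_K}\to\mathbb R$ a $V$-Lipschitz extension at level $R$ if it is non-decreasing (coordinatewise order), agrees with $\mathsf C_K$ at all $y\in\mathcal C_K$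 with $|||y|||_{1,*}\le R$, and satisfies $|\mathsf H(y)-\mathsf H(y')|\le V|||y-y'|||_{1,*}$. With $L=4R/m$ define $\widetilde{\mathsf C}_{K,R}(y)=\max\big(\mathsf C_K(y),2L(|||y|||_{1,*}-R)\big)$ for $y\in\mathcal C_K$, $|||y|||_{1,*}\le2R$, and $\widetilde{\mathsf C}_{K,R}(y)=2L(|||y|||_{1,*}-R)$ for the other $y\in\mathcal C_K$, and let $\mathsf H_{K,R}(y)=\inf\{\widetilde{\mathsf C}_{K,R}(w): w\in\mathcal C_K,\ w\ge y\}$. Let $\mathfrak L_{\mathrm{unif}}$ be the set of $u:[0,\infty)\times\mathbb R^{d}_{\ge0}\to\mathbb R$ with $\sup_{t>0,x}|u(t,x)-u(0,x)|/t<\infty$ and $u(t,\cdot)$ Lipschitz for $|||\cdot|||_1$ uniformly in $t\ge0$. Viscosity solutions of $\partial_tf=\mathsf H(\nabla f)$ on $\mathbb R_{>0}\times\mathbb R_{>0}^{\mathcal D_K}$ are functions continuous on $[0,\infty)\times\mathbb R_{>0}^{\mathcal D_K}$ such that, for every $\phi\in C^\infty((0,\infty)\times\mathbb R_{>0}^{\mathcal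 D_K})$, $\partial_t\phi-\mathsf H(\nabla\phi)\le0$ (resp. $\ge0$) at every local maximum (resp. minimum) point of $f-\phi$ in $(0,\infty)\times\mathbb R_{>0}^{\mathcal D_K}$. **Theorem 1.2.** Assume (H1)–(H4). (i) For all $R>0$, $K\ge1$ and $M\ge\max_{[-1,1]} g$, the function $\mathsf H_{K,R}$ is an $\frac{8RM}{m^2}$-Lipschitz extension at level $R$. (ii) There is a function $f:[0,\infty)\times\mathcal M_+\to\mathbb R$ such that the following holds for every $R>\|\psi\|_{\mathrm{Lip},\mathrm{TV}}$, every $V\in\mathbb R$ and every family $(\mathsf H^{(K)})_{K\ge1}$ of $V$-Lipschitz extensions at level $R$ (in particular for $\mathsf H^{(K)}=\mathsf H_{K,R}$). For each $K\ge1$ the equation $\partial_tf=\mathsf H^{(K)}(\nabla f)$ on $\mathbb R_{>0}\times\mathbb R_{>0}^{\mathcal D_K}$ has a unique viscosity solution $f^{(K)}_R\in\mathfrak L_{\mathrm{unif}}$ with $f_R^{(K)}(0,\cdot)=\psi^{(K)}$ on $\mathbb R_{\ge0}^{\mathcal D_K}$, and for every $t\ge0$ and $\mu\in\mathcal M_+$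 $$\lim_{K\to\infty}f^{(K)}_R\big(t,x^{(K)}(\mu)\big)=f(t,\mu).$$ That is, the limit exists, is finite, and depends neither on $R$ nor on the choice of the extensions. The function $f$ is by definition the solution of the infinite-dimensional Hamilton–Jacobi equation $\partial_tf=\mathsf C_\infty(D_\mu f)$, $f(0,\cdot)=\psi$, where $\mathsf C_\infty(G_\mu)=\frac12\int G_\mu\,d\mu$ for $G_\mu(x)=\int g(xy)\,d\mu(y)$. -/

import Mathlib

open MeasureTheory Filter Topology
open scoped NNReal ContDiff

noncomputable section

namespace SparseHJ

/-! ### Norms, cones and calculus on `ℝ^ι` -/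

section FiniteDim

variable {ι : Type} [Fintype ι]

/-- The normalized `ℓ¹` norm `(1/d) ∑ |x_k|`. -/
def norm1 (x : ι → ℝ) : ℝ := (Fintype.card ι : ℝ)⁻¹ * ∑ k, |x k|

/-- The normalized dual norm `max_k d |y_k|`. -/
def dualNorm1 (y : ι → ℝ) : ℝ := ⨆ k, (Fintype.card ι : ℝ) * |y k|

/-- The neighbourhood of radius `d^(-1/2)` of a set, in the normalized dual norm. -/
def enlarge (S : Set (ι → ℝ)) : Set (ι → ℝ) :=
  {y | ∃ z ∈ S, dualNorm1 (y - z) ≤ 1 / Real.sqrt (Fintype.card ι)}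

/-- The closed orthant. -/
def closedOrthant (ι : Type) : Set (ι → ℝ) := {x | ∀ k, 0 ≤ x k}

/-- The open orthant. -/
def openOrthant (ι : Type) : Set (ι → ℝ) := {x | ∀ k, 0 < x k}

/-- The gradient of a function on `ℝ^ι`. -/
def grad [DecidableEq ι] (h : (ι → ℝ) → ℝ) (x : ι → ℝ) : ι → ℝ :=
  fun k => fderiv ℝ h x (Pi.single k 1)

/-- A (Lipschitz) function on the closed orthant has its gradient in `S`: at almost every point of
the orthant (whose boundary is Lebesgue-null) it is differentiable with gradient in `S`. -/
def HasGradientIn [DecidableEq ι] (h : (ι → ℝ) → ℝ) (S : Set (ι → ℝ)) : Prop :=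
  ∀ᵐ x ∂(volume.restrict (openOrthant ι)), DifferentiableAt ℝ h x ∧ grad h x ∈ S

/-- The time derivative of a function of `(t, x)`. -/
def dt (φ : ℝ × (ι → ℝ) → ℝ) (p : ℝ × (ι → ℝ)) : ℝ := fderiv ℝ φ p (1, 0)

/-- The spatial gradient of a function of `(t, x)`. -/
def dx [DecidableEq ι] (φ : ℝ × (ι → ℝ) → ℝ) (p : ℝ × (ι → ℝ)) : ι → ℝ :=
  fun k => fderiv ℝ φ p (0, Pi.single k 1)

/-! ### Viscosity solutions of `∂_t f = H(∇ f)` on `(0,∞) × (0,∞)^ι` -/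

/-- Viscosity subsolution. -/
def IsViscositySubsolution [DecidableEq ι] (H : (ι → ℝ) → ℝ) (u : ℝ × (ι → ℝ) → ℝ) : Prop :=
  UpperSemicontinuousOn u (Set.Ici 0 ×ˢ openOrthant ι) ∧
  ∀ φ : ℝ × (ι → ℝ) → ℝ, ContDiffOn ℝ ∞ φ (Set.Ioi 0 ×ˢ openOrthant ι) →
    ∀ p ∈ Set.Ioi (0 : ℝ) ×ˢ openOrthant ι,
      IsLocalMaxOn (fun q => u q - φ q) (Set.Ioi 0 ×ˢ openOrthant ι) p →
        dt φ p - H (dx φ p) ≤ 0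

/-- Viscosity supersolution. -/
def IsViscositySupersolution [DecidableEq ι] (H : (ι → ℝ) → ℝ) (u : ℝ × (ι → ℝ) → ℝ) : Prop :=
  LowerSemicontinuousOn u (Set.Ici 0 ×ˢ openOrthant ι) ∧
  ∀ φ : ℝ × (ι → ℝ) → ℝ, ContDiffOn ℝ ∞ φ (Set.Ioi 0 ×ˢ openOrthant ι) →
    ∀ p ∈ Set.Ioi (0 : ℝ) ×ˢ openOrthant ι,
      IsLocalMinOn (fun q => u q - φ q) (Set.Ioi 0 ×ˢ openOrthant ι) p →
        0 ≤ dt φ p - H (dx φ p)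

/-- Viscosity solution: continuous, and both a sub- and a supersolution. -/
def IsViscositySolution [DecidableEq ι] (H : (ι → ℝ) → ℝ) (u : ℝ × (ι → ℝ) → ℝ) : Prop :=
  ContinuousOn u (Set.Ici 0 ×ˢ openOrthant ι) ∧
    IsViscositySubsolution H u ∧ IsViscositySupersolution H u

/-- The space `𝔏` of functions on `[0,∞) × [0,∞)^ι` with Lipschitz initial condition and at most
linear growth in time (values outside this domain are irrelevant). -/
def MemL (u : ℝ × (ι → ℝ) → ℝ) : Prop :=
  (∃ C : ℝ, ∀ x ∈ closedOrthant ι, ∀ x' ∈ closedOrthant ι,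
      |u (0, x) - u (0, x')| ≤ C * norm1 (x - x')) ∧
  (∃ C : ℝ, ∀ t : ℝ, 0 < t → ∀ x ∈ closedOrthant ι, |u (t, x) - u (0, x)| ≤ C * t)

/-- The space `𝔏_unif`: functions of `𝔏` that are Lipschitz in space, uniformly in time. -/
def MemLUnif (u : ℝ × (ι → ℝ) → ℝ) : Prop :=
  MemL u ∧
  ∃ C : ℝ, ∀ t : ℝ, 0 ≤ t → ∀ x ∈ closedOrthant ι, ∀ x' ∈ closedOrthant ι,
    |u (t, x) - u (t, x')| ≤ C * norm1 (x - x')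

/-- `u ∈ 𝔏_unif` is a viscosity solution of `∂_t u = H(∇u)` with initial condition `u₀`. -/
structure IsSolution [DecidableEq ι] (H : (ι → ℝ) → ℝ) (u₀ : (ι → ℝ) → ℝ)
    (u : ℝ × (ι → ℝ) → ℝ) : Prop where
  memLUnif : MemLUnif u
  viscosity : IsViscositySolution H u
  initial : ∀ x ∈ closedOrthant ι, u (0, x) = u₀ x

end FiniteDim

/-! ### Measures on `[-1,1]` -/

/-- The interval `[-1,1]`. -/
abbrev I : Type := Set.Icc (-1 : ℝ) 1

/-- The total variation distance `sup_A |μ(A) - ν(A)|`. -/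
def tv (μ ν : FiniteMeasure I) : ℝ :=
  ⨆ A : {A : Set I // MeasurableSet A}, |(μ A.1 : ℝ) - (ν A.1 : ℝ)|

/-- The Wasserstein distance, in its dual form. -/
def wasserstein (P Q : ProbabilityMeasure I) : ℝ :=
  ⨆ h : {h : I → ℝ // LipschitzWith 1 h},
    |(∫ x, h.1 x ∂(P : Measure I)) - ∫ x, h.1 x ∂(Q : Measure I)|

/-- `ψ` is Lipschitz continuous with respect to the total variation distance. -/
def LipschitzTV (ψ : FiniteMeasure I → ℝ) : Prop :=
  ∃ L : ℝ, ∀ μ ν, |ψ μ - ψ ν| ≤ L * tv μ ν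

/-- The Lipschitz semi-norm with respect to the total variation distance. -/
def lipTV (ψ : FiniteMeasure I → ℝ) : ℝ :=
  ⨆ p : FiniteMeasure I × FiniteMeasure I, |ψ p.1 - ψ p.2| / tv p.1 p.2

/-- `ψ` is, on probability measures, Lipschitz continuous for the Wasserstein distance. -/
def LipschitzW (ψ : FiniteMeasure I → ℝ) : Prop :=
  ∃ L : ℝ, ∀ P Q : ProbabilityMeasure I,
    |ψ P.toFiniteMeasure - ψ Q.toFiniteMeasure| ≤ L * wasserstein P Q

/-! ### Dyadic discretization -/

/-- Index set of the `2^(K+1)` dyadic rationals `i / 2^K`, `-2^K ≤ i < 2^K`. -/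
abbrev D (K : ℕ) : Type := Fin (2 ^ (K + 1))

/-- The dyadic rational with index `k`, namely `(k - 2^K) / 2^K`. -/
def dyadic (K : ℕ) (k : D K) : ℝ := ((k : ℝ) - 2 ^ K) / 2 ^ K

lemma dyadic_mem (K : ℕ) (k : D K) : dyadic K k ∈ Set.Icc (-1 : ℝ) 1 := by
  have h2 : (0 : ℝ) < 2 ^ K := by positivity
  have hk : (k : ℝ) ≤ 2 * 2 ^ K := by
    have h : (k : ℕ) ≤ 2 * 2 ^ K := k.2.le.trans_eq (pow_succ' 2 K)
    exact_mod_cast h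
  have hk0 : (0 : ℝ) ≤ (k : ℝ) := Nat.cast_nonneg _
  unfold dyadic
  constructor
  · rw [le_div_iff₀ h2]; linarith
  · rw [div_le_iff₀ h2]; linarith

/-- The dyadic rational with index `k`, as a point of `[-1,1]`. -/
def dyadicPt (K : ℕ) (k : D K) : I := ⟨dyadic K k, dyadic_mem K k⟩

/-- The vector `x^{(K)}(μ)` with entries `|D_K| μ[k, k + 2^{-K})`. -/
def proj (K : ℕ) (μ : FiniteMeasure I) : D K → ℝ := fun k =>
  (Fintype.card (D K) : ℝ) *
    (μ {y : I | dyadic K k ≤ (y : ℝ) ∧ (y : ℝ) < dyadic K k + 1 / 2 ^ K} : ℝ)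

/-- The measure `μ_x^{(K)} = |D_K|⁻¹ ∑_k x_k δ_k`, for `x` in the closed orthant. -/
def discMeasure (K : ℕ) (x : D K → ℝ) : FiniteMeasure I :=
  ∑ k, ((x k).toNNReal / (Fintype.card (D K) : ℝ≥0)) •
    (diracProba (dyadicPt K k)).toFiniteMeasure

/-- The projected initial condition `ψ^{(K)}(x) = ψ(μ_x^{(K)})`. -/
def projInit (ψ : FiniteMeasure I → ℝ) (K : ℕ) (x : D K → ℝ) : ℝ := ψ (discMeasure K x)

/-- The matrix `G^{(K)} = |D_K|⁻² (g(k k'))`. -/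
def GMat (g : ℝ → ℝ) (K : ℕ) : Matrix (D K) (D K) ℝ :=
  Matrix.of fun k k' => g (dyadic K k * dyadic K k') / (Fintype.card (D K) : ℝ) ^ 2

/-- The value `C_K(G^{(K)} x) = ½ G^{(K)} x · x` of the projected non-linearity, as a function of
the parameter `x` in the closed orthant. -/
def CVal (g : ℝ → ℝ) (K : ℕ) (x : D K → ℝ) : ℝ := (1 / 2) * ((GMat g K).mulVec x ⬝ᵥ x)

/-- The closed convex set `𝒦_{a,K} = {G^{(K)} x | x ≥ 0, ‖x‖₁ ≤ a}`. -/
def Kset (g : ℝ → ℝ) (a : ℝ) (K : ℕ) : Set (D K → ℝ) :=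
  {y | ∃ x ∈ closedOrthant (D K), norm1 x ≤ a ∧ y = (GMat g K).mulVec x}

/-- There is `a > 0` such that every projected initial condition has its gradient in the enlarged
set `𝒦'_{a,K}`. -/
def GradientCondition (g : ℝ → ℝ) (ψ : FiniteMeasure I → ℝ) : Prop :=
  ∃ a : ℝ, 0 < a ∧ ∀ K : ℕ, 1 ≤ K → HasGradientIn (projInit ψ K) (enlarge (Kset g a K))

/-! ### Extension of the projected non-linearity -/

/-- `H` is a non-decreasing extension of `C_K` from the cone intersected with the dual ball of
radius `R` to the whole space, and is `V`-Lipschitz for the normalized dual norm. -/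
structure IsExtension (g : ℝ → ℝ) (K : ℕ) (R V : ℝ) (H : (D K → ℝ) → ℝ) : Prop where
  monotone : Monotone H
  agrees : ∀ x ∈ closedOrthant (D K), dualNorm1 ((GMat g K).mulVec x) ≤ R →
    H ((GMat g K).mulVec x) = CVal g K x
  lipschitz : ∀ y y' : D K → ℝ, |H y - H y'| ≤ V * dualNorm1 (y - y')

/-- The regularized non-linearity on the cone, as a function of the parameter `x` of the point
`y = G^{(K)} x`: with `L = 4R/m`, it is `max(C_K(y), 2L(‖y‖ - R))` if `‖y‖ ≤ 2R`, and
`2L(‖y‖ - R)` otherwise. -/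
def regVal (g : ℝ → ℝ) (m : ℝ) (K : ℕ) (R : ℝ) (x : D K → ℝ) : ℝ :=
  if dualNorm1 ((GMat g K).mulVec x) ≤ 2 * R then
    max (CVal g K x) (2 * (4 * R / m) * (dualNorm1 ((GMat g K).mulVec x) - R))
  else 2 * (4 * R / m) * (dualNorm1 ((GMat g K).mulVec x) - R)

/-- The extension `H_{K,R}(y)`: the infimum of the regularized non-linearity over the points `w`
of the cone with `w ≥ y`. -/
def HKR (g : ℝ → ℝ) (m : ℝ) (K : ℕ) (R : ℝ) (y : D K → ℝ) : ℝ :=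
  ⨅ x : {x : D K → ℝ // x ∈ closedOrthant (D K) ∧ y ≤ (GMat g K).mulVec x}, regVal g m K R x.1

end SparseHJ

end

open SparseHJ

/-!
The equations at level `K` live on the orthant of `ℝ^{D K}`, and their non-linearities `H` are
non-decreasing and Lipschitz for the normalized dual norm. Monotonicity makes the boundary of the
orthant invisible: in the doubling of variables, barriers `η / x_k` contribute with the favourable
sign, so that the comparison principle (`comparison`, and `le_of_perturbation` with an error in the
equation and in the initial condition) holds without boundary conditions and gives uniqueness.

Existence comes from an explicit scheme with *forward* differences. It never leaves the orthant, it
is monotone under a CFL condition (`schemeStep_le`), and it commutes with translations, so that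
every bound `u (x + z) ≤ u x + c` on increments is preserved (`iterate_schemeStep_add_le`). Its
limits along an ultrafilter satisfy the equation at every element of their superjets and subjets
(`IsSchemeLimit.le_of_isSuperjet`), which is stronger than the viscosity property.

The gradient condition on `ψ` says that increments of `ψ^{(K)}` are bounded by the support function
of the convex set `𝒦'_{a,K}` (`le_add_of_hasGradientIn`). The scheme propagates this, and by
Hahn–Banach all jets of the solution lie in the closure of `𝒦'_{a,K}`; they are also bounded by the
Lipschitz constant of `ψ`, which is less than `R`. At such jets every extension is within
`O(2^{-K/2})` of the quadratic form `C_K`, and the latter is compatible with passing from level `K`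
to level `K + n` up to `O(2^{-K})`, because `g` is Lipschitz (`abs_extension_sub_le`). Hence, with
`avg` the coarse-graining of densities, `(t, x) ↦ u^{(K)}(t, avg x)` solves the equation of level
`K + n` up to a small error, for any choice of the extensions. The same gradient bound shows that
its initial condition is close to `ψ^{(K + n)}` (`abs_projInit_avg_sub_le`). The perturbed
comparison principle then bounds the difference of the two solutions (`abs_sub_avg_le`): the
sequence is Cauchy, and its limit depends neither on `R` nor on the extensions.

For `H_{K,R}`, the symmetry of `G^{(K)}` gives
`C_K(y) - C_K(y') = ½ (y - y') · (x + x')` for `y = G x`, `y' = G x'`, whence monotonicity and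
Lipschitz bounds on the cone (`regVal_mono`, `regVal_sub_le`). The bounds `m ≤ g ≤ M` allow one to
dominate a perturbation of size `δ` by moving within the cone by at most `δ M / m`
(`exists_add_le_GMat_mulVec`).
-/

namespace SparseHJ

/-! ### The normalized norms -/

section Norms

variable {ι : Type} [Fintype ι]

lemma dualNorm1_le_iff [Nonempty ι] {y : ι → ℝ} {c : ℝ} :
    dualNorm1 y ≤ c ↔ ∀ k, (Fintype.card ι : ℝ) * |y k| ≤ c :=
  ciSup_le_iff (Set.finite_range _).bddAbove

lemma le_dualNorm1 (y : ι → ℝ) (k : ι) : (Fintype.card ι : ℝ) * |y k| ≤ dualNorm1 y :=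
  le_ciSup (f := fun k => (Fintype.card ι : ℝ) * |y k|) (Set.finite_range _).bddAbove k

lemma dualNorm1_nonneg (y : ι → ℝ) : 0 ≤ dualNorm1 y :=
  Real.iSup_nonneg fun _ => by positivity

lemma card_pos_real (ι : Type) [Fintype ι] [Nonempty ι] : (0 : ℝ) < Fintype.card ι := by
  exact_mod_cast Fintype.card_pos

lemma dualNorm1_le_card_mul [Nonempty ι] {y : ι → ℝ} {c : ℝ} (h : ∀ k, |y k| ≤ c) :
    dualNorm1 y ≤ Fintype.card ι * c :=
  dualNorm1_le_iff.2 fun k => mul_le_mul_of_nonneg_left (h k) (card_pos_real ι).le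

lemma dualNorm1_add_le [Nonempty ι] (y z : ι → ℝ) :
    dualNorm1 (y + z) ≤ dualNorm1 y + dualNorm1 z :=
  dualNorm1_le_iff.2 fun k => by
    have h := mul_le_mul_of_nonneg_left (abs_add_le (y k) (z k)) (card_pos_real ι).le
    have h1 := le_dualNorm1 y k
    have h2 := le_dualNorm1 z k
    simp only [Pi.add_apply]
    linarith

lemma dualNorm1_neg (y : ι → ℝ) : dualNorm1 (-y) = dualNorm1 y := by
  simp [dualNorm1]

lemma norm1_nonneg (x : ι → ℝ) : 0 ≤ norm1 x := by unfold norm1; positivity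

lemma norm1_of_nonneg {x : ι → ℝ} (hx : x ∈ closedOrthant ι) :
    norm1 x = (Fintype.card ι : ℝ)⁻¹ * ∑ k, x k := by
  unfold norm1
  congr 1
  exact Finset.sum_congr rfl fun k _ => abs_of_nonneg (hx k)

lemma abs_dotProduct_le [Nonempty ι] (y x : ι → ℝ) : |y ⬝ᵥ x| ≤ dualNorm1 y * norm1 x := by
  have hd := card_pos_real ι
  unfold norm1 dotProduct
  rw [← mul_assoc, Finset.mul_sum]
  refine (Finset.abs_sum_le_sum_abs _ _).trans (Finset.sum_le_sum fun k _ => ?_)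
  rw [abs_mul]
  refine mul_le_mul_of_nonneg_right ?_ (abs_nonneg _)
  rw [← div_eq_mul_inv, le_div_iff₀ hd, mul_comm]
  exact le_dualNorm1 y k

lemma norm1_le_sum [Nonempty ι] (x : ι → ℝ) : norm1 x ≤ ∑ k, |x k| := by
  have hd : (1 : ℝ) ≤ Fintype.card ι := by exact_mod_cast Fintype.card_pos
  unfold norm1
  exact mul_le_of_le_one_left (by positivity) (inv_le_one_of_one_le₀ hd)

lemma norm1_le_norm [Nonempty ι] (x : ι → ℝ) : norm1 x ≤ ‖x‖ := by
  have hd := card_pos_real ι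
  unfold norm1
  rw [inv_mul_le_iff₀ hd]
  calc ∑ k, |x k| ≤ ∑ _k : ι, ‖x‖ := Finset.sum_le_sum fun k _ => norm_le_pi_norm x k
    _ = _ := by simp

lemma lipschitz_const_nonneg [Nonempty ι] {H : (ι → ℝ) → ℝ} {V : ℝ}
    (hlip : ∀ y y', |H y - H y'| ≤ V * dualNorm1 (y - y')) : 0 ≤ V := by
  have h := hlip (fun _ => 1) 0
  have h2 : 0 < dualNorm1 ((fun _ => 1) - 0 : ι → ℝ) := by
    have := le_dualNorm1 ((fun _ => 1) - 0 : ι → ℝ) (Classical.arbitrary ι)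
    have hd := card_pos_real ι
    simp only [sub_zero, abs_one, mul_one] at this ⊢
    linarith
  by_contra hV
  push Not at hV
  have := mul_neg_of_neg_of_pos hV h2
  have := abs_nonneg (H (fun _ => 1) - H 0)
  linarith

lemma openOrthant_subset_closedOrthant {ι : Type} : openOrthant ι ⊆ closedOrthant ι :=
  fun _ hx k => (hx k).le

lemma isOpen_openOrthant : IsOpen (openOrthant ι) := by
  have : openOrthant ι = ⋂ k, {x : ι → ℝ | 0 < x k} := by
    ext x; simp [openOrthant]
  rw [this]
  exact isOpen_iInter_of_finite fun k => isOpen_lt continuous_const (continuous_apply k)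

end Norms

/-! ### Comparison principle on the open orthant -/

section Comparison

variable {ι : Type} [Fintype ι]

lemma dt_dx_separable [DecidableEq ι] {A : ℝ → ℝ} {B : ι → ℝ → ℝ} {p : ℝ × (ι → ℝ)} {a' : ℝ}
    {b' : ι → ℝ}
    (hA : HasDerivAt A a' p.1) (hB : ∀ k, HasDerivAt (B k) (b' k) (p.2 k)) :
    dt (fun q => A q.1 + ∑ k, B k (q.2 k)) p = a' ∧
      dx (fun q => A q.1 + ∑ k, B k (q.2 k)) p = b' := by
  have h1 : HasFDerivAt (fun q : ℝ × (ι → ℝ) => A q.1)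
      (a' • ContinuousLinearMap.fst ℝ ℝ (ι → ℝ)) p :=
    hA.comp_hasFDerivAt p hasFDerivAt_fst
  have h2 : ∀ k ∈ Finset.univ, HasFDerivAt (fun q : ℝ × (ι → ℝ) => B k (q.2 k))
      (b' k • (ContinuousLinearMap.proj k).comp (ContinuousLinearMap.snd ℝ ℝ (ι → ℝ))) p :=
    fun k _ => (hB k).comp_hasFDerivAt p
      ((ContinuousLinearMap.proj (R := ℝ) (φ := fun _ : ι => ℝ) k).comp
        (ContinuousLinearMap.snd ℝ ℝ (ι → ℝ))).hasFDerivAt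
  have h := h1.add (HasFDerivAt.fun_sum h2)
  have hf := h.fderiv
  constructor
  · unfold dt
    erw [hf]
    simp
  · ext k
    unfold dx
    erw [hf]
    simp [Pi.single_apply]

lemma contDiffOn_separable {A : ℝ → ℝ} {B : ι → ℝ → ℝ} (hA : ContDiff ℝ ∞ A)
    (hB : ∀ k, ContDiffOn ℝ ∞ (B k) (Set.Ioi 0)) :
    ContDiffOn ℝ ∞ (fun q : ℝ × (ι → ℝ) => A q.1 + ∑ k, B k (q.2 k))
      (Set.Ioi 0 ×ˢ openOrthant ι) := by
  refine (hA.comp contDiff_fst).contDiffOn.add (ContDiffOn.sum fun k _ => ?_)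
  refine (hB k).comp (t := Set.Ioi 0) ?_ fun q hq => hq.2 k
  exact (((ContinuousLinearMap.proj (R := ℝ) (φ := fun _ : ι => ℝ) k).comp
        (ContinuousLinearMap.snd ℝ ℝ (ι → ℝ))).contDiff).contDiffOn

/-- The penalization used to double the variables: it is quadratic in the differences, and it
blows up at spatial and temporal infinity and at the boundary of the orthant. -/
noncomputable def doublingPenalty (κ lam β η : ℝ) (p q : ℝ × (ι → ℝ)) : ℝ :=
  κ * (p.1 - q.1) ^ 2 + κ * ∑ k, (p.2 k - q.2 k) ^ 2 + lam * (p.1 + p.1 ^ 2)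
    + β * ∑ k, p.2 k + η * ∑ k, (p.2 k)⁻¹ + η * ∑ k, (q.2 k)⁻¹

lemma mul_sub_sq_le {κ : ℝ} (hκ : 0 < κ) (C r : ℝ) :
    C * r - κ * r ^ 2 ≤ C ^ 2 / (2 * κ) - κ / 2 * r ^ 2 := by
  have h : C ^ 2 / (2 * κ) - κ / 2 * r ^ 2 - (C * r - κ * r ^ 2) = (C - κ * r) ^ 2 / (2 * κ) := by
    field_simp; ring
  have : 0 ≤ (C - κ * r) ^ 2 / (2 * κ) := by positivity
  linarith

lemma continuousOn_doublingPenalty (κ lam β η : ℝ) :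
    ContinuousOn (fun z : (ℝ × (ι → ℝ)) × (ℝ × (ι → ℝ)) => doublingPenalty κ lam β η z.1 z.2)
      ((Set.Ici 0 ×ˢ openOrthant ι) ×ˢ (Set.Ici 0 ×ˢ openOrthant ι)) := by
  unfold doublingPenalty
  refine (ContinuousOn.add (Continuous.continuousOn ?_)
    (continuousOn_const.mul (continuousOn_finsetSum _ fun k _ => ?_))).add
    (continuousOn_const.mul (continuousOn_finsetSum _ fun k _ => ?_))
  · have h1 : ∀ k, Continuous fun z : (ℝ × (ι → ℝ)) × (ℝ × (ι → ℝ)) => z.1.2 k := fun k =>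
      (continuous_apply k).comp (continuous_snd.comp continuous_fst)
    have h2 : ∀ k, Continuous fun z : (ℝ × (ι → ℝ)) × (ℝ × (ι → ℝ)) => z.2.2 k := fun k =>
      (continuous_apply k).comp (continuous_snd.comp continuous_snd)
    have h3 := continuous_finsetSum Finset.univ fun k _ => ((h1 k).sub (h2 k)).pow 2
    have h4 := continuous_finsetSum Finset.univ fun k _ => h1 k
    have h5 : Continuous fun z : (ℝ × (ι → ℝ)) × (ℝ × (ι → ℝ)) =>
        κ * (z.1.1 - z.2.1) ^ 2 := by fun_prop
    have h6 : Continuous fun z : (ℝ × (ι → ℝ)) × (ℝ × (ι → ℝ)) =>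
        lam * (z.1.1 + z.1.1 ^ 2) := by fun_prop
    exact ((h5.add (continuous_const.mul h3)).add h6).add (continuous_const.mul h4)
  · exact ContinuousOn.inv₀ (Continuous.continuousOn
      ((continuous_apply k).comp (continuous_snd.comp continuous_fst))) fun z hz => (hz.1.2 k).ne'
  · exact ContinuousOn.inv₀ (Continuous.continuousOn
      ((continuous_apply k).comp (continuous_snd.comp continuous_snd))) fun z hz => (hz.2.2 k).ne'

lemma exists_isMax_sub_doublingPenalty {u w : ℝ × (ι → ℝ) → ℝ} {C κ lam β η : ℝ}
    (hκ : 0 < κ) (hlam : 0 < lam) (hβ : 0 < β) (hη : 0 < η) (hC : 0 ≤ C)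
    (hu : ContinuousOn u (Set.Ici 0 ×ˢ openOrthant ι))
    (hw : ContinuousOn w (Set.Ici 0 ×ˢ openOrthant ι))
    (hS : ∀ p ∈ Set.Ici (0 : ℝ) ×ˢ openOrthant ι, ∀ q ∈ Set.Ici (0 : ℝ) ×ˢ openOrthant ι,
      u p - w q ≤ C * (∑ k, |p.2 k - q.2 k| + p.1 + q.1))
    {p₀ : ℝ × (ι → ℝ)} (hp₀ : p₀ ∈ Set.Ici (0 : ℝ) ×ˢ openOrthant ι)
    (h0 : 0 ≤ u p₀ - w p₀ - doublingPenalty κ lam β η p₀ p₀) :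
    ∃ p ∈ Set.Ici (0 : ℝ) ×ˢ openOrthant ι, ∃ q ∈ Set.Ici (0 : ℝ) ×ˢ openOrthant ι,
      ∀ p' ∈ Set.Ici (0 : ℝ) ×ˢ openOrthant ι, ∀ q' ∈ Set.Ici (0 : ℝ) ×ˢ openOrthant ι,
        u p' - w q' - doublingPenalty κ lam β η p' q' ≤
          u p - w q - doublingPenalty κ lam β η p q := by
  set Ω : Set (ℝ × (ι → ℝ)) := Set.Ici (0 : ℝ) ×ˢ openOrthant ι with hΩ
  set d : ℝ := ((Fintype.card ι : ℕ) : ℝ) with hd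
  have hd0 : 0 ≤ d := by positivity
  set B : ℝ := (d + 1) * (C ^ 2 / (2 * κ)) + 2 * C ^ 2 / lam + 1 with hB
  have hB1 : 1 ≤ B := by
    have : 0 ≤ (d + 1) * (C ^ 2 / (2 * κ)) + 2 * C ^ 2 / lam := by positivity
    linarith
  -- On the superlevel set of height zero every penalization term is bounded by `B`.
  have key : ∀ p ∈ Ω, ∀ q ∈ Ω, 0 ≤ u p - w q - doublingPenalty κ lam β η p q →
      κ / 2 * (p.1 - q.1) ^ 2 + κ / 2 * ∑ k, (p.2 k - q.2 k) ^ 2 + lam / 2 * p.1 ^ 2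
        + β * ∑ k, p.2 k + η * ∑ k, (p.2 k)⁻¹ + η * ∑ k, (q.2 k)⁻¹ ≤ B := by
    intro p hp q hq h
    have h1 := hS p hp q hq
    have hp1 : 0 ≤ p.1 := hp.1
    have h2 := mul_sub_sq_le hκ C |p.1 - q.1|
    rw [sq_abs] at h2
    have h3 : C * ∑ k, |p.2 k - q.2 k| - κ * ∑ k, (p.2 k - q.2 k) ^ 2
        ≤ d * (C ^ 2 / (2 * κ)) - κ / 2 * ∑ k, (p.2 k - q.2 k) ^ 2 := by
      have : ∑ k, (C * |p.2 k - q.2 k| - κ * (p.2 k - q.2 k) ^ 2)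
          ≤ ∑ k, (C ^ 2 / (2 * κ) - κ / 2 * (p.2 k - q.2 k) ^ 2) :=
        Finset.sum_le_sum fun k _ => by
          have := mul_sub_sq_le hκ C |p.2 k - q.2 k|
          rwa [sq_abs] at this
      simpa [Finset.sum_sub_distrib, ← Finset.mul_sum, hd] using this
    have h4 : q.1 ≤ p.1 + |p.1 - q.1| := by
      have := neg_abs_le (p.1 - q.1); linarith
    have h5 := mul_sub_sq_le (κ := lam) hlam (2 * C) p.1
    have h6 : (2 * C) ^ 2 / (2 * lam) = 2 * C ^ 2 / lam := by field_simp
    have h7 := mul_le_mul_of_nonneg_left h4 hC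
    have h8 : 0 ≤ lam * p.1 := by positivity
    unfold doublingPenalty at h
    rw [h6] at h5
    linarith
  have inv_sum : ∀ p ∈ Ω, ∀ k, (p.2 k)⁻¹ ≤ ∑ k, (p.2 k)⁻¹ := fun p hp k =>
    Finset.single_le_sum (f := fun k => (p.2 k)⁻¹) (fun j _ => inv_nonneg.2 (hp.2 j).le)
      (Finset.mem_univ k)
  set b : ℝ := 2 * B / lam + B / β + 2 * B / κ + 2 with hb
  set r : ℝ := η / B with hr
  have hBp : 0 < B := by linarith
  have hr0 : 0 < r := by positivity
  set box : Set (ℝ × (ι → ℝ)) := Set.Icc 0 b ×ˢ Set.Icc (fun _ => r) (fun _ => b) with hbox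
  have hboxΩ : box ⊆ Ω := fun p hp => ⟨hp.1.1, fun k => hr0.trans_le (hp.2.1 k)⟩
  have le_of_sq : ∀ {z c : ℝ}, 0 ≤ c → z ^ 2 ≤ c → z ≤ c + 1 := fun {z c} _ h => by nlinarith
  have mem_box : ∀ p ∈ Ω, ∀ q ∈ Ω, 0 ≤ u p - w q - doublingPenalty κ lam β η p q →
      p ∈ box ∧ q ∈ box := by
    intro p hp q hq h
    have hk := key p hp q hq h
    have e1 : 0 ≤ κ / 2 * (p.1 - q.1) ^ 2 := by positivity
    have e2 : 0 ≤ κ / 2 * ∑ k, (p.2 k - q.2 k) ^ 2 := by positivity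
    have e3 : 0 ≤ lam / 2 * p.1 ^ 2 := by positivity
    have e4 : 0 ≤ β * ∑ k, p.2 k :=
      mul_nonneg hβ.le (Finset.sum_nonneg fun k _ => (hp.2 k).le)
    have e5 : 0 ≤ η * ∑ k, (p.2 k)⁻¹ :=
      mul_nonneg hη.le (Finset.sum_nonneg fun k _ => inv_nonneg.2 (hp.2 k).le)
    have e6 : 0 ≤ η * ∑ k, (q.2 k)⁻¹ :=
      mul_nonneg hη.le (Finset.sum_nonneg fun k _ => inv_nonneg.2 (hq.2 k).le)
    have f1 : p.1 ≤ 2 * B / lam + 1 := le_of_sq (by positivity) (by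
      rw [le_div_iff₀ hlam]; linarith)
    have f2 : q.1 - p.1 ≤ 2 * B / κ + 1 := le_of_sq (by positivity) (by
      rw [le_div_iff₀ hκ]
      have h1 : (q.1 - p.1) ^ 2 * κ = 2 * (κ / 2 * (p.1 - q.1) ^ 2) := by ring
      linarith)
    have f3 : ∀ k, p.2 k ≤ B / β := fun k => by
      rw [le_div_iff₀ hβ]
      have := Finset.single_le_sum (f := fun k => p.2 k) (fun j _ => (hp.2 j).le)
        (Finset.mem_univ k)
      have h1 := mul_le_mul_of_nonneg_left this hβ.le
      linarith
    have f4 : ∀ k, q.2 k - p.2 k ≤ 2 * B / κ + 1 := fun k => le_of_sq (by positivity) (by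
      rw [le_div_iff₀ hκ]
      have := Finset.single_le_sum (f := fun k => (p.2 k - q.2 k) ^ 2) (fun j _ => sq_nonneg _)
        (Finset.mem_univ k)
      have h1 := mul_le_mul_of_nonneg_left this (half_pos hκ).le
      have h2 : (q.2 k - p.2 k) ^ 2 * κ = 2 * (κ / 2 * (p.2 k - q.2 k) ^ 2) := by ring
      linarith)
    have lower : ∀ p ∈ Ω, η * ∑ k, (p.2 k)⁻¹ ≤ B → ∀ k, r ≤ p.2 k := fun p hp h k => by
      have h1 := mul_le_mul_of_nonneg_left (inv_sum p hp k) hη.le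
      have h2 : η * (p.2 k)⁻¹ ≤ B := h1.trans h
      rw [← div_eq_mul_inv, div_le_iff₀ (hp.2 k)] at h2
      rw [hr, div_le_iff₀ hBp]; linarith
    have g1 : 0 ≤ 2 * B / lam := by positivity
    have g2 : 0 ≤ B / β := by positivity
    have g3 : 0 ≤ 2 * B / κ := by positivity
    refine ⟨⟨⟨hp.1, by linarith⟩, lower p hp (by linarith), fun k => ?_⟩,
      ⟨⟨hq.1, by linarith⟩, lower q hq (by linarith), fun k => ?_⟩⟩
    · have := f3 k; simp only; linarith
    · have := f3 k; have := f4 k; simp only; linarith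
  have hcompact : IsCompact (box ×ˢ box) :=
    (isCompact_Icc.prod isCompact_Icc).prod (isCompact_Icc.prod isCompact_Icc)
  have hcont : ContinuousOn (fun z : (ℝ × (ι → ℝ)) × (ℝ × (ι → ℝ)) =>
      u z.1 - w z.2 - doublingPenalty κ lam β η z.1 z.2) (box ×ˢ box) := by
    refine ((hu.comp continuousOn_fst fun z hz => hboxΩ hz.1).sub
      (hw.comp continuousOn_snd fun z hz => hboxΩ hz.2)).sub ?_
    exact (continuousOn_doublingPenalty κ lam β η).mono fun z hz => ⟨hboxΩ hz.1, hboxΩ hz.2⟩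
  have hp₀box := (mem_box p₀ hp₀ p₀ hp₀ h0).1
  obtain ⟨z, hz, hmax⟩ := hcompact.exists_isMaxOn ⟨(p₀, p₀), hp₀box, hp₀box⟩ hcont
  refine ⟨z.1, hboxΩ hz.1, z.2, hboxΩ hz.2, fun p hp q hq => ?_⟩
  by_cases h : 0 ≤ u p - w q - doublingPenalty κ lam β η p q
  · have := mem_box p hp q hq h
    exact hmax (a := (p, q)) ⟨this.1, this.2⟩
  · have h1 := hmax (a := (p₀, p₀)) ⟨hp₀box, hp₀box⟩
    exact (not_le.1 h).le.trans (h0.trans h1)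

/-- Comparison principle. Since `H` is non-decreasing, the barriers `η / x_k` contribute with the
right sign in both differential inequalities, and no boundary condition is needed. -/
theorem comparison [DecidableEq ι] [Nonempty ι] {H : (ι → ℝ) → ℝ} {V : ℝ} (hmono : Monotone H)
    (hlip : ∀ y y', |H y - H y'| ≤ V * dualNorm1 (y - y'))
    {u w : ℝ × (ι → ℝ) → ℝ} {C : ℝ} (hC : 0 ≤ C)
    (hu : ContinuousOn u (Set.Ici 0 ×ˢ openOrthant ι))
    (hw : ContinuousOn w (Set.Ici 0 ×ˢ openOrthant ι))
    (hsub : IsViscositySubsolution H u) (hsup : IsViscositySupersolution H w)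
    (hS : ∀ p ∈ Set.Ici (0 : ℝ) ×ˢ openOrthant ι, ∀ q ∈ Set.Ici (0 : ℝ) ×ˢ openOrthant ι,
      u p - w q ≤ C * (∑ k, |p.2 k - q.2 k| + p.1 + q.1))
    {p₀ : ℝ × (ι → ℝ)} (hp₀ : p₀ ∈ Set.Ici (0 : ℝ) ×ˢ openOrthant ι) : u p₀ ≤ w p₀ := by
  by_contra hlt
  push Not at hlt
  set d : ℝ := ((Fintype.card ι : ℕ) : ℝ) with hd
  have hd0 : 0 < d := card_pos_real ι
  have ht0 : 0 ≤ p₀.1 := hp₀.1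
  obtain ⟨δ, hδ, hδe⟩ : ∃ δ : ℝ, 0 < δ ∧ u p₀ - w p₀ = 4 * δ :=
    ⟨(u p₀ - w p₀) / 4, by linarith, by ring⟩
  -- With these constants the penalization costs at most `3 δ` at `(p₀, p₀)`; moreover the error
  -- `V d β` caused by the linear growth term is less than `lam`, and `κ` absorbs the modulus of
  -- continuity at time zero.
  set lam : ℝ := δ / (1 + p₀.1 + p₀.1 ^ 2) with hlam
  have hlam0 : 0 < lam := by positivity
  set sx : ℝ := ∑ k, p₀.2 k with hsx
  have hsx0 : 0 ≤ sx := Finset.sum_nonneg fun k _ => (hp₀.2 k).le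
  set si : ℝ := ∑ k, (p₀.2 k)⁻¹ with hsi
  have hsi0 : 0 ≤ si := Finset.sum_nonneg fun k _ => inv_nonneg.2 (hp₀.2 k).le
  have hV0 : 0 ≤ V := lipschitz_const_nonneg hlip
  set β : ℝ := min (δ / (sx + 1)) (lam / (2 * (V * d + 1))) with hβ
  have hβ0 : 0 < β := by positivity
  set η : ℝ := δ / (2 * si + 1) with hη
  have hη0 : 0 < η := by positivity
  set κ : ℝ := (d + 1) * (C ^ 2 + 1) / δ with hκ
  have hκ0 : 0 < κ := by positivity
  have hstart : δ ≤ u p₀ - w p₀ - doublingPenalty κ lam β η p₀ p₀ := by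
    have h1 : lam * (p₀.1 + p₀.1 ^ 2) ≤ δ := by
      rw [hlam, div_mul_eq_mul_div, div_le_iff₀ (by positivity)]; nlinarith
    have h2 : β * sx ≤ δ := by
      have : β ≤ δ / (sx + 1) := min_le_left _ _
      rw [le_div_iff₀ (by positivity)] at this
      nlinarith
    have h3 : η * si + η * si ≤ δ := by
      have : η * (2 * si + 1) = δ := by rw [hη]; field_simp
      nlinarith
    unfold doublingPenalty
    simp only [sub_self, ne_eq, OfNat.ofNat_ne_zero, not_false_eq_true, zero_pow, mul_zero,
      Finset.sum_const_zero, zero_add, ← hsx, ← hsi]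
    linarith
  obtain ⟨p, hp, q, hq, hmax⟩ := exists_isMax_sub_doublingPenalty hκ0 hlam0 hβ0 hη0 hC hu hw hS
    hp₀ (hδ.le.trans hstart)
  have hval : δ ≤ u p - w q - doublingPenalty κ lam β η p q := hstart.trans (hmax p₀ hp₀ p₀ hp₀)
  -- A maximum with one of the times equal to zero has a too small value.
  have hquad : C * (∑ k, |p.2 k - q.2 k| + |p.1 - q.1|)
      - (κ * (p.1 - q.1) ^ 2 + κ * ∑ k, (p.2 k - q.2 k) ^ 2) < δ := by
    have hc : ∀ r : ℝ, C * |r| - κ * r ^ 2 ≤ C ^ 2 / (2 * κ) := fun r => by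
      have h1 := mul_sub_sq_le hκ0 C |r|
      rw [sq_abs] at h1
      have h2 : 0 ≤ κ / 2 * r ^ 2 := by positivity
      linarith
    have h1 := hc (p.1 - q.1)
    have h2 : C * ∑ k, |p.2 k - q.2 k| - κ * ∑ k, (p.2 k - q.2 k) ^ 2 ≤ d * (C ^ 2 / (2 * κ)) := by
      have := Finset.sum_le_sum (s := Finset.univ) fun k _ => hc (p.2 k - q.2 k)
      simpa [Finset.sum_sub_distrib, ← Finset.mul_sum, hd] using this
    have h3 : (d + 1) * (C ^ 2 / (2 * κ)) < δ := by
      have : (d + 1) * (C ^ 2 / (2 * κ)) = δ * (C ^ 2 / (2 * (C ^ 2 + 1))) := by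
        rw [hκ]; field_simp
      rw [this]
      refine mul_lt_of_lt_one_right hδ ?_
      rw [div_lt_one (by positivity)]
      nlinarith [sq_nonneg C]
    linarith
  have hrest : 0 ≤ lam * (p.1 + p.1 ^ 2) + β * ∑ k, p.2 k + η * ∑ k, (p.2 k)⁻¹
      + η * ∑ k, (q.2 k)⁻¹ := by
    have hp1 : 0 ≤ p.1 := hp.1
    have e4 : 0 ≤ β * ∑ k, p.2 k :=
      mul_nonneg hβ0.le (Finset.sum_nonneg fun k _ => (hp.2 k).le)
    have e5 : 0 ≤ η * ∑ k, (p.2 k)⁻¹ :=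
      mul_nonneg hη0.le (Finset.sum_nonneg fun k _ => inv_nonneg.2 (hp.2 k).le)
    have e6 : 0 ≤ η * ∑ k, (q.2 k)⁻¹ :=
      mul_nonneg hη0.le (Finset.sum_nonneg fun k _ => inv_nonneg.2 (hq.2 k).le)
    positivity
  have hfar : p.1 + q.1 ≠ |p.1 - q.1| := by
    intro h
    have h1 := hS p hp q hq
    rw [add_assoc, h] at h1
    unfold doublingPenalty at hval
    linarith
  have hp1 : 0 < p.1 := by
    rcases (show (0 : ℝ) ≤ p.1 from hp.1).eq_or_lt with h | h
    · exact absurd (by rw [← h, zero_add, zero_sub, abs_neg, abs_of_nonneg hq.1]) hfar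
    · exact h
  have hq1 : 0 < q.1 := by
    rcases (show (0 : ℝ) ≤ q.1 from hq.1).eq_or_lt with h | h
    · exact absurd (by rw [← h, add_zero, sub_zero, abs_of_nonneg hp.1]) hfar
    · exact h
  have hsubset : Set.Ioi (0 : ℝ) ×ˢ openOrthant ι ⊆ Set.Ici (0 : ℝ) ×ˢ openOrthant ι :=
    Set.prod_mono_left Set.Ioi_subset_Ici_self
  have hinv : ∀ c : ℝ, ContDiffOn ℝ ∞ (fun r : ℝ => c * r⁻¹) (Set.Ioi 0) := fun c =>
    contDiffOn_const.mul (contDiffOn_id.inv fun r hr => (ne_of_gt hr))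
  -- The differential inequality for `u` at `p`.
  have hU : 2 * κ * (p.1 - q.1) + lam * (1 + 2 * p.1)
      - H (fun k => 2 * κ * (p.2 k - q.2 k) + β - η * ((p.2 k) ^ 2)⁻¹) ≤ 0 := by
    set A : ℝ → ℝ := fun t => κ * (t - q.1) ^ 2 + lam * (t + t ^ 2) with hA
    set Bf : ι → ℝ → ℝ := fun k r => κ * (r - q.2 k) ^ 2 + β * r + η * r⁻¹ with hBf
    have hA' : HasDerivAt A (2 * κ * (p.1 - q.1) + lam * (1 + 2 * p.1)) p.1 := by
      have h1 := ((((hasDerivAt_id p.1).sub_const q.1).pow 2).const_mul κ).add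
        (((hasDerivAt_id p.1).add ((hasDerivAt_id p.1).pow 2)).const_mul lam)
      refine h1.congr_deriv ?_
      simp; ring
    have hB' : ∀ k, HasDerivAt (Bf k)
        (2 * κ * (p.2 k - q.2 k) + β - η * ((p.2 k) ^ 2)⁻¹) (p.2 k) := fun k => by
      have h1 := (((((hasDerivAt_id (p.2 k)).sub_const (q.2 k)).pow 2).const_mul κ).add
        ((hasDerivAt_id (p.2 k)).const_mul β)).add
        ((hasDerivAt_inv (hp.2 k).ne').const_mul η)
      refine h1.congr_deriv ?_
      simp; ring
    obtain ⟨e1, e2⟩ := dt_dx_separable hA' hB'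
    have := hsub.2 (fun z => A z.1 + ∑ k, Bf k (z.2 k))
      (contDiffOn_separable (by fun_prop) fun k =>
        ContDiffOn.add (ContDiff.contDiffOn (by fun_prop)) (hinv η)) p ⟨hp1, hp.2⟩
      (Filter.eventually_of_mem self_mem_nhdsWithin fun z hz => by
        have h1 := hmax z (hsubset hz) q hq
        unfold doublingPenalty at h1
        simp only [hA, hBf, Finset.sum_add_distrib, ← Finset.mul_sum]
        linarith)
    rwa [e1, e2] at this
  -- The differential inequality for `w` at `q`.
  have hW : 0 ≤ 2 * κ * (p.1 - q.1)
      - H (fun k => 2 * κ * (p.2 k - q.2 k) + η * ((q.2 k) ^ 2)⁻¹) := by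
    set A : ℝ → ℝ := fun t => -(κ * (p.1 - t) ^ 2) with hA
    set Bf : ι → ℝ → ℝ := fun k r => -(κ * (p.2 k - r) ^ 2) + (-η) * r⁻¹ with hBf
    have hA' : HasDerivAt A (2 * κ * (p.1 - q.1)) q.1 := by
      have h1 := ((((hasDerivAt_id q.1).const_sub p.1).pow 2).const_mul κ).neg
      refine h1.congr_deriv ?_
      simp; ring
    have hB' : ∀ k, HasDerivAt (Bf k)
        (2 * κ * (p.2 k - q.2 k) + η * ((q.2 k) ^ 2)⁻¹) (q.2 k) := fun k => by
      have h1 := ((((hasDerivAt_id (q.2 k)).const_sub (p.2 k)).pow 2).const_mul κ).neg.add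
        ((hasDerivAt_inv (hq.2 k).ne').const_mul (-η))
      refine h1.congr_deriv ?_
      simp; ring
    obtain ⟨e1, e2⟩ := dt_dx_separable hA' hB'
    have := hsup.2 (fun z => A z.1 + ∑ k, Bf k (z.2 k))
      (contDiffOn_separable (by fun_prop) fun k =>
        ContDiffOn.add (ContDiff.contDiffOn (by fun_prop)) (hinv (-η))) q ⟨hq1, hq.2⟩
      (Filter.eventually_of_mem self_mem_nhdsWithin fun z hz => by
        have h1 := hmax p hp z (hsubset hz)
        unfold doublingPenalty at h1
        simp only [hA, hBf, Finset.sum_add_distrib, ← Finset.mul_sum, Finset.sum_neg_distrib]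
        linarith)
    rwa [e1, e2] at this
  have m1 : H (fun k => 2 * κ * (p.2 k - q.2 k) + β - η * ((p.2 k) ^ 2)⁻¹)
      ≤ H (fun k => 2 * κ * (p.2 k - q.2 k) + β) := hmono fun k => by
    have := hp.2 k
    have : 0 ≤ η * ((p.2 k) ^ 2)⁻¹ := by positivity
    simp only; linarith
  have m2 : H (fun k => 2 * κ * (p.2 k - q.2 k))
      ≤ H (fun k => 2 * κ * (p.2 k - q.2 k) + η * ((q.2 k) ^ 2)⁻¹) := hmono fun k => by
    have := hq.2 k
    have : 0 ≤ η * ((q.2 k) ^ 2)⁻¹ := by positivity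
    simp only; linarith
  have m3 : H (fun k => 2 * κ * (p.2 k - q.2 k) + β) - H (fun k => 2 * κ * (p.2 k - q.2 k))
      ≤ V * (d * β) := by
    refine (le_abs_self _).trans ((hlip _ _).trans (mul_le_mul_of_nonneg_left ?_ hV0))
    refine dualNorm1_le_card_mul fun k => ?_
    simp [abs_of_pos hβ0]
  have m4 : V * (d * β) < lam := by
    have h1 : β ≤ lam / (2 * (V * d + 1)) := min_le_right _ _
    rw [le_div_iff₀ (by positivity)] at h1
    have : 0 ≤ V * (d * β) := by positivity
    linarith
  have : 0 ≤ lam * p.1 := by positivity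
  linarith

end Comparison

/-! ### Superjets -/

section Jets

variable {ι : Type} [Fintype ι]

/-- `(a, b)` belongs to the first-order superjet of `u` at `p`. The subjet of `u` is obtained from
the superjet of `-u`, with opposite signs. -/
def IsSuperjet (u : ℝ × (ι → ℝ) → ℝ) (p : ℝ × (ι → ℝ)) (a : ℝ) (b : ι → ℝ) : Prop :=
  ∀ ε > 0, ∀ᶠ q in 𝓝 p, u q ≤ u p + a * (q.1 - p.1) + b ⬝ᵥ (q.2 - p.2) + ε * ‖q - p‖

lemma fderiv_eq_dt_add_dx [DecidableEq ι] (φ : ℝ × (ι → ℝ) → ℝ) (p z : ℝ × (ι → ℝ)) :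
    fderiv ℝ φ p z = dt φ p * z.1 + dx φ p ⬝ᵥ z.2 := by
  have hz : z = z.1 • ((1 : ℝ), (0 : ι → ℝ))
      + ∑ k, z.2 k • ((0 : ℝ), (Pi.single k (1 : ℝ) : ι → ℝ)) := by
    refine Prod.ext ?_ ?_
    · simp [Prod.fst_sum]
    · simp only [Prod.snd_add, Prod.smul_snd, smul_zero, Prod.snd_sum, zero_add]
      ext j
      simp [Finset.sum_apply, Pi.single_apply]
  conv_lhs => rw [hz]
  simp only [map_add, map_smul, map_sum, smul_eq_mul]
  unfold dt dx dotProduct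
  rw [mul_comm]
  congr 1
  exact Finset.sum_congr rfl fun k _ => mul_comm _ _

lemma eventually_le_of_differentiableAt [DecidableEq ι] {φ : ℝ × (ι → ℝ) → ℝ} {p : ℝ × (ι → ℝ)}
    (hφ : DifferentiableAt ℝ φ p) {ε : ℝ} (hε : 0 < ε) :
    ∀ᶠ q in 𝓝 p, |φ q - φ p - (dt φ p * (q.1 - p.1) + dx φ p ⬝ᵥ (q.2 - p.2))| ≤ ε * ‖q - p‖ := by
  have h := (hasFDerivAt_iff_isLittleO.1 hφ.hasFDerivAt).def hε
  filter_upwards [h] with q hq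
  rw [fderiv_eq_dt_add_dx, Real.norm_eq_abs] at hq
  exact hq

lemma isSuperjet_of_isLocalMax [DecidableEq ι] {u φ : ℝ × (ι → ℝ) → ℝ} {p : ℝ × (ι → ℝ)}
    (hφ : DifferentiableAt ℝ φ p) (h : IsLocalMax (fun q => u q - φ q) p) :
    IsSuperjet u p (dt φ p) (dx φ p) := by
  intro ε hε
  filter_upwards [h, eventually_le_of_differentiableAt hφ hε] with q h1 h2
  have := (abs_le.1 h2).2
  linarith

lemma isSuperjet_neg_of_isLocalMin [DecidableEq ι] {u φ : ℝ × (ι → ℝ) → ℝ} {p : ℝ × (ι → ℝ)}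
    (hφ : DifferentiableAt ℝ φ p) (h : IsLocalMin (fun q => u q - φ q) p) :
    IsSuperjet (-u) p (-dt φ p) (-dx φ p) := by
  intro ε hε
  filter_upwards [h, eventually_le_of_differentiableAt hφ hε] with q h1 h2
  have := (abs_le.1 h2).1
  simp only [Pi.neg_apply, neg_dotProduct]
  linarith

/-- A pointwise inequality along the superjets yields the subsolution property. -/
lemma isViscositySubsolution_of_superjet [DecidableEq ι] {H : (ι → ℝ) → ℝ}
    {u : ℝ × (ι → ℝ) → ℝ} (hu : ContinuousOn u (Set.Ici 0 ×ˢ openOrthant ι))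
    (h : ∀ p ∈ Set.Ioi (0 : ℝ) ×ˢ openOrthant ι, ∀ a b, IsSuperjet u p a b → a ≤ H b) :
    IsViscositySubsolution H u := by
  refine ⟨hu.upperSemicontinuousOn, fun φ hφ p hp hmax => ?_⟩
  have hopen : IsOpen (Set.Ioi (0 : ℝ) ×ˢ openOrthant ι) := isOpen_Ioi.prod isOpen_openOrthant
  have hd : DifferentiableAt ℝ φ p :=
    (hφ.contDiffAt (hopen.mem_nhds hp)).differentiableAt (by simp)
  have := h p hp _ _ (isSuperjet_of_isLocalMax hd (hmax.isLocalMax (hopen.mem_nhds hp)))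
  linarith

lemma isViscositySupersolution_of_superjet [DecidableEq ι] {H : (ι → ℝ) → ℝ}
    {u : ℝ × (ι → ℝ) → ℝ} (hu : ContinuousOn u (Set.Ici 0 ×ˢ openOrthant ι))
    (h : ∀ p ∈ Set.Ioi (0 : ℝ) ×ˢ openOrthant ι, ∀ a b,
      IsSuperjet (-u) p (-a) (-b) → H b ≤ a) :
    IsViscositySupersolution H u := by
  refine ⟨hu.lowerSemicontinuousOn, fun φ hφ p hp hmin => ?_⟩
  have hopen : IsOpen (Set.Ioi (0 : ℝ) ×ˢ openOrthant ι) := isOpen_Ioi.prod isOpen_openOrthant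
  have hd : DifferentiableAt ℝ φ p :=
    (hφ.contDiffAt (hopen.mem_nhds hp)).differentiableAt (by simp)
  have := h p hp _ _ (isSuperjet_neg_of_isLocalMin hd (hmin.isLocalMin (hopen.mem_nhds hp)))
  linarith

end Jets

/-! ### A monotone finite-difference scheme -/

section Scheme

variable {ι : Type} [Fintype ι] [DecidableEq ι]

/-- The forward finite-difference gradient with mesh `h`. -/
noncomputable def fwdDiff (h : ℝ) (u : (ι → ℝ) → ℝ) (x : ι → ℝ) : ι → ℝ :=
  fun k => (u (x + Pi.single k h) - u x) / h

/-- One explicit Euler step, of length `τ`, for `∂_t u = H(∇u)` with forward differences. -/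
noncomputable def schemeStep (H : (ι → ℝ) → ℝ) (h τ : ℝ) (u : (ι → ℝ) → ℝ) (x : ι → ℝ) : ℝ :=
  u x + τ * H (fwdDiff h u x)

/-- Monotonicity of the scheme. Forward differences are increasing in the values at the shifted
points, and the condition `τ * (V * d) ≤ h` compensates for the dependence on the base point. -/
lemma schemeStep_le [Nonempty ι] {H : (ι → ℝ) → ℝ} {V h τ : ℝ} (hmono : Monotone H)
    (hlip : ∀ y y', |H y - H y'| ≤ V * dualNorm1 (y - y')) (hV : 0 ≤ V) (hh : 0 < h) (hτ : 0 ≤ τ)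
    (hcfl : τ * (V * Fintype.card ι) ≤ h) {u w : (ι → ℝ) → ℝ} {x x' : ι → ℝ} {c : ℝ}
    (h0 : u x ≤ w x' + c)
    (h1 : ∀ k, u (x + Pi.single k h) ≤ w (x' + Pi.single k h) + c) :
    schemeStep H h τ u x ≤ schemeStep H h τ w x' + c := by
  set δ := w x' + c - u x with hδ
  have hδ0 : 0 ≤ δ := by linarith
  have e1 : H (fwdDiff h u x) ≤ H (fun k => fwdDiff h w x' k + δ / h) := hmono fun k => by
    simp only [fwdDiff]
    rw [← add_div]
    refine div_le_div_of_nonneg_right ?_ hh.le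
    have := h1 k
    linarith
  have e2 : H (fun k => fwdDiff h w x' k + δ / h) - H (fwdDiff h w x')
      ≤ V * (Fintype.card ι * (δ / h)) := by
    refine (le_abs_self _).trans ((hlip _ _).trans (mul_le_mul_of_nonneg_left ?_ hV))
    refine dualNorm1_le_card_mul fun k => ?_
    simp [abs_of_nonneg hδ0, abs_of_pos hh, abs_div]
  have e3 : τ * (V * (Fintype.card ι * (δ / h))) ≤ δ := by
    have : τ * (V * (Fintype.card ι * (δ / h))) = τ * (V * Fintype.card ι) * δ / h := by ring
    rw [this, div_le_iff₀ hh, mul_comm δ h]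
    exact mul_le_mul_of_nonneg_right hcfl hδ0
  have e4 := mul_le_mul_of_nonneg_left
    (show H (fwdDiff h u x) ≤ H (fwdDiff h w x') + V * (Fintype.card ι * (δ / h)) by linarith) hτ
  unfold schemeStep
  linarith

/-- The scheme preserves every bound on the increments along a fixed vector `z`, on any set that is
stable under the shifts of the scheme. -/
lemma iterate_schemeStep_add_le [Nonempty ι] {H : (ι → ℝ) → ℝ} {V h τ : ℝ} (hmono : Monotone H)
    (hlip : ∀ y y', |H y - H y'| ≤ V * dualNorm1 (y - y')) (hV : 0 ≤ V) (hh : 0 < h) (hτ : 0 ≤ τ)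
    (hcfl : τ * (V * Fintype.card ι) ≤ h) {u : (ι → ℝ) → ℝ} {S : Set (ι → ℝ)}
    (hS : ∀ x ∈ S, ∀ k, x + Pi.single k h ∈ S) {z : ι → ℝ} {c : ℝ}
    (h0 : ∀ x ∈ S, x + z ∈ S → u (x + z) ≤ u x + c) (n : ℕ) :
    ∀ x ∈ S, x + z ∈ S →
      (schemeStep H h τ)^[n] u (x + z) ≤ (schemeStep H h τ)^[n] u x + c := by
  induction n with
  | zero => simpa using h0
  | succ n ih =>
    intro x hx hxz
    simp only [Function.iterate_succ_apply']
    refine schemeStep_le hmono hlip hV hh hτ hcfl (ih x hx hxz) fun k => ?_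
    have := hS _ hxz k
    rw [add_right_comm] at this ⊢
    exact ih _ (hS x hx k) this

lemma norm1_single [Nonempty ι] (k : ι) (h : ℝ) :
    norm1 (Pi.single k h : ι → ℝ) = |h| / Fintype.card ι := by
  unfold norm1
  rw [Finset.sum_eq_single k (fun j _ hj => by simp [Pi.single_eq_of_ne hj]) (by simp)]
  simp [div_eq_inv_mul]

lemma dualNorm1_fwdDiff_le [Nonempty ι] {h L : ℝ} (hh : 0 < h) {u : (ι → ℝ) → ℝ}
    (hu : ∀ x y, |u x - u y| ≤ L * norm1 (x - y)) (x : ι → ℝ) :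
    dualNorm1 (fwdDiff h u x) ≤ L := by
  have hd := card_pos_real ι
  refine dualNorm1_le_iff.2 fun k => ?_
  have h1 := hu (x + Pi.single k h) x
  rw [add_sub_cancel_left, norm1_single, abs_of_pos hh] at h1
  unfold fwdDiff
  rw [abs_div, abs_of_pos hh, ← mul_div_assoc, div_le_iff₀ hh]
  calc (Fintype.card ι : ℝ) * |u (x + Pi.single k h) - u x|
      ≤ Fintype.card ι * (L * (h / Fintype.card ι)) := mul_le_mul_of_nonneg_left h1 hd.le
    _ = L * h := by field_simp

lemma iterate_schemeStep_lipschitz [Nonempty ι] {H : (ι → ℝ) → ℝ} {V h τ L : ℝ}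
    (hmono : Monotone H) (hlip : ∀ y y', |H y - H y'| ≤ V * dualNorm1 (y - y')) (hV : 0 ≤ V)
    (hh : 0 < h) (hτ : 0 ≤ τ) (hcfl : τ * (V * Fintype.card ι) ≤ h) {u : (ι → ℝ) → ℝ}
    (hu : ∀ x y, |u x - u y| ≤ L * norm1 (x - y)) (n : ℕ) (x y : ι → ℝ) :
    |(schemeStep H h τ)^[n] u x - (schemeStep H h τ)^[n] u y| ≤ L * norm1 (x - y) := by
  have key : ∀ x y : ι → ℝ, (schemeStep H h τ)^[n] u x - (schemeStep H h τ)^[n] u y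
      ≤ L * norm1 (x - y) := fun x y => by
    have := iterate_schemeStep_add_le hmono hlip hV hh hτ hcfl (u := u) (S := Set.univ)
      (fun _ _ _ => trivial) (z := x - y) (c := L * norm1 (x - y)) (fun w _ _ => by
        have := (abs_le.1 (hu (w + (x - y)) w)).2
        rw [add_sub_cancel_left] at this
        linarith) n y trivial trivial
    rw [add_sub_cancel] at this
    linarith
  have hs : norm1 (y - x) = norm1 (x - y) := by
    unfold norm1; simp only [Pi.sub_apply, abs_sub_comm]
  have := key y x
  rw [hs] at this
  exact abs_le.2 ⟨by linarith, key x y⟩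

lemma abs_iterate_schemeStep_sub_le [Nonempty ι] {H : (ι → ℝ) → ℝ} {V h τ L : ℝ}
    (hmono : Monotone H) (hlip : ∀ y y', |H y - H y'| ≤ V * dualNorm1 (y - y')) (hV : 0 ≤ V)
    (hh : 0 < h) (hτ : 0 ≤ τ) (hcfl : τ * (V * Fintype.card ι) ≤ h) {u : (ι → ℝ) → ℝ}
    (hu : ∀ x y, |u x - u y| ≤ L * norm1 (x - y)) (n k : ℕ) (x : ι → ℝ) :
    |(schemeStep H h τ)^[n + k] u x - (schemeStep H h τ)^[n] u x| ≤ (|H 0| + V * L) * (τ * k) := by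
  induction k with
  | zero => simp
  | succ k ih =>
    rw [← add_assoc, Function.iterate_succ_apply']
    set w := (schemeStep H h τ)^[n + k] u with hw
    have h1 : |H (fwdDiff h w x)| ≤ |H 0| + V * L := by
      have h2 := hlip (fwdDiff h w x) 0
      rw [sub_zero] at h2
      have h3 := dualNorm1_fwdDiff_le hh
        (iterate_schemeStep_lipschitz hmono hlip hV hh hτ hcfl hu (n + k)) x
      have h4 := mul_le_mul_of_nonneg_left h3 hV
      have h5 := abs_sub_abs_le_abs_sub (H (fwdDiff h w x)) (H 0)
      linarith
    have h2 : schemeStep H h τ w x - (schemeStep H h τ)^[n] u x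
        = (w x - (schemeStep H h τ)^[n] u x) + τ * H (fwdDiff h w x) := by
      unfold schemeStep; ring
    rw [h2]
    refine (abs_add_le _ _).trans ?_
    rw [abs_mul, abs_of_nonneg hτ]
    have := mul_le_mul_of_nonneg_left h1 hτ
    push_cast
    linarith

/-- The meshes `1 / (j + 1)` along which the scheme is refined. -/
noncomputable def mesh (j : ℕ) : ℝ := 1 / ((j : ℝ) + 1)

/-- The time step attached to the mesh of index `j`, at the limit of the stability condition. -/
noncomputable def timeStep (ι : Type) [Fintype ι] (V : ℝ) (j : ℕ) : ℝ :=
  mesh j / (V * Fintype.card ι)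

/-- The approximate solution computed by the scheme, piecewise constant in time; it equals `u₀` at
negative times. -/
noncomputable def approxSol (H : (ι → ℝ) → ℝ) (V : ℝ) (u₀ : (ι → ℝ) → ℝ) (j : ℕ)
    (p : ℝ × (ι → ℝ)) : ℝ :=
  (schemeStep H (mesh j) (timeStep ι V j))^[⌊p.1 / timeStep ι V j⌋₊] u₀ p.2

lemma mesh_pos (j : ℕ) : 0 < mesh j := by unfold mesh; positivity

lemma timeStep_pos {ι : Type} [Fintype ι] [Nonempty ι] {V : ℝ} (hV : 0 < V) (j : ℕ) :
    0 < timeStep ι V j :=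
  div_pos (mesh_pos j) (mul_pos hV (card_pos_real ι))

lemma timeStep_mul {ι : Type} [Fintype ι] [Nonempty ι] {V : ℝ} (hV : 0 < V) (j : ℕ) :
    timeStep ι V j * (V * Fintype.card ι) ≤ mesh j :=
  (div_mul_cancel₀ _ (mul_pos hV (card_pos_real ι)).ne').le

lemma tendsto_mesh : Tendsto mesh atTop (𝓝 0) := tendsto_one_div_add_atTop_nhds_zero_nat

lemma tendsto_timeStep {ι : Type} [Fintype ι] {V : ℝ} :
    Tendsto (timeStep ι V) atTop (𝓝 0) := by
  have := (tendsto_mesh).div_const (V * Fintype.card ι)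
  rwa [zero_div] at this

lemma abs_approxSol_sub_le [Nonempty ι] {H : (ι → ℝ) → ℝ} {V L : ℝ} (hmono : Monotone H)
    (hlip : ∀ y y', |H y - H y'| ≤ V * dualNorm1 (y - y')) (hV : 0 < V) (hL : 0 ≤ L)
    {u₀ : (ι → ℝ) → ℝ} (hu : ∀ x y, |u₀ x - u₀ y| ≤ L * norm1 (x - y)) (j : ℕ)
    (p q : ℝ × (ι → ℝ)) :
    |approxSol H V u₀ j p - approxSol H V u₀ j q| ≤
      (|H 0| + V * L) * (|p.1 - q.1| + timeStep ι V j) + L * norm1 (p.2 - q.2) := by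
  set τ := timeStep ι V j with hτ
  have hτ0 : 0 < τ := timeStep_pos hV j
  have hC : 0 ≤ |H 0| + V * L := by positivity
  have time : ∀ s t : ℝ, s ≤ t → ∀ x, |approxSol H V u₀ j (t, x) - approxSol H V u₀ j (s, x)| ≤
      (|H 0| + V * L) * (|t - s| + τ) := fun s t hst x => by
    have hfl : ⌊s / τ⌋₊ ≤ ⌊t / τ⌋₊ := Nat.floor_mono (div_le_div_of_nonneg_right hst hτ0.le)
    obtain ⟨k, hk⟩ := Nat.exists_eq_add_of_le hfl
    have h1 := abs_iterate_schemeStep_sub_le hmono hlip hV.le (mesh_pos j) hτ0.le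
      (timeStep_mul hV j) hu ⌊s / τ⌋₊ k x
    unfold approxSol
    simp only [← hτ]
    rw [hk]
    refine h1.trans (mul_le_mul_of_nonneg_left ?_ hC)
    rw [abs_of_nonneg (by linarith)]
    have h2 : s / τ < ⌊s / τ⌋₊ + 1 := Nat.lt_floor_add_one _
    rcases k.eq_zero_or_pos with rfl | hkpos
    · simp only [Nat.cast_zero, mul_zero]; linarith
    · have h3 : (⌊t / τ⌋₊ : ℝ) ≤ t / τ := Nat.floor_le (by
        by_contra hneg
        have := Nat.floor_of_nonpos (not_le.1 hneg).le
        omega)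
      rw [hk] at h3
      push_cast at h3
      have h4 : (k : ℝ) ≤ (t - s) / τ + 1 := by rw [sub_div]; linarith
      have h5 := mul_le_mul_of_nonneg_left h4 hτ0.le
      have h6 : τ * ((t - s) / τ + 1) = t - s + τ := by field_simp
      linarith
  have htime : |approxSol H V u₀ j p - approxSol H V u₀ j (q.1, p.2)| ≤
      (|H 0| + V * L) * (|p.1 - q.1| + τ) := by
    rcases le_total q.1 p.1 with h | h
    · exact time _ _ h p.2
    · rw [abs_sub_comm, abs_sub_comm p.1]; exact time _ _ h p.2
  have hspace : |approxSol H V u₀ j (q.1, p.2) - approxSol H V u₀ j q| ≤ L * norm1 (p.2 - q.2) :=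
    iterate_schemeStep_lipschitz hmono hlip hV.le (mesh_pos j) hτ0.le (timeStep_mul hV j) hu _ _ _
  have := abs_sub_le (approxSol H V u₀ j p) (approxSol H V u₀ j (q.1, p.2))
    (approxSol H V u₀ j q)
  linarith

/-- `u` is the pointwise limit of the scheme along a fixed non-principal ultrafilter. The use of
an ultrafilter replaces the extraction of a convergent subsequence. -/
def IsSchemeLimit (H : (ι → ℝ) → ℝ) (V : ℝ) (u₀ : (ι → ℝ) → ℝ) (u : ℝ × (ι → ℝ) → ℝ) : Prop :=
  ∀ p, Tendsto (fun j => approxSol H V u₀ j p) (hyperfilter ℕ) (𝓝 (u p))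

lemma hyperfilter_le_atTop : (hyperfilter ℕ : Filter ℕ) ≤ atTop := by
  rw [← Nat.cofinite_eq_atTop]; exact hyperfilter_le_cofinite

lemma timeStep_le_timeStep_zero {ι : Type} [Fintype ι] [Nonempty ι] {V : ℝ} (hV : 0 < V) (j : ℕ) :
    timeStep ι V j ≤ timeStep ι V 0 := by
  refine div_le_div_of_nonneg_right ?_ (mul_pos hV (card_pos_real ι)).le
  unfold mesh
  have : (0 : ℝ) ≤ j := Nat.cast_nonneg j
  rw [Nat.cast_zero]
  exact one_div_le_one_div_of_le (by norm_num) (by linarith)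

lemma approxSol_zero [Nonempty ι] {H : (ι → ℝ) → ℝ} {V : ℝ} {u₀ : (ι → ℝ) → ℝ} (j : ℕ)
    (x : ι → ℝ) : approxSol H V u₀ j (0, x) = u₀ x := by
  simp [approxSol]

lemma exists_isSchemeLimit [Nonempty ι] {H : (ι → ℝ) → ℝ} {V L : ℝ} (hmono : Monotone H)
    (hlip : ∀ y y', |H y - H y'| ≤ V * dualNorm1 (y - y')) (hV : 0 < V) (hL : 0 ≤ L)
    {u₀ : (ι → ℝ) → ℝ} (hu : ∀ x y, |u₀ x - u₀ y| ≤ L * norm1 (x - y)) :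
    ∃ u, IsSchemeLimit H V u₀ u := by
  have : ∀ p, ∃ y, Tendsto (fun j => approxSol H V u₀ j p) (hyperfilter ℕ) (𝓝 y) := by
    intro p
    set B := (|H 0| + V * L) * (|p.1 - 0| + timeStep ι V 0) with hB
    have hmem : ∀ j, approxSol H V u₀ j p ∈ Metric.closedBall (u₀ p.2) B := fun j => by
      have h := abs_approxSol_sub_le hmono hlip hV hL hu j p (0, p.2)
      rw [approxSol_zero] at h
      rw [Metric.mem_closedBall, Real.dist_eq]
      refine h.trans ?_
      have h1 : norm1 (p.2 - p.2) = 0 := by simp [norm1]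
      simp only [h1, mul_zero, add_zero, hB]
      have := timeStep_le_timeStep_zero (ι := ι) hV j
      gcongr
    obtain ⟨y, -, hy⟩ := (isCompact_closedBall (u₀ p.2) B).ultrafilter_le_nhds
      ((hyperfilter ℕ).map fun j => approxSol H V u₀ j p)
      (by rw [Ultrafilter.coe_map, le_principal_iff, mem_map]; exact Eventually.of_forall hmem)
    exact ⟨y, hy⟩
  choose u hu using this
  exact ⟨u, hu⟩

namespace IsSchemeLimit

variable {H : (ι → ℝ) → ℝ} {V L : ℝ} {u₀ : (ι → ℝ) → ℝ} {u : ℝ × (ι → ℝ) → ℝ}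

lemma initial [Nonempty ι] (h : IsSchemeLimit H V u₀ u) (x : ι → ℝ) : u (0, x) = u₀ x := by
  have := h (0, x)
  simp only [approxSol_zero] at this
  exact tendsto_nhds_unique this tendsto_const_nhds

lemma abs_sub_le [Nonempty ι] (h : IsSchemeLimit H V u₀ u) (hmono : Monotone H)
    (hlip : ∀ y y', |H y - H y'| ≤ V * dualNorm1 (y - y')) (hV : 0 < V) (hL : 0 ≤ L)
    (hu : ∀ x y, |u₀ x - u₀ y| ≤ L * norm1 (x - y)) (p q : ℝ × (ι → ℝ)) :
    |u p - u q| ≤ (|H 0| + V * L) * |p.1 - q.1| + L * norm1 (p.2 - q.2) := by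
  have h1 := ((h p).sub (h q)).abs
  have h2 : Tendsto (fun j => (|H 0| + V * L) * (|p.1 - q.1| + timeStep ι V j)
      + L * norm1 (p.2 - q.2)) (hyperfilter ℕ)
      (𝓝 ((|H 0| + V * L) * (|p.1 - q.1| + 0) + L * norm1 (p.2 - q.2))) :=
    ((tendsto_const_nhds.add (tendsto_timeStep.mono_left hyperfilter_le_atTop)).const_mul _).add
      tendsto_const_nhds
  rw [add_zero] at h2
  exact le_of_tendsto_of_tendsto' h1 h2 fun j => abs_approxSol_sub_le hmono hlip hV hL hu j p q

lemma add_le [Nonempty ι] (h : IsSchemeLimit H V u₀ u) (hmono : Monotone H)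
    (hlip : ∀ y y', |H y - H y'| ≤ V * dualNorm1 (y - y')) (hV : 0 < V) {z : ι → ℝ} {c : ℝ}
    (h0 : ∀ x ∈ openOrthant ι, x + z ∈ openOrthant ι → u₀ (x + z) ≤ u₀ x + c) (t : ℝ) :
    ∀ x ∈ openOrthant ι, x + z ∈ openOrthant ι → u (t, x + z) ≤ u (t, x) + c := by
  intro x hx hxz
  refine le_of_tendsto_of_tendsto' (h (t, x + z)) ((h (t, x)).add tendsto_const_nhds) fun j => ?_
  refine iterate_schemeStep_add_le hmono hlip hV.le (mesh_pos j) (timeStep_pos hV j).le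
    (timeStep_mul hV j) (S := openOrthant ι) (fun y hy k i => ?_) h0 _ x hx hxz
  have h1 := hy i
  have h2 : 0 ≤ (Pi.single k (mesh j) : ι → ℝ) i := by
    by_cases hik : i = k
    · subst hik; simpa using (mesh_pos j).le
    · simp [Pi.single_eq_of_ne hik]
  simp only [Pi.add_apply]
  linarith

/-- The convergence of the scheme is uniform on compact sets. -/
lemma eventually_forall_abs_sub_le [Nonempty ι] (h : IsSchemeLimit H V u₀ u) (hmono : Monotone H)
    (hlip : ∀ y y', |H y - H y'| ≤ V * dualNorm1 (y - y')) (hV : 0 < V) (hL : 0 ≤ L)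
    (hu : ∀ x y, |u₀ x - u₀ y| ≤ L * norm1 (x - y)) {K : Set (ℝ × (ι → ℝ))} (hK : IsCompact K)
    {δ : ℝ} (hδ : 0 < δ) :
    ∀ᶠ j in (hyperfilter ℕ : Filter ℕ), ∀ q ∈ K, |approxSol H V u₀ j q - u q| ≤ δ := by
  refine hK.induction_on (p := fun s => ∀ᶠ j in (hyperfilter ℕ : Filter ℕ), ∀ q ∈ s,
    |approxSol H V u₀ j q - u q| ≤ δ) (by simp) (fun s t hst ht => ht.mono fun j hj q hq =>
      hj q (hst hq)) (fun s t hs ht => (hs.and ht).mono fun j hj q hq =>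
      hq.elim (hj.1 q) (hj.2 q)) fun p _ => ?_
  set C := |H 0| + V * L with hC
  have hcont : Continuous fun q : ℝ × (ι → ℝ) => C * |q.1 - p.1| + L * norm1 (q.2 - p.2) := by
    unfold norm1; fun_prop
  have hsmall : ∀ᶠ q in 𝓝 p, C * |q.1 - p.1| + L * norm1 (q.2 - p.2) < δ / 4 :=
    hcont.continuousAt.eventually_lt continuousAt_const (by simp [norm1, hδ])
  refine ⟨{q | C * |q.1 - p.1| + L * norm1 (q.2 - p.2) < δ / 4},
    mem_nhdsWithin_of_mem_nhds hsmall, ?_⟩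
  have h1 : ∀ᶠ j in (hyperfilter ℕ : Filter ℕ), |approxSol H V u₀ j p - u p| < δ / 4 := by
    have := ((h p).sub_const (u p)).abs
    rw [sub_self, abs_zero] at this
    exact this.eventually_lt_const (by positivity)
  have h2 : ∀ᶠ j in (hyperfilter ℕ : Filter ℕ), C * timeStep ι V j < δ / 4 := by
    have := ((tendsto_timeStep (ι := ι) (V := V)).mono_left hyperfilter_le_atTop).const_mul C
    rw [mul_zero] at this
    exact this.eventually_lt_const (by positivity)
  filter_upwards [h1, h2] with j hj1 hj2 q hq
  have e1 := abs_approxSol_sub_le hmono hlip hV hL hu j q p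
  have e2 := h.abs_sub_le hmono hlip hV hL hu q p
  rw [← hC] at e1 e2
  change _ < _ at hq
  rw [abs_le] at *
  rw [abs_lt] at hj1
  constructor <;> linarith

lemma neg (h : IsSchemeLimit H V u₀ u) : IsSchemeLimit (fun b => -H (-b)) V (-u₀) (-u) := by
  have step : ∀ (η τ : ℝ) (w : (ι → ℝ) → ℝ),
      schemeStep (fun b => -H (-b)) η τ (-w) = -schemeStep H η τ w := fun η τ w => by
    ext x
    have : -fwdDiff η (-w) x = fwdDiff η w x := by
      ext k; simp only [fwdDiff, Pi.neg_apply]; ring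
    simp only [schemeStep, Pi.neg_apply, this]
    ring
  have iter : ∀ (η τ : ℝ) (n : ℕ), (schemeStep (fun b => -H (-b)) η τ)^[n] (-u₀)
      = -(schemeStep H η τ)^[n] u₀ := fun η τ n => by
    induction n with
    | zero => rfl
    | succ n ih => rw [Function.iterate_succ_apply', Function.iterate_succ_apply', ih, step]
  intro p
  have : (fun j => approxSol (fun b => -H (-b)) V (-u₀) j p)
      = fun j => -approxSol H V u₀ j p := by
    ext j; simp only [approxSol, iter, Pi.neg_apply]
  rw [this]
  exact (h p).neg

/-- Consistency of the scheme: its limits satisfy the equation along their superjets. The linear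
function given by the superjet is perturbed by a small cone, so that the perturbed test function
touches the approximate solutions from above near `p`, and the scheme is monotone. -/
lemma le_of_isSuperjet [Nonempty ι] (h : IsSchemeLimit H V u₀ u) (hmono : Monotone H)
    (hlip : ∀ y y', |H y - H y'| ≤ V * dualNorm1 (y - y')) (hV : 0 < V) (hL : 0 ≤ L)
    (hu : ∀ x y, |u₀ x - u₀ y| ≤ L * norm1 (x - y)) {p : ℝ × (ι → ℝ)} (hp : 0 < p.1)
    {a : ℝ} {b : ι → ℝ} (hab : IsSuperjet u p a b) : a ≤ H b := by
  set d : ℝ := ((Fintype.card ι : ℕ) : ℝ) with hd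
  have hd0 : 0 < d := card_pos_real ι
  suffices hs : ∀ ε > 0, a ≤ H b + ε * (3 + 2 * V * d) by
    refine le_of_forall_pos_le_add fun e he => ?_
    have := hs (e / (3 + 2 * V * d)) (by positivity)
    rwa [div_mul_cancel₀ _ (by positivity)] at this
  intro ε hε
  obtain ⟨r₁, hr₁, hball⟩ := Metric.nhds_basis_closedBall.eventually_iff.1 (hab ε hε)
  obtain ⟨r, hr, hrr₁, hrp⟩ : ∃ r > 0, r ≤ r₁ ∧ r ≤ p.1 :=
    ⟨min r₁ p.1, lt_min hr₁ hp, min_le_left _ _, min_le_right _ _⟩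
  set χ : ℝ × (ι → ℝ) → ℝ := fun q => a * q.1 + b ⬝ᵥ q.2 + 2 * ε * ‖q - p‖ with hχ
  have hχp : χ p = a * p.1 + b ⬝ᵥ p.2 := by simp [hχ]
  have hjet : ∀ q ∈ Metric.closedBall p r, u q - χ q ≤ u p - χ p - ε * ‖q - p‖ := fun q hq => by
    have h1 := hball (Metric.closedBall_subset_closedBall hrr₁ hq)
    rw [hχp]
    simp only [hχ]
    rw [dotProduct_sub] at h1
    linarith
  have hT : Tendsto (timeStep ι V) (hyperfilter ℕ) (𝓝 0) :=
    tendsto_timeStep.mono_left hyperfilter_le_atTop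
  have hM : Tendsto mesh (hyperfilter ℕ) (𝓝 0) := tendsto_mesh.mono_left hyperfilter_le_atTop
  have hT2 : Tendsto (fun j => (|a| + 2 * ε) * timeStep ι V j) (hyperfilter ℕ) (𝓝 0) := by
    simpa using hT.const_mul (|a| + 2 * ε)
  obtain ⟨j, hunif, hτ2, hτr, hhr⟩ := ((h.eventually_forall_abs_sub_le hmono hlip hV hL hu
    (isCompact_closedBall p r) (δ := ε * r / 8) (by positivity)).and
    ((hT2.eventually_lt_const (u := ε * r / 8) (by positivity)).and
    ((hT.eventually_lt_const (u := r / 2) (by positivity)).and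
    (hM.eventually_lt_const (u := r / 2) (by positivity))))).exists
  set τ := timeStep ι V j with hτ
  have hτ0 : 0 < τ := timeStep_pos hV j
  set η := mesh j with hη
  have hη0 : 0 < η := mesh_pos j
  set w : ℕ → (ι → ℝ) → ℝ := fun n => (schemeStep H η τ)^[n] u₀ with hw
  have hgrid : ∀ (n : ℕ) (y : ι → ℝ), approxSol H V u₀ j (τ * n, y) = w n y := fun n y => by
    simp only [approxSol, ← hτ, ← hη, hw]
    rw [mul_div_cancel_left₀ _ hτ0.ne', Nat.floor_natCast]
  set G : Set ℝ := {s | ∃ (n : ℕ) (y : ι → ℝ), (τ * n, y) ∈ Metric.closedBall p r ∧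
    s = w n y - χ (τ * n, y)} with hG
  have hGbdd : BddAbove G := by
    refine ⟨u p - χ p + ε * r / 8, ?_⟩
    rintro s ⟨n, y, hy, rfl⟩
    have h1 := hjet _ hy
    have h2 := (abs_le.1 (hunif _ hy)).2
    rw [hgrid] at h2
    have h3 : 0 ≤ ε * ‖(τ * n, y) - p‖ := by positivity
    linarith
  -- The value at the grid point just below `p` in time bounds the supremum from below.
  obtain ⟨s₀, hs₀G, hs₀⟩ : ∃ s ∈ G, u p - χ p - ε * r / 4 ≤ s := by
    set n := ⌊p.1 / τ⌋₊ with hn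
    have h1 : (n : ℝ) ≤ p.1 / τ := Nat.floor_le (by positivity)
    have h2 : p.1 / τ < n + 1 := Nat.lt_floor_add_one _
    rw [le_div_iff₀ hτ0] at h1
    rw [div_lt_iff₀ hτ0] at h2
    have hdist : ‖(τ * (n : ℝ), p.2) - p‖ ≤ τ := by
      rw [Prod.norm_def]
      simp only [Prod.fst_sub, Prod.snd_sub, sub_self, norm_zero]
      refine max_le ?_ hτ0.le
      rw [Real.norm_eq_abs, abs_le]
      constructor <;> linarith
    refine ⟨_, ⟨n, p.2, ?_, rfl⟩, ?_⟩
    · rw [Metric.mem_closedBall, dist_eq_norm]; linarith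
    · have h3 := (abs_le.1 (hunif p (Metric.mem_closedBall_self hr.le))).1
      have h4 : approxSol H V u₀ j p = w n p.2 := rfl
      rw [h4] at h3
      have h5 : χ (τ * n, p.2) ≤ χ p + (|a| + 2 * ε) * τ := by
        rw [hχp]
        simp only [hχ]
        have e1 : a * (τ * n - p.1) ≤ |a| * τ := by
          refine (le_abs_self _).trans ?_
          rw [abs_mul]
          refine mul_le_mul_of_nonneg_left ?_ (abs_nonneg a)
          rw [abs_le]; constructor <;> linarith
        have e2 := mul_le_mul_of_nonneg_left hdist (show 0 ≤ 2 * ε by positivity)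
        linarith
      linarith
  set M := sSup G with hMdef
  have hθ : 0 < min (ε * τ) (ε * r / 16) := by positivity
  obtain ⟨s₁, ⟨n, y, hny, rfl⟩, hs₁⟩ := exists_lt_of_lt_csSup ⟨s₀, hs₀G⟩
    (show M - min (ε * τ) (ε * r / 16) < sSup G by rw [← hMdef]; linarith)
  have hMs₀ : s₀ ≤ M := le_csSup hGbdd hs₀G
  have hθ1 := min_le_left (ε * τ) (ε * r / 16)
  have hθ2 := min_le_right (ε * τ) (ε * r / 16)
  have hnear : ‖(τ * (n : ℝ), y) - p‖ < r / 2 := by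
    have h1 := hjet _ hny
    have h2 := (abs_le.1 (hunif _ hny)).2
    rw [hgrid] at h2
    by_contra hfar
    push Not at hfar
    have h3 := mul_le_mul_of_nonneg_left hfar hε.le
    have h4 : 0 < ε * r := by positivity
    linarith
  have hnear1 : |τ * n - p.1| < r / 2 :=
    (norm_fst_le ((τ * (n : ℝ), y) - p)).trans_lt hnear
  have hn0 : n ≠ 0 := by
    rintro rfl
    rw [abs_lt] at hnear1
    simp only [Nat.cast_zero, mul_zero] at hnear1
    linarith
  obtain ⟨n', rfl⟩ := Nat.exists_eq_succ_of_ne_zero hn0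
  have hcast : τ * ((n' + 1 : ℕ) : ℝ) = τ * n' + τ := by push_cast; ring
  -- Points at distance less than `r / 2` of the near-maximizer belong to the ball.
  have hG' : ∀ z : ι → ℝ, ‖z‖ ≤ r / 2 → w n' (y + z) ≤ χ (τ * n', y + z) + M := fun z hz => by
    have hmem : (τ * (n' : ℝ), y + z) ∈ Metric.closedBall p r := by
      rw [Metric.mem_closedBall, dist_eq_norm]
      have h1 : (τ * (n' : ℝ), y + z) - p = ((τ * ((n' + 1 : ℕ) : ℝ), y) - p) + (-τ, z) := by
        rw [hcast]
        refine Prod.ext ?_ ?_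
        · simp only [Prod.fst_sub, Prod.fst_add]; ring
        · simp only [Prod.snd_sub, Prod.snd_add]; abel
      rw [h1]
      have h2 : ‖((-τ, z) : ℝ × (ι → ℝ))‖ ≤ r / 2 := by
        rw [Prod.norm_def]
        refine max_le ?_ hz
        simp only [norm_neg, Real.norm_eq_abs, abs_of_pos hτ0]
        exact hτr.le
      have := norm_add_le ((τ * ((n' + 1 : ℕ) : ℝ), y) - p) (-τ, z)
      linarith
    have := le_csSup hGbdd ⟨n', y + z, hmem, rfl⟩
    linarith
  have hstep : w (n' + 1) y ≤ schemeStep H η τ (fun y => χ (τ * n', y)) y + M := by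
    have h1 : w (n' + 1) y = schemeStep H η τ (w n') y := by
      simp only [hw, Function.iterate_succ_apply']
    rw [h1]
    refine schemeStep_le hmono hlip hV.le hη0 hτ0.le (timeStep_mul hV j) ?_ fun k => ?_
    · simpa using hG' 0 (by simp; positivity)
    · refine hG' _ ?_
      rw [Pi.norm_single, Real.norm_eq_abs, abs_of_pos hη0]
      exact hhr.le
  have hH : H (fwdDiff η (fun y => χ (τ * n', y)) y) ≤ H b + V * (d * (2 * ε)) := by
    have h1 : H (fwdDiff η (fun y => χ (τ * n', y)) y) ≤ H (fun k => b k + 2 * ε) :=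
      hmono fun k => by
        simp only [fwdDiff]
        rw [div_le_iff₀ hη0]
        simp only [hχ, dotProduct_add, dotProduct_single]
        have h2 : ‖(τ * (n' : ℝ), y + Pi.single k η) - p‖ ≤ ‖(τ * (n' : ℝ), y) - p‖ + η := by
          have h3 : (τ * (n' : ℝ), y + Pi.single k η) - p
              = ((τ * (n' : ℝ), y) - p) + (0, Pi.single k η) := by
            refine Prod.ext ?_ ?_
            · simp
            · simp only [Prod.snd_sub, Prod.snd_add]; abel
          rw [h3]
          refine (norm_add_le _ _).trans (add_le_add_right ?_ _)
          rw [Prod.norm_def]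
          refine max_le (by simp [hη0.le]) ?_
          rw [Pi.norm_single, Real.norm_eq_abs, abs_of_pos hη0]
        have := mul_le_mul_of_nonneg_left h2 (show 0 ≤ 2 * ε by positivity)
        linarith
    have h2 : H (fun k => b k + 2 * ε) - H b ≤ V * (d * (2 * ε)) := by
      refine (le_abs_self _).trans ((hlip _ _).trans (mul_le_mul_of_nonneg_left ?_ hV.le))
      refine dualNorm1_le_card_mul fun k => ?_
      simp [abs_of_pos hε]
    linarith
  have hχtime : χ (τ * n', y) - χ (τ * ((n' + 1 : ℕ) : ℝ), y) ≤ -a * τ + 2 * ε * τ := by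
    simp only [hχ, hcast]
    have h2 : ‖(τ * (n' : ℝ), y) - p‖ ≤ ‖(τ * (n' : ℝ) + τ, y) - p‖ + τ := by
      have h3 : (τ * (n' : ℝ), y) - p = ((τ * (n' : ℝ) + τ, y) - p) + (-τ, 0) := by
        refine Prod.ext ?_ ?_
        · simp only [Prod.fst_sub, Prod.fst_add]; ring
        · simp
      rw [h3]
      refine (norm_add_le _ _).trans (add_le_add_right ?_ _)
      rw [Prod.norm_def]
      exact max_le (by simp [abs_of_pos hτ0]) (by simp [hτ0.le])
    have := mul_le_mul_of_nonneg_left h2 (show 0 ≤ 2 * ε by positivity)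
    linarith
  have hfin := mul_le_mul_of_nonneg_left hH hτ0.le
  unfold schemeStep at hstep
  have : τ * a ≤ τ * (H b + ε * (3 + 2 * V * d)) := by linarith
  exact le_of_mul_le_mul_left this hτ0

end IsSchemeLimit

end Scheme

/-! ### Gradient constraints -/

section Gradient

variable {ι : Type} [Fintype ι]

lemma fderiv_eq_grad_dotProduct [DecidableEq ι] (f : (ι → ℝ) → ℝ) (x z : ι → ℝ) :
    fderiv ℝ f x z = grad f x ⬝ᵥ z := by
  have hz : z = ∑ k, z k • (Pi.single k (1 : ℝ) : ι → ℝ) := by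
    ext j; simp [Finset.sum_apply, Pi.single_apply]
  conv_lhs => rw [hz]
  simp only [map_sum, map_smul, smul_eq_mul]
  exact Finset.sum_congr rfl fun k _ => mul_comm _ _

lemma convex_closedOrthant (ι : Type) : Convex ℝ (closedOrthant ι) := by
  intro x hx y hy a b ha hb _ k
  have := hx k
  have := hy k
  simp only [Pi.add_apply, Pi.smul_apply, smul_eq_mul]
  positivity

/-- A Lipschitz function whose gradient belongs almost everywhere to `S` has its increments bounded
by the support function of `S`. The averages of the function over small cubes `x + (0, r)^ι` are
differentiable everywhere, with gradients that are averages of elements of `S`; these cubes stay in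
the open orthant even if `x` lies on the boundary. -/
lemma le_add_of_hasGradientIn [DecidableEq ι] [Nonempty ι] {f : (ι → ℝ) → ℝ} {S : Set (ι → ℝ)}
    {L : ℝ} (hL : 0 ≤ L) (hf : ∀ x y, |f x - f y| ≤ L * norm1 (x - y)) (hS : HasGradientIn f S)
    {z : ι → ℝ} {c : ℝ} (hc : ∀ s ∈ S, s ⬝ᵥ z ≤ c) {x : ι → ℝ} (hx : x ∈ closedOrthant ι)
    (hxz : x + z ∈ closedOrthant ι) : f (x + z) ≤ f x + c := by
  have hf' : ∀ x y, |f x - f y| ≤ L * ‖x - y‖ := fun x y =>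
    (hf x y).trans (mul_le_mul_of_nonneg_left (norm1_le_norm _) hL)
  have hcont : Continuous f := by
    have : LipschitzWith (Real.toNNReal L) f := LipschitzWith.of_dist_le_mul fun x y => by
      rw [Real.dist_eq, dist_eq_norm, Real.coe_toNNReal _ hL]; exact hf' x y
    exact this.continuous
  suffices hr : ∀ r > 0, f (x + z) ≤ f x + c + 2 * L * r by
    refine le_of_forall_pos_le_add fun e he => ?_
    have := hr (e / (2 * L + 1)) (by positivity)
    have h2 : 2 * L * (e / (2 * L + 1)) ≤ e := by
      rw [← mul_div_assoc, div_le_iff₀ (by positivity)]; nlinarith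
    linarith
  intro r hr
  set Q : Set (ι → ℝ) := Set.pi Set.univ fun _ => Set.Ioo 0 r with hQ
  have hQm : MeasurableSet Q := MeasurableSet.univ_pi fun _ => measurableSet_Ioo
  have hQo : ∀ w ∈ Q, ∀ k, 0 < w k ∧ w k < r := fun w hw k => hw k trivial
  have hvol : volume Q = ENNReal.ofReal r ^ Fintype.card ι := by
    rw [hQ, Real.volume_pi_Ioo]; simp
  set ν : Measure (ι → ℝ) := volume.restrict Q with hν
  have : IsFiniteMeasure ν := ⟨by
    rw [hν, Measure.restrict_apply_univ, hvol]; exact ENNReal.pow_lt_top ENNReal.ofReal_lt_top⟩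
  set N : ℝ := ν.real Set.univ with hN
  have hN0 : 0 < N := by
    rw [hN, Measure.real, hν, Measure.restrict_apply_univ, hvol, ENNReal.toReal_pow,
      ENNReal.toReal_ofReal hr.le]
    positivity
  have hQae : ∀ᵐ w ∂ν, w ∈ Q := ae_restrict_mem hQm
  have hint : ∀ y, Integrable (fun w => f (y + w)) ν := fun y => by
    refine Integrable.of_bound (hcont.comp (continuous_const_add y)).aestronglyMeasurable
      (|f y| + L * r) ?_
    filter_upwards [hQae] with w hw
    have h1 := hf' (y + w) y
    rw [add_sub_cancel_left] at h1
    have h2 : ‖w‖ ≤ r := (pi_norm_le_iff_of_nonneg hr.le).2 fun k => by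
      rw [Real.norm_eq_abs, abs_of_pos (hQo w hw k).1]; exact (hQo w hw k).2.le
    have h3 := mul_le_mul_of_nonneg_left h2 hL
    have h4 := abs_sub_abs_le_abs_sub (f (y + w)) (f y)
    rw [Real.norm_eq_abs]
    linarith
  set F : (ι → ℝ) → ℝ := fun y => ∫ w, f (y + w) ∂ν with hF
  have hFf : ∀ y, |F y - N * f y| ≤ N * (L * r) := fun y => by
    have h1 : F y - N * f y = ∫ w, (f (y + w) - f y) ∂ν := by
      rw [integral_sub (hint y) (integrable_const _), integral_const, smul_eq_mul]
    rw [h1, ← Real.norm_eq_abs, mul_comm N]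
    refine norm_integral_le_of_norm_le_const ?_
    filter_upwards [hQae] with w hw
    have h1 := hf' (y + w) y
    rw [add_sub_cancel_left] at h1
    have h2 : ‖w‖ ≤ r := (pi_norm_le_iff_of_nonneg hr.le).2 fun k => by
      rw [Real.norm_eq_abs, abs_of_pos (hQo w hw k).1]; exact (hQo w hw k).2.le
    exact h1.trans (mul_le_mul_of_nonneg_left h2 hL)
  have hgrad : ∀ y ∈ closedOrthant ι,
      ∀ᵐ w ∂ν, DifferentiableAt ℝ f (y + w) ∧ grad f (y + w) ∈ S := fun y hy => by
    have h1 : ∀ᵐ v : ι → ℝ, v ∈ openOrthant ι → DifferentiableAt ℝ f v ∧ grad f v ∈ S :=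
      (ae_restrict_iff' isOpen_openOrthant.measurableSet).1 hS
    have h2 := (measurePreserving_add_left (volume : Measure (ι → ℝ)) y).quasiMeasurePreserving.ae
      h1
    filter_upwards [ae_restrict_of_ae (s := Q) h2, hQae] with w hw hwQ
    exact hw fun k => add_pos_of_nonneg_of_pos (hy k) (hQo w hwQ k).1
  have hderiv : ∀ y ∈ closedOrthant ι, ∃ F' : (ι → ℝ) →L[ℝ] ℝ, HasFDerivAt F F' y ∧
      F' z ≤ N * c := fun y hy => by
    have h := hasFDerivAt_integral_of_dominated_loc_of_lip (μ := ν) (F := fun y w => f (y + w))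
      (F' := fun w => fderiv ℝ f (y + w)) (x₀ := y) (s := Set.univ) (bound := fun _ => L)
      univ_mem
      (Eventually.of_forall fun y =>
        (hcont.comp (continuous_const_add y)).aestronglyMeasurable) (hint y)
      ((measurable_fderiv ℝ f).comp (measurable_const_add y)).aestronglyMeasurable
      (Eventually.of_forall fun w => LipschitzOnWith.of_dist_le_mul fun u _ v _ => by
        have := hf' (u + w) (v + w)
        rw [add_sub_add_right_eq_sub] at this
        simpa [Real.dist_eq, dist_eq_norm, abs_of_nonneg hL] using this)
      (integrable_const _) (by
        filter_upwards [hgrad y hy] with w hw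
        exact (hasFDerivAt_comp_add_right w).2 hw.1.hasFDerivAt)
    refine ⟨_, h.2, ?_⟩
    rw [ContinuousLinearMap.integral_apply h.1]
    calc ∫ w, fderiv ℝ f (y + w) z ∂ν ≤ ∫ _w, c ∂ν := by
          refine integral_mono_ae (h.1.apply_continuousLinearMap z) (integrable_const _) ?_
          filter_upwards [hgrad y hy] with w hw
          rw [fderiv_eq_grad_dotProduct]
          exact hc _ hw.2
      _ = N * c := by rw [integral_const, smul_eq_mul]
  have hseg : ∀ s ∈ Set.Icc (0 : ℝ) 1, x + s • z ∈ closedOrthant ι := fun s hs => by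
    have := (convex_closedOrthant ι).add_smul_sub_mem hx hxz hs
    rwa [add_sub_cancel_left] at this
  choose! F' hF' hF'c using hderiv
  have hline : ∀ s ∈ Set.Icc (0 : ℝ) 1, HasDerivAt (fun s : ℝ => F (x + s • z))
      (F' (x + s • z) z) s := fun s hs => by
    have h1 : HasDerivAt (fun s : ℝ => x + s • z) z s := by
      simpa using ((hasDerivAt_id s).smul_const z).const_add x
    exact (hF' _ (hseg s hs)).comp_hasDerivAt s h1
  obtain ⟨s, hs, hslope⟩ := exists_hasDerivAt_eq_slope (fun s : ℝ => F (x + s • z))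
    (fun s => F' (x + s • z) z) zero_lt_one
    (fun s hs => (hline s hs).continuousAt.continuousWithinAt)
    (fun s hs => hline s ⟨hs.1.le, hs.2.le⟩)
  have h1 := hF'c _ (hseg s ⟨hs.1.le, hs.2.le⟩)
  simp only [one_smul, zero_smul, add_zero, sub_zero, div_one] at hslope
  have h2 := (abs_le.1 (hFf x)).2
  have h3 := (abs_le.1 (hFf (x + z))).1
  have : N * f (x + z) ≤ N * (f x + c + 2 * L * r) := by linarith
  exact le_of_mul_le_mul_left this hN0

/-- A point below the support function of a convex set belongs to its closure. -/
lemma mem_closure_of_forall_dotProduct_le [DecidableEq ι] {S : Set (ι → ℝ)} (hS : Convex ℝ S)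
    {b : ι → ℝ} (hb : ∀ z c, (∀ s ∈ S, s ⬝ᵥ z ≤ c) → b ⬝ᵥ z ≤ c) : b ∈ closure S := by
  by_contra hmem
  obtain ⟨φ, c, h1, h2⟩ := geometric_hahn_banach_closed_point hS.closure isClosed_closure hmem
  have hφ : ∀ s, φ s = s ⬝ᵥ fun k => φ (Pi.single k 1) := fun s => by
    have hz : s = ∑ k, s k • (Pi.single k (1 : ℝ) : ι → ℝ) := by
      ext j; simp [Finset.sum_apply, Pi.single_apply]
    conv_lhs => rw [hz]
    simp only [map_sum, map_smul, smul_eq_mul, dotProduct]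
  have := hb (fun k => φ (Pi.single k 1)) c fun s hs => by
    rw [← hφ]; exact (h1 s (subset_closure hs)).le
  rw [← hφ] at this
  linarith

lemma IsSuperjet.dotProduct_le {u : ℝ × (ι → ℝ) → ℝ} {p : ℝ × (ι → ℝ)} {a : ℝ} {b : ι → ℝ}
    (h : IsSuperjet u p a b) {z : ι → ℝ} {c : ℝ}
    (hz : ∀ᶠ σ : ℝ in 𝓝[>] 0, u p ≤ u (p.1, p.2 - σ • z) + σ * c) : b ⬝ᵥ z ≤ c := by
  have hpath : Tendsto (fun σ : ℝ => (p.1, p.2 - σ • z)) (𝓝[>] 0) (𝓝 p) := by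
    have : Continuous fun σ : ℝ => (p.1, p.2 - σ • z) := by fun_prop
    have h1 := this.tendsto 0
    simp only [zero_smul, sub_zero] at h1
    exact h1.mono_left nhdsWithin_le_nhds
  suffices hs : ∀ ε > 0, b ⬝ᵥ z ≤ c + ε * ‖z‖ by
    refine le_of_forall_pos_le_add fun e he => ?_
    have := hs (e / (‖z‖ + 1)) (by positivity)
    have h2 : e / (‖z‖ + 1) * ‖z‖ ≤ e := by
      rw [div_mul_eq_mul_div, div_le_iff₀ (by positivity)]; nlinarith [norm_nonneg z]
    linarith
  intro ε hε
  obtain ⟨σ, h1, h2, hσ⟩ := (hz.and ((hpath.eventually (h ε hε)).and self_mem_nhdsWithin)).exists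
  have hσ0 : 0 < σ := hσ
  have e1 : ‖((p.1, p.2 - σ • z) : ℝ × (ι → ℝ)) - p‖ = σ * ‖z‖ := by
    rw [Prod.norm_def]
    simp [norm_smul, abs_of_pos hσ0]
    positivity
  rw [e1] at h2
  simp only [sub_self, mul_zero, add_zero, sub_sub_cancel_left, dotProduct_neg,
    dotProduct_smul, smul_eq_mul] at h2
  have : σ * (b ⬝ᵥ z) ≤ σ * (c + ε * ‖z‖) := by linarith
  exact le_of_mul_le_mul_left this hσ0

/-- The bounds on increments given by the support function of `S`, on the open orthant. -/
def IncrementsIn (S : Set (ι → ℝ)) (f : (ι → ℝ) → ℝ) : Prop :=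
  ∀ z c, (∀ s ∈ S, s ⬝ᵥ z ≤ c) → ∀ x ∈ openOrthant ι, x + z ∈ openOrthant ι → f (x + z) ≤ f x + c

lemma eventually_add_smul_mem {x : ι → ℝ} (hx : x ∈ openOrthant ι) (z : ι → ℝ) :
    ∀ᶠ σ : ℝ in 𝓝[>] 0, x + σ • z ∈ openOrthant ι := by
  have : Continuous fun σ : ℝ => x + σ • z := by fun_prop
  have h1 := this.tendsto 0
  simp only [zero_smul, add_zero] at h1
  exact (h1.mono_left nhdsWithin_le_nhds).eventually (isOpen_openOrthant.mem_nhds hx)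

lemma IncrementsIn.mem_closure_of_isSuperjet [DecidableEq ι] {S : Set (ι → ℝ)} (hS : Convex ℝ S)
    {u : ℝ × (ι → ℝ) → ℝ} {p : ℝ × (ι → ℝ)} (hp : p.2 ∈ openOrthant ι)
    (hu : IncrementsIn S fun x => u (p.1, x)) {a : ℝ} {b : ι → ℝ} (h : IsSuperjet u p a b) :
    b ∈ closure S := by
  refine mem_closure_of_forall_dotProduct_le hS fun z c hc => h.dotProduct_le ?_
  filter_upwards [eventually_add_smul_mem hp (-z), self_mem_nhdsWithin] with σ hσ hσ0
  have hσ0 : 0 < σ := hσ0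
  rw [smul_neg, ← sub_eq_add_neg] at hσ
  have := hu (σ • z) (σ * c) (fun s hs => by
    rw [dotProduct_smul, smul_eq_mul]
    exact mul_le_mul_of_nonneg_left (hc s hs) hσ0.le) (p.2 - σ • z) hσ (by simpa using hp)
  simpa using this

lemma IncrementsIn.mem_closure_of_isSuperjet_neg [DecidableEq ι] {S : Set (ι → ℝ)}
    (hS : Convex ℝ S) {u : ℝ × (ι → ℝ) → ℝ} {p : ℝ × (ι → ℝ)} (hp : p.2 ∈ openOrthant ι)
    (hu : IncrementsIn S fun x => u (p.1, x)) {a : ℝ} {b : ι → ℝ}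
    (h : IsSuperjet (-u) p a (-b)) : b ∈ closure S := by
  refine mem_closure_of_forall_dotProduct_le hS fun z c hc => ?_
  rw [← neg_dotProduct_neg]
  refine h.dotProduct_le ?_
  filter_upwards [eventually_add_smul_mem hp z, self_mem_nhdsWithin] with σ hσ hσ0
  have hσ0 : 0 < σ := hσ0
  have := hu (σ • z) (σ * c) (fun s hs => by
    rw [dotProduct_smul, smul_eq_mul]
    exact mul_le_mul_of_nonneg_left (hc s hs) hσ0.le) p.2 hp hσ
  simp only [Pi.neg_apply, smul_neg, sub_neg_eq_add]
  linarith

/-- Superjets of a Lipschitz function are bounded by its Lipschitz constant. -/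
lemma IsSuperjet.dualNorm1_le [DecidableEq ι] [Nonempty ι] {u : ℝ × (ι → ℝ) → ℝ}
    {p : ℝ × (ι → ℝ)} {a L : ℝ} {b : ι → ℝ} (h : IsSuperjet u p a b)
    (hu : ∀ x y, |u (p.1, x) - u (p.1, y)| ≤ L * norm1 (x - y)) : dualNorm1 b ≤ L := by
  have hd := card_pos_real ι
  have key : ∀ k (e : ℝ), |e| = 1 → b k * e ≤ L / Fintype.card ι := fun k e he => by
    have h1 := h.dotProduct_le (z := Pi.single k e) (c := L / Fintype.card ι) (by
      filter_upwards [self_mem_nhdsWithin] with σ hσ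
      have hσ : 0 < σ := hσ
      have h2 := (abs_le.1 (hu p.2 (p.2 - σ • Pi.single k e))).2
      rw [sub_sub_cancel, ← Pi.single_smul', norm1_single, smul_eq_mul, abs_mul, he, mul_one,
        abs_of_pos hσ] at h2
      have h3 : L * (σ / Fintype.card ι) = σ * (L / Fintype.card ι) := by ring
      rw [h3] at h2
      rw [← Pi.single_smul', smul_eq_mul]
      linarith)
    rwa [dotProduct_single] at h1
  refine dualNorm1_le_iff.2 fun k => ?_
  have h1 := key k 1 (by simp)
  have h2 := key k (-1) (by simp)
  have : |b k| ≤ L / Fintype.card ι := abs_le.2 ⟨by linarith, by linarith⟩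
  rw [le_div_iff₀ hd] at this
  linarith

/-- Superjets of `u (t, P x)`, for a linear map `P` with a right inverse `Q`, come from superjets
of `u`. -/
lemma IsSuperjet.of_comp {κ : Type} [Fintype κ] {u : ℝ × (κ → ℝ) → ℝ}
    (P : (ι → ℝ) →L[ℝ] (κ → ℝ)) (Q : (κ → ℝ) →L[ℝ] (ι → ℝ)) (hPQ : ∀ z, P (Q z) = z)
    {p : ℝ × (ι → ℝ)} {a : ℝ} {b : ι → ℝ} {b' : κ → ℝ} (hb' : ∀ z, b' ⬝ᵥ z = b ⬝ᵥ Q z)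
    (h : IsSuperjet (fun q => u (q.1, P q.2)) p a b) :
    IsSuperjet u (p.1, P p.2) a b' ∧ ∀ w, b ⬝ᵥ w = b' ⬝ᵥ P w := by
  constructor
  · intro ε hε
    set ε' := ε / (1 + ‖Q‖) with hε'
    have hcont : Continuous fun q : ℝ × (κ → ℝ) => (q.1, p.2 + Q (q.2 - P p.2)) := by fun_prop
    have ht := hcont.tendsto (p.1, P p.2)
    simp only [sub_self, map_zero, add_zero] at ht
    filter_upwards [ht.eventually (h ε' (by positivity))] with q hq
    simp only [map_add, hPQ, add_sub_cancel, add_sub_cancel_left] at hq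
    rw [← hb'] at hq
    refine hq.trans (add_le_add_right ?_ _)
    have h1 : ‖((q.1, p.2 + Q (q.2 - P p.2)) : ℝ × (ι → ℝ)) - p‖ ≤
        (1 + ‖Q‖) * ‖q - (p.1, P p.2)‖ := by
      rw [Prod.norm_def]
      refine max_le ?_ ?_
      · have := norm_fst_le (q - (p.1, P p.2))
        simp only [Prod.fst_sub] at this ⊢
        nlinarith [norm_nonneg Q, norm_nonneg (q - (p.1, P p.2))]
      · have h2 := norm_snd_le (q - (p.1, P p.2))
        simp only [Prod.snd_sub, add_sub_cancel_left] at h2 ⊢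
        have h3 := Q.le_opNorm (q.2 - P p.2)
        have h4 := mul_le_mul_of_nonneg_left h2 (norm_nonneg Q)
        nlinarith [norm_nonneg (q - (p.1, P p.2))]
    calc ε' * _ ≤ ε' * ((1 + ‖Q‖) * ‖q - (p.1, P p.2)‖) :=
          mul_le_mul_of_nonneg_left h1 (by positivity)
      _ = ε * ‖q - (p.1, P p.2)‖ := by rw [hε']; field_simp
  · intro w
    have hker : ∀ z, P z = 0 → b ⬝ᵥ z ≤ 0 := fun z hz =>
      h.dotProduct_le (Eventually.of_forall fun σ => by simp [hz])
    have h1 := hker (w - Q (P w)) (by rw [map_sub, hPQ, sub_self])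
    have h2 := hker (-(w - Q (P w))) (by rw [map_neg, map_sub, hPQ, sub_self, neg_zero])
    rw [dotProduct_neg, neg_nonpos] at h2
    have h3 := le_antisymm h1 h2
    rw [dotProduct_sub, ← hb', sub_eq_zero] at h3
    exact h3

end Gradient

/-! ### The projected non-linearity and its extension -/

section Extension

variable {g : ℝ → ℝ} {m M : ℝ} {K : ℕ}

instance nonempty_D (K : ℕ) : Nonempty (D K) := ⟨⟨0, by positivity⟩⟩

lemma dyadic_mul_mem (K : ℕ) (k l : D K) : dyadic K k * dyadic K l ∈ Set.Icc (-1 : ℝ) 1 := by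
  have hk := abs_le.2 (dyadic_mem K k)
  have hl := abs_le.2 (dyadic_mem K l)
  rw [Set.mem_Icc, ← abs_le, abs_mul]
  exact mul_le_one₀ hk (abs_nonneg _) hl

lemma GMat_mulVec_dotProduct_comm (g : ℝ → ℝ) (K : ℕ) (x x' : D K → ℝ) :
    (GMat g K).mulVec x ⬝ᵥ x' = (GMat g K).mulVec x' ⬝ᵥ x := by
  have hsymm : (GMat g K).transpose = GMat g K := by
    ext k l; simp [GMat, mul_comm]
  rw [dotProduct_comm, Matrix.dotProduct_mulVec, ← Matrix.mulVec_transpose, hsymm]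

lemma CVal_sub (g : ℝ → ℝ) (K : ℕ) (x x' : D K → ℝ) :
    CVal g K x - CVal g K x' =
      1 / 2 * (((GMat g K).mulVec x - (GMat g K).mulVec x') ⬝ᵥ (x + x')) := by
  have := GMat_mulVec_dotProduct_comm g K x x'
  simp only [CVal, sub_dotProduct, dotProduct_add]
  linarith

lemma card_mul_GMat_mulVec (g : ℝ → ℝ) (K : ℕ) (x : D K → ℝ) (k : D K) :
    (Fintype.card (D K) : ℝ) * (GMat g K).mulVec x k =
      (Fintype.card (D K) : ℝ)⁻¹ * ∑ l, g (dyadic K k * dyadic K l) * x l := by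
  have hd := card_pos_real (D K)
  simp only [Matrix.mulVec, dotProduct, GMat, Matrix.of_apply, Finset.mul_sum]
  refine Finset.sum_congr rfl fun l _ => ?_
  field_simp

lemma le_card_mul_GMat_mulVec (hgm : ∀ x ∈ Set.Icc (-1 : ℝ) 1, m ≤ g x) {x : D K → ℝ}
    (hx : x ∈ closedOrthant (D K)) (k : D K) :
    m * norm1 x ≤ (Fintype.card (D K) : ℝ) * (GMat g K).mulVec x k := by
  rw [card_mul_GMat_mulVec, norm1_of_nonneg hx, mul_left_comm, Finset.mul_sum]
  refine mul_le_mul_of_nonneg_left (Finset.sum_le_sum fun l _ => ?_) (by positivity)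
  exact mul_le_mul_of_nonneg_right (hgm _ (dyadic_mul_mem K k l)) (hx l)

lemma card_mul_GMat_mulVec_le (hgM : ∀ x ∈ Set.Icc (-1 : ℝ) 1, g x ≤ M) {x : D K → ℝ}
    (hx : x ∈ closedOrthant (D K)) (k : D K) :
    (Fintype.card (D K) : ℝ) * (GMat g K).mulVec x k ≤ M * norm1 x := by
  rw [card_mul_GMat_mulVec, norm1_of_nonneg hx, mul_left_comm, Finset.mul_sum _ _ M]
  refine mul_le_mul_of_nonneg_left (Finset.sum_le_sum fun l _ => ?_) (by positivity)
  exact mul_le_mul_of_nonneg_right (hgM _ (dyadic_mul_mem K k l)) (hx l)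

lemma GMat_mulVec_nonneg (hm : 0 ≤ m) (hgm : ∀ x ∈ Set.Icc (-1 : ℝ) 1, m ≤ g x) {x : D K → ℝ}
    (hx : x ∈ closedOrthant (D K)) (k : D K) : 0 ≤ (GMat g K).mulVec x k := by
  have h1 := le_card_mul_GMat_mulVec hgm hx k
  have h2 := mul_nonneg hm (norm1_nonneg x)
  exact (mul_nonneg_iff_of_pos_left (card_pos_real (D K))).1 (h2.trans h1)

lemma le_dualNorm1_GMat_mulVec (hgm : ∀ x ∈ Set.Icc (-1 : ℝ) 1, m ≤ g x) {x : D K → ℝ}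
    (hx : x ∈ closedOrthant (D K)) : m * norm1 x ≤ dualNorm1 ((GMat g K).mulVec x) := by
  have k : D K := Classical.arbitrary _
  refine (le_card_mul_GMat_mulVec hgm hx k).trans (le_trans ?_ (le_dualNorm1 _ k))
  exact mul_le_mul_of_nonneg_left (le_abs_self _) (card_pos_real _).le

lemma add_mem_closedOrthant {x x' : D K → ℝ} (hx : x ∈ closedOrthant (D K))
    (hx' : x' ∈ closedOrthant (D K)) : x + x' ∈ closedOrthant (D K) :=
  fun k => add_nonneg (hx k) (hx' k)

lemma CVal_nonneg (hm : 0 ≤ m) (hgm : ∀ x ∈ Set.Icc (-1 : ℝ) 1, m ≤ g x) {x : D K → ℝ}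
    (hx : x ∈ closedOrthant (D K)) : 0 ≤ CVal g K x := by
  unfold CVal
  have : 0 ≤ (GMat g K).mulVec x ⬝ᵥ x :=
    Finset.sum_nonneg fun k _ => mul_nonneg (GMat_mulVec_nonneg hm hgm hx k) (hx k)
  positivity

/-- The projected non-linearity is non-decreasing on the cone: by symmetry of `G`, its increments
are `½ (y - y') · (x + x')`. -/
lemma CVal_mono {x x' : D K → ℝ} (hx : x ∈ closedOrthant (D K)) (hx' : x' ∈ closedOrthant (D K))
    (h : (GMat g K).mulVec x ≤ (GMat g K).mulVec x') : CVal g K x ≤ CVal g K x' := by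
  have h1 := CVal_sub g K x' x
  have h2 : 0 ≤ ((GMat g K).mulVec x' - (GMat g K).mulVec x) ⬝ᵥ (x' + x) :=
    Finset.sum_nonneg fun k _ => mul_nonneg (sub_nonneg.2 (h k)) (add_nonneg (hx' k) (hx k))
  linarith

lemma abs_CVal_sub_le (hm : 0 < m) (hgm : ∀ x ∈ Set.Icc (-1 : ℝ) 1, m ≤ g x) {x x' : D K → ℝ}
    (hx : x ∈ closedOrthant (D K)) (hx' : x' ∈ closedOrthant (D K)) {r : ℝ}
    (hr : dualNorm1 ((GMat g K).mulVec x) ≤ r) (hr' : dualNorm1 ((GMat g K).mulVec x') ≤ r) :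
    |CVal g K x - CVal g K x'| ≤
      r / m * dualNorm1 ((GMat g K).mulVec x - (GMat g K).mulVec x') := by
  have n1 : norm1 x ≤ r / m := by
    rw [le_div_iff₀ hm]; linarith [le_dualNorm1_GMat_mulVec hgm hx]
  have n2 : norm1 x' ≤ r / m := by
    rw [le_div_iff₀ hm]; linarith [le_dualNorm1_GMat_mulVec hgm hx']
  have n3 : norm1 (x + x') ≤ 2 * (r / m) := by
    have : norm1 (x + x') = norm1 x + norm1 x' := by
      rw [norm1_of_nonneg hx, norm1_of_nonneg hx', norm1_of_nonneg (add_mem_closedOrthant hx hx')]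
      simp [Finset.sum_add_distrib, mul_add]
    linarith
  rw [CVal_sub, abs_mul, abs_of_pos (by norm_num : (0 : ℝ) < 1 / 2)]
  have h1 := abs_dotProduct_le ((GMat g K).mulVec x - (GMat g K).mulVec x') (x + x')
  have h2 := mul_le_mul_of_nonneg_left n3
    (dualNorm1_nonneg ((GMat g K).mulVec x - (GMat g K).mulVec x'))
  linarith

/-- The value of the non-linearity is at most `‖y‖² / (2 m)`. -/
lemma CVal_le (hm : 0 < m) (hgm : ∀ x ∈ Set.Icc (-1 : ℝ) 1, m ≤ g x) {x : D K → ℝ}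
    (hx : x ∈ closedOrthant (D K)) {r : ℝ} (hr : dualNorm1 ((GMat g K).mulVec x) ≤ r) :
    CVal g K x ≤ r ^ 2 / (2 * m) := by
  have h1 := (le_abs_self _).trans (abs_dotProduct_le ((GMat g K).mulVec x) x)
  have n1 : norm1 x ≤ r / m := by
    rw [le_div_iff₀ hm]; linarith [le_dualNorm1_GMat_mulVec hgm hx]
  have h2 : dualNorm1 ((GMat g K).mulVec x) * norm1 x ≤ r * (r / m) :=
    mul_le_mul hr n1 (norm1_nonneg x) ((dualNorm1_nonneg _).trans hr)
  have h3 : r * (r / m) = 2 * (r ^ 2 / (2 * m)) := by field_simp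
  unfold CVal
  linarith

lemma CVal_le_of_dualNorm1_le {R : ℝ} (hR : 0 < R) (hm : 0 < m)
    (hgm : ∀ x ∈ Set.Icc (-1 : ℝ) 1, m ≤ g x) {x : D K → ℝ} (hx : x ∈ closedOrthant (D K))
    (h : dualNorm1 ((GMat g K).mulVec x) ≤ 2 * R) : CVal g K x ≤ 2 * (4 * R / m) * R := by
  refine (CVal_le hm hgm hx h).trans ?_
  have : 2 * (4 * R / m) * R - (2 * R) ^ 2 / (2 * m) = 6 * R ^ 2 / m := by field_simp; ring
  have : 0 ≤ 6 * R ^ 2 / m := by positivity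
  linarith

lemma regVal_nonneg {R : ℝ} (hR : 0 < R) (hm : 0 < m)
    (hgm : ∀ x ∈ Set.Icc (-1 : ℝ) 1, m ≤ g x) {x : D K → ℝ} (hx : x ∈ closedOrthant (D K)) :
    0 ≤ regVal g m K R x := by
  unfold regVal
  split_ifs with h
  · exact (CVal_nonneg hm.le hgm hx).trans (le_max_left _ _)
  · have : 0 ≤ dualNorm1 ((GMat g K).mulVec x) - R := by linarith
    positivity

/-- On the cone the regularized non-linearity is Lipschitz for the dual norm, with constant
`8 R / m`. -/
lemma regVal_sub_le {R : ℝ} (hR : 0 < R) (hm : 0 < m)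
    (hgm : ∀ x ∈ Set.Icc (-1 : ℝ) 1, m ≤ g x) {x x' : D K → ℝ} (hx : x ∈ closedOrthant (D K))
    (hx' : x' ∈ closedOrthant (D K)) :
    regVal g m K R x - regVal g m K R x' ≤
      2 * (4 * R / m) * dualNorm1 ((GMat g K).mulVec x - (GMat g K).mulVec x') := by
  set y := (GMat g K).mulVec x with hy
  set y' := (GMat g K).mulVec x' with hy'
  set Λ := 2 * (4 * R / m) with hΛ
  have hΛ0 : 0 < Λ := by positivity
  have htri : dualNorm1 y ≤ dualNorm1 (y - y') + dualNorm1 y' := by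
    simpa using dualNorm1_add_le (y - y') y'
  have hlin : Λ * (dualNorm1 y - R) - Λ * (dualNorm1 y' - R) ≤ Λ * dualNorm1 (y - y') := by
    have := mul_le_mul_of_nonneg_left htri hΛ0.le
    linarith
  have hge : Λ * (dualNorm1 y' - R) ≤ regVal g m K R x' := by
    unfold regVal
    rw [← hy', ← hΛ]
    split_ifs
    · exact le_max_right _ _
    · exact le_rfl
  have hnn := mul_nonneg hΛ0.le (dualNorm1_nonneg (y - y'))
  by_cases h : dualNorm1 y ≤ 2 * R
  · have e1 : regVal g m K R x = max (CVal g K x) (Λ * (dualNorm1 y - R)) := if_pos h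
    rw [e1, sub_le_iff_le_add]
    refine max_le ?_ (by linarith)
    by_cases h' : dualNorm1 y' ≤ 2 * R
    · have e2 : CVal g K x' ≤ regVal g m K R x' := by
        unfold regVal
        rw [← hy', if_pos h']
        exact le_max_left _ _
      have e3 := (le_abs_self _).trans (abs_CVal_sub_le hm hgm hx hx' h h')
      have e4 : 2 * R / m * dualNorm1 (y - y') ≤ Λ * dualNorm1 (y - y') := by
        refine mul_le_mul_of_nonneg_right ?_ (dualNorm1_nonneg _)
        have : Λ = 4 * (2 * R / m) := by rw [hΛ]; ring
        have : 0 ≤ 2 * R / m := by positivity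
        linarith
      linarith
    · have e2 := CVal_le_of_dualNorm1_le hR hm hgm hx h
      have e3 := mul_le_mul_of_nonneg_left
        (show R ≤ dualNorm1 y' - R by linarith) hΛ0.le
      linarith
  · have e1 : regVal g m K R x = Λ * (dualNorm1 y - R) := if_neg h
    linarith

lemma dualNorm1_mono {y y' : D K → ℝ} (h0 : ∀ k, 0 ≤ y k) (h : y ≤ y') :
    dualNorm1 y ≤ dualNorm1 y' :=
  dualNorm1_le_iff.2 fun k => by
    refine le_trans ?_ (le_dualNorm1 y' k)
    exact mul_le_mul_of_nonneg_left (abs_le_abs_of_nonneg (h0 k) (h k)) (card_pos_real _).le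

lemma regVal_mono {R : ℝ} (hR : 0 < R) (hm : 0 < m)
    (hgm : ∀ x ∈ Set.Icc (-1 : ℝ) 1, m ≤ g x) {x x' : D K → ℝ} (hx : x ∈ closedOrthant (D K))
    (hx' : x' ∈ closedOrthant (D K)) (h : (GMat g K).mulVec x ≤ (GMat g K).mulVec x') :
    regVal g m K R x ≤ regVal g m K R x' := by
  have hn := dualNorm1_mono (GMat_mulVec_nonneg hm.le hgm hx) h
  have hΛ0 : 0 < 2 * (4 * R / m) := by positivity
  have hlin := mul_le_mul_of_nonneg_left (sub_le_sub_right hn R) hΛ0.le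
  unfold regVal
  split_ifs with h1 h2 h2
  · exact max_le_max (CVal_mono hx hx' h) hlin
  · refine max_le ((CVal_le_of_dualNorm1_le hR hm hgm hx h1).trans ?_) hlin
    exact mul_le_mul_of_nonneg_left (by linarith) hΛ0.le
  · exact absurd (hn.trans h2) h1
  · exact hlin

/-- Adding the constant `δ / m` to `x` raises every entry of `G x` by at least `δ / d`. -/
lemma exists_add_le_GMat_mulVec (hm : 0 < m) (hgm : ∀ x ∈ Set.Icc (-1 : ℝ) 1, m ≤ g x)
    (hgM : ∀ x ∈ Set.Icc (-1 : ℝ) 1, g x ≤ M) {x : D K → ℝ} (hx : x ∈ closedOrthant (D K)) {δ : ℝ}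
    (hδ : 0 ≤ δ) : ∃ x' ∈ closedOrthant (D K),
      (∀ k, (GMat g K).mulVec x k + δ / Fintype.card (D K) ≤ (GMat g K).mulVec x' k) ∧
      dualNorm1 ((GMat g K).mulVec x' - (GMat g K).mulVec x) ≤ M / m * δ := by
  have hd := card_pos_real (D K)
  set e : D K → ℝ := fun _ => δ / m with he
  have hemem : e ∈ closedOrthant (D K) := fun k => by simp only [he]; positivity
  have hen : norm1 e = δ / m := by
    rw [norm1_of_nonneg hemem]; simp [he]
  refine ⟨x + e, add_mem_closedOrthant hx hemem, fun k => ?_, ?_⟩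
  · rw [Matrix.mulVec_add, Pi.add_apply]
    refine add_le_add_right ?_ _
    have := le_card_mul_GMat_mulVec hgm hemem k
    rw [hen, mul_div_cancel₀ _ hm.ne'] at this
    rw [div_le_iff₀ hd]; linarith
  · rw [Matrix.mulVec_add, add_sub_cancel_left]
    refine dualNorm1_le_iff.2 fun k => ?_
    rw [abs_of_nonneg (GMat_mulVec_nonneg hm.le hgm hemem k)]
    refine (card_mul_GMat_mulVec_le hgM hemem k).trans_eq ?_
    rw [hen]; ring

theorem isExtension_HKR {R : ℝ} (hR : 0 < R) (hm : 0 < m)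
    (hgm : ∀ x ∈ Set.Icc (-1 : ℝ) 1, m ≤ g x) (hgM : ∀ x ∈ Set.Icc (-1 : ℝ) 1, g x ≤ M) (K : ℕ) :
    IsExtension g K R (8 * R * M / m ^ 2) (HKR g m K R) := by
  have hd := card_pos_real (D K)
  have hM0 : 0 < M := hm.trans_le ((hgm 0 (by simp)).trans (hgM 0 (by simp)))
  have bdd : ∀ y : D K → ℝ, BddBelow (Set.range fun x : {x : D K → ℝ //
      x ∈ closedOrthant (D K) ∧ y ≤ (GMat g K).mulVec x} => regVal g m K R x.1) := fun y =>
    ⟨0, by rintro _ ⟨x, rfl⟩; exact regVal_nonneg hR hm hgm x.2.1⟩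
  have above : ∀ {y y' : D K → ℝ} {x : D K → ℝ} {δ : ℝ}, 0 ≤ δ → x ∈ closedOrthant (D K) →
      y ≤ (GMat g K).mulVec x → (∀ k, y' k ≤ y k + δ / Fintype.card (D K)) →
      ∃ x' : {x : D K → ℝ // x ∈ closedOrthant (D K) ∧ y' ≤ (GMat g K).mulVec x},
        regVal g m K R x'.1 ≤ regVal g m K R x + 8 * R * M / m ^ 2 * δ := by
    intro y y' x δ hδ hx hxy hyy'
    obtain ⟨x', hx', h1, h2⟩ := exists_add_le_GMat_mulVec hm hgm hgM hx hδ
    refine ⟨⟨x', hx', fun k => ?_⟩, ?_⟩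
    · have := hyy' k; have := hxy k; have := h1 k; linarith
    · have h3 := regVal_sub_le hR hm hgm hx' hx
      have h4 := mul_le_mul_of_nonneg_left h2 (show 0 ≤ 2 * (4 * R / m) by positivity)
      have h5 : 2 * (4 * R / m) * (M / m * δ) = 8 * R * M / m ^ 2 * δ := by field_simp; ring
      simp only
      linarith
  have ne : ∀ y : D K → ℝ, Nonempty {x : D K → ℝ //
      x ∈ closedOrthant (D K) ∧ y ≤ (GMat g K).mulVec x} := fun y => by
    obtain ⟨x', -⟩ := above (y := 0) (y' := y) (x := 0) (dualNorm1_nonneg y) (fun _ => le_rfl)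
      (by rw [Matrix.mulVec_zero]) fun k => by
        rw [Pi.zero_apply, zero_add, le_div_iff₀ hd, mul_comm]
        exact (mul_le_mul_of_nonneg_left (le_abs_self _) hd.le).trans (le_dualNorm1 y k)
    exact ⟨x'⟩
  refine ⟨fun y y' hyy' => ?_, fun x hx hxR => ?_, fun y y' => ?_⟩
  · have := ne y'
    exact le_ciInf fun x => ciInf_le (bdd y) ⟨x.1, x.2.1, hyy'.trans x.2.2⟩
  · have hreg : regVal g m K R x = CVal g K x := by
      unfold regVal
      rw [if_pos (by linarith), max_eq_left]
      refine le_trans ?_ (CVal_nonneg hm.le hgm hx)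
      exact mul_nonpos_of_nonneg_of_nonpos (by positivity) (by linarith)
    have := ne ((GMat g K).mulVec x)
    refine le_antisymm ?_ (le_ciInf fun x' => ?_)
    · rw [← hreg]
      exact ciInf_le (bdd _) ⟨x, hx, le_rfl⟩
    · rw [← hreg]
      exact regVal_mono hR hm hgm hx x'.2.1 x'.2.2
  · have key : ∀ y y' : D K → ℝ, HKR g m K R y' - HKR g m K R y ≤
        8 * R * M / m ^ 2 * dualNorm1 (y - y') := fun y y' => by
      have := ne y
      rw [sub_le_comm]
      refine le_ciInf fun x => ?_
      obtain ⟨x', hx'⟩ := above (y := y) (y' := y') (dualNorm1_nonneg (y - y')) x.2.1 x.2.2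
        fun k => by
          have h1 := le_dualNorm1 (y - y') k
          have h2 := mul_le_mul_of_nonneg_left (neg_abs_le ((y - y') k)) hd.le
          have h3 : y' k - y k ≤ dualNorm1 (y - y') / Fintype.card (D K) := by
            rw [le_div_iff₀ hd]
            simp only [Pi.sub_apply] at h1 h2
            linarith
          linarith
      have : HKR g m K R y' ≤ regVal g m K R x'.1 := ciInf_le (bdd y') x'
      linarith
    have h1 := key y y'
    have h2 := key y' y
    rw [← neg_sub y y', dualNorm1_neg] at h2
    exact abs_le.2 ⟨by linarith, by linarith⟩

end Extension

/-! ### Dyadic refinement -/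

section Refinement

/-- The `2^n` descendants at level `K + n` of the dyadic interval of index `k` at level `K`. -/
def refineEquiv (K n : ℕ) : D K × Fin (2 ^ n) ≃ D (K + n) :=
  finProdFinEquiv.trans (finCongr (by rw [← pow_add]; congr 1; ring))

lemma val_refine (K n : ℕ) (k : D K) (j : Fin (2 ^ n)) :
    (refineEquiv K n (k, j) : ℕ) = j + 2 ^ n * k := rfl

lemma dyadic_refine (K n : ℕ) (k : D K) (j : Fin (2 ^ n)) :
    dyadic (K + n) (refineEquiv K n (k, j)) = dyadic K k + j / 2 ^ (K + n) := by
  unfold dyadic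
  rw [val_refine]
  push_cast
  rw [pow_add (2 : ℝ) K n]
  field_simp
  ring

lemma sum_refine (K n : ℕ) (F : D (K + n) → ℝ) : ∑ k, F k = ∑ k, ∑ j, F (refineEquiv K n (k, j)) := by
  rw [← (refineEquiv K n).sum_comp, Fintype.sum_prod_type]

lemma card_refine (K n : ℕ) :
    (Fintype.card (D (K + n)) : ℝ) = Fintype.card (D K) * 2 ^ n := by
  rw [← Fintype.card_congr (refineEquiv K n)]
  simp

/-- Averages over the descendants: the map on densities corresponding to the coarse-graining of
measures. -/
noncomputable def avg (K n : ℕ) : (D (K + n) → ℝ) →L[ℝ] (D K → ℝ) :=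
  ContinuousLinearMap.pi fun k =>
    ((2 : ℝ) ^ n)⁻¹ • ∑ j, ContinuousLinearMap.proj (refineEquiv K n (k, j))

lemma avg_apply (K n : ℕ) (x : D (K + n) → ℝ) (k : D K) :
    avg K n x k = ((2 : ℝ) ^ n)⁻¹ * ∑ j, x (refineEquiv K n (k, j)) := by
  simp [avg]

/-- The right inverse of `avg` that is constant on descendants. -/
noncomputable def spread (K n : ℕ) : (D K → ℝ) →L[ℝ] (D (K + n) → ℝ) :=
  ContinuousLinearMap.pi fun k' => ContinuousLinearMap.proj ((refineEquiv K n).symm k').1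

lemma spread_refine (K n : ℕ) (x : D K → ℝ) (k : D K) (j : Fin (2 ^ n)) :
    spread K n x (refineEquiv K n (k, j)) = x k := by
  simp [spread]

lemma avg_spread (K n : ℕ) (x : D K → ℝ) : avg K n (spread K n x) = x := by
  ext k
  rw [avg_apply]
  simp [spread_refine]

/-- The density at level `K + n` of the discrete measure with density `x` at level `K`: its mass
sits on the left-most descendants. -/
noncomputable def lift (K n : ℕ) (x : D K → ℝ) : D (K + n) → ℝ := fun k' =>
  if ((refineEquiv K n).symm k').2 = 0 then 2 ^ n * x ((refineEquiv K n).symm k').1 else 0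

lemma lift_refine (K n : ℕ) (x : D K → ℝ) (k : D K) (j : Fin (2 ^ n)) :
    lift K n x (refineEquiv K n (k, j)) = if j = 0 then 2 ^ n * x k else 0 := by
  unfold lift
  rw [Equiv.symm_apply_apply]

lemma lift_mem {K n : ℕ} {x : D K → ℝ} (hx : x ∈ closedOrthant (D K)) :
    lift K n x ∈ closedOrthant (D (K + n)) := fun k' => by
  have := hx ((refineEquiv K n).symm k').1
  unfold lift
  split_ifs <;> positivity

lemma avg_mem {K n : ℕ} {x : D (K + n) → ℝ} (hx : x ∈ closedOrthant (D (K + n))) :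
    avg K n x ∈ closedOrthant (D K) := fun k => by
  rw [avg_apply]
  exact mul_nonneg (by positivity) (Finset.sum_nonneg fun j _ => hx _)

lemma avg_mem_openOrthant {K n : ℕ} {x : D (K + n) → ℝ} (hx : x ∈ openOrthant (D (K + n))) :
    avg K n x ∈ openOrthant (D K) := fun k => by
  rw [avg_apply]
  exact mul_pos (by positivity) (Finset.sum_pos (fun j _ => hx _) ⟨0, by simp⟩)

lemma sum_mul_lift (K n : ℕ) (x : D K → ℝ) (F : D (K + n) → ℝ) :
    ∑ k', F k' * lift K n x k' = 2 ^ n * ∑ k, F (refineEquiv K n (k, 0)) * x k := by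
  rw [sum_refine, Finset.mul_sum]
  refine Finset.sum_congr rfl fun k _ => ?_
  simp only [lift_refine, mul_ite, mul_zero, Finset.sum_ite_eq', Finset.mem_univ, if_true]
  ring

lemma norm1_lift {K n : ℕ} {x : D K → ℝ} (hx : x ∈ closedOrthant (D K)) :
    norm1 (lift K n x) = norm1 x := by
  have hd := card_pos_real (D K)
  have h := sum_mul_lift K n x fun _ => 1
  simp only [one_mul] at h
  rw [norm1_of_nonneg (lift_mem hx), norm1_of_nonneg hx, h, card_refine]
  field_simp

lemma norm1_avg_le (K n : ℕ) (x : D (K + n) → ℝ) : norm1 (avg K n x) ≤ norm1 x := by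
  have hd := card_pos_real (D K)
  unfold norm1
  rw [sum_refine, card_refine, mul_inv, mul_assoc]
  refine mul_le_mul_of_nonneg_left ?_ (by positivity)
  rw [Finset.mul_sum]
  refine Finset.sum_le_sum fun k _ => ?_
  rw [avg_apply, abs_mul, abs_of_pos (by positivity)]
  exact mul_le_mul_of_nonneg_left (Finset.abs_sum_le_sum_abs _ _) (by positivity)

lemma norm1_avg {K n : ℕ} {x : D (K + n) → ℝ} (hx : x ∈ closedOrthant (D (K + n))) :
    norm1 (avg K n x) = norm1 x := by
  have hd := card_pos_real (D K)
  rw [norm1_of_nonneg hx, norm1_of_nonneg (avg_mem hx), sum_refine, card_refine]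
  simp only [avg_apply, ← Finset.mul_sum]
  field_simp

lemma dotProduct_avg (K n : ℕ) (q : D K → ℝ) (w : D (K + n) → ℝ) :
    q ⬝ᵥ avg K n w = (((2 : ℝ) ^ n)⁻¹ • spread K n q) ⬝ᵥ w := by
  simp only [dotProduct, Pi.smul_apply, smul_eq_mul]
  rw [sum_refine]
  refine Finset.sum_congr rfl fun k _ => ?_
  simp only [avg_apply, spread_refine, Finset.mul_sum]
  exact Finset.sum_congr rfl fun j _ => by ring

/-- Applied to a lifted vector, the kernel of level `K + n` is an integral against the same discrete
measure as at level `K`, evaluated at the finer points. -/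
lemma card_mul_GMat_mulVec_lift (g : ℝ → ℝ) (K n : ℕ) (x : D K → ℝ) (k' : D (K + n)) :
    (Fintype.card (D (K + n)) : ℝ) * (GMat g (K + n)).mulVec (lift K n x) k' =
      (Fintype.card (D K) : ℝ)⁻¹ * ∑ l, g (dyadic (K + n) k' * dyadic K l) * x l := by
  have hd := card_pos_real (D K)
  rw [card_mul_GMat_mulVec, sum_mul_lift, card_refine]
  simp only [dyadic_refine, Fin.val_zero, Nat.cast_zero, zero_div, add_zero]
  field_simp

lemma CVal_lift (g : ℝ → ℝ) (K n : ℕ) (x : D K → ℝ) :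
    CVal g (K + n) (lift K n x) = CVal g K x := by
  have hd := card_pos_real (D K)
  unfold CVal
  congr 1
  unfold dotProduct
  rw [sum_mul_lift, Finset.mul_sum]
  refine Finset.sum_congr rfl fun k _ => ?_
  have h1 := card_mul_GMat_mulVec_lift g K n x (refineEquiv K n (k, 0))
  have h2 := card_mul_GMat_mulVec g K x k
  simp only [dyadic_refine, Fin.val_zero, Nat.cast_zero, zero_div, add_zero] at h1
  rw [← h2, card_refine, mul_assoc] at h1
  have h3 := mul_left_cancel₀ hd.ne' h1
  rw [← h3]
  ring

variable {g : ℝ → ℝ} {ℓ : ℝ}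

lemma abs_dyadic_refine_sub_le (K n : ℕ) (k : D K) (j : Fin (2 ^ n)) :
    |dyadic (K + n) (refineEquiv K n (k, j)) - dyadic K k| ≤ 1 / 2 ^ K := by
  rw [dyadic_refine, add_sub_cancel_left, abs_of_nonneg (by positivity), pow_add,
    div_le_div_iff₀ (by positivity) (by positivity), one_mul, mul_comm]
  refine mul_le_mul_of_nonneg_left ?_ (by positivity)
  exact_mod_cast j.2.le

lemma abs_sub_le_of_lipschitz (hg : ∀ x ∈ Set.Icc (-1 : ℝ) 1, ∀ y ∈ Set.Icc (-1 : ℝ) 1,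
    |g x - g y| ≤ ℓ * |x - y|) (hℓ : 0 ≤ ℓ) {s s' t r : ℝ} (hs : s ∈ Set.Icc (-1 : ℝ) 1)
    (hs' : s' ∈ Set.Icc (-1 : ℝ) 1) (ht : t ∈ Set.Icc (-1 : ℝ) 1) (hr : |s - s'| ≤ r) :
    |g (s * t) - g (s' * t)| ≤ ℓ * r := by
  have hmem : ∀ u ∈ Set.Icc (-1 : ℝ) 1, u * t ∈ Set.Icc (-1 : ℝ) 1 := fun u hu => by
    rw [Set.mem_Icc, ← abs_le, abs_mul]
    exact mul_le_one₀ (abs_le.2 hu) (abs_nonneg _) (abs_le.2 ht)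
  refine (hg _ (hmem s hs) _ (hmem s' hs')).trans (mul_le_mul_of_nonneg_left ?_ hℓ)
  rw [← sub_mul, abs_mul]
  exact (mul_le_of_le_one_right (abs_nonneg _) (abs_le.2 ht)).trans hr

/-- Lifting a vector of the cone changes the image under the kernel by at most `ℓ ‖x‖₁ 2^{-K}`. -/
lemma dualNorm1_spread_sub_le (hg : ∀ x ∈ Set.Icc (-1 : ℝ) 1, ∀ y ∈ Set.Icc (-1 : ℝ) 1,
    |g x - g y| ≤ ℓ * |x - y|) (hℓ : 0 ≤ ℓ) (K n : ℕ) {x : D K → ℝ}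
    (hx : x ∈ closedOrthant (D K)) :
    dualNorm1 (((2 : ℝ) ^ n)⁻¹ • spread K n ((GMat g K).mulVec x)
      - (GMat g (K + n)).mulVec (lift K n x)) ≤ ℓ * (1 / 2 ^ K) * norm1 x := by
  have hd := card_pos_real (D K)
  have hd' := card_pos_real (D (K + n))
  refine dualNorm1_le_iff.2 fun k' => ?_
  obtain ⟨⟨k, j⟩, rfl⟩ := (refineEquiv K n).surjective k'
  rw [← abs_of_pos hd', ← abs_mul, Pi.sub_apply, mul_sub,
    card_mul_GMat_mulVec_lift, Pi.smul_apply, spread_refine, smul_eq_mul, card_refine]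
  have e1 : (Fintype.card (D K) : ℝ) * 2 ^ n * (((2 : ℝ) ^ n)⁻¹ * (GMat g K).mulVec x k)
      = Fintype.card (D K) * (GMat g K).mulVec x k := by field_simp
  rw [e1, card_mul_GMat_mulVec, ← mul_sub, ← Finset.sum_sub_distrib, abs_mul,
    abs_of_pos (inv_pos.2 hd), norm1_of_nonneg hx, mul_left_comm]
  refine mul_le_mul_of_nonneg_left ?_ (inv_pos.2 hd).le
  rw [Finset.mul_sum]
  refine (Finset.abs_sum_le_sum_abs _ _).trans (Finset.sum_le_sum fun l _ => ?_)
  rw [← sub_mul, abs_mul, abs_of_nonneg (hx l)]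
  refine mul_le_mul_of_nonneg_right ?_ (hx l)
  refine abs_sub_le_of_lipschitz hg hℓ (dyadic_mem _ _) (dyadic_mem _ _) (dyadic_mem _ _) ?_
  rw [abs_sub_comm]
  exact abs_dyadic_refine_sub_le K n k j

/-- Coarse-graining a vector of the cone changes its image under the kernel by at most
`ℓ ‖x‖₁ 2^{-K}`. -/
lemma dualNorm1_GMat_sub_lift_avg_le (hg : ∀ x ∈ Set.Icc (-1 : ℝ) 1, ∀ y ∈ Set.Icc (-1 : ℝ) 1,
    |g x - g y| ≤ ℓ * |x - y|) (hℓ : 0 ≤ ℓ) (K n : ℕ) {x : D (K + n) → ℝ}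
    (hx : x ∈ closedOrthant (D (K + n))) :
    dualNorm1 ((GMat g (K + n)).mulVec (x - lift K n (avg K n x))) ≤
      ℓ * (1 / 2 ^ K) * norm1 x := by
  have hd := card_pos_real (D K)
  have hd' := card_pos_real (D (K + n))
  refine dualNorm1_le_iff.2 fun k' => ?_
  rw [← abs_of_pos hd', ← abs_mul, Matrix.mulVec_sub, Pi.sub_apply, mul_sub,
    card_mul_GMat_mulVec_lift, card_mul_GMat_mulVec, norm1_of_nonneg hx]
  have e1 : (Fintype.card (D K) : ℝ)⁻¹ *
      ∑ l, g (dyadic (K + n) k' * dyadic K l) * avg K n x l = (Fintype.card (D (K + n)) : ℝ)⁻¹ *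
      ∑ l, ∑ j, g (dyadic (K + n) k' * dyadic K l) * x (refineEquiv K n (l, j)) := by
    rw [card_refine, mul_inv, mul_assoc, Finset.mul_sum _ _ ((2 : ℝ) ^ n)⁻¹]
    congr 1
    refine Finset.sum_congr rfl fun l _ => ?_
    rw [avg_apply, ← Finset.mul_sum]
    ring
  rw [e1, ← mul_sub, abs_mul, abs_of_pos (inv_pos.2 hd'), mul_left_comm]
  refine mul_le_mul_of_nonneg_left ?_ (inv_pos.2 hd').le
  rw [sum_refine, sum_refine K n x, ← Finset.sum_sub_distrib, Finset.mul_sum]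
  refine (Finset.abs_sum_le_sum_abs _ _).trans (Finset.sum_le_sum fun l _ => ?_)
  rw [← Finset.sum_sub_distrib, Finset.mul_sum]
  refine (Finset.abs_sum_le_sum_abs _ _).trans (Finset.sum_le_sum fun j _ => ?_)
  rw [← sub_mul, abs_mul, abs_of_nonneg (hx _)]
  refine mul_le_mul_of_nonneg_right ?_ (hx _)
  rw [mul_comm (dyadic (K + n) k'), mul_comm (dyadic (K + n) k')]
  exact abs_sub_le_of_lipschitz hg hℓ (dyadic_mem _ _) (dyadic_mem _ _) (dyadic_mem _ _)
    (abs_dyadic_refine_sub_le K n l j)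

end Refinement

/-! ### Discretized measures -/

section Measures

lemma discMeasure_lift (K n : ℕ) (x : D K → ℝ) :
    discMeasure (K + n) (lift K n x) = discMeasure K x := by
  unfold discMeasure
  rw [← (refineEquiv K n).sum_comp, Fintype.sum_prod_type]
  refine Finset.sum_congr rfl fun k _ => ?_
  have hpt : dyadicPt (K + n) (refineEquiv K n (k, 0)) = dyadicPt K k := by
    apply Subtype.ext
    simp [dyadicPt, dyadic_refine]
  have hcard : (Fintype.card (D (K + n)) : ℝ≥0) = Fintype.card (D K) * 2 ^ n := by
    rw [← Fintype.card_congr (refineEquiv K n)]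
    simp
  rw [Finset.sum_eq_single 0]
  · rw [hpt, lift_refine, if_pos rfl, hcard, Real.toNNReal_mul (by positivity)]
    congr 1
    rw [Real.toNNReal_pow (by norm_num), Real.toNNReal_ofNat, mul_comm,
      mul_div_mul_right _ _ (by positivity)]
  · intro j _ hj
    rw [lift_refine, if_neg hj]
    simp
  · simp

lemma discMeasure_apply (K : ℕ) (x : D K → ℝ) {A : Set I} (hA : MeasurableSet A) :
    (discMeasure K x A : ℝ) = (Fintype.card (D K) : ℝ)⁻¹ *
      ∑ k, max (x k) 0 * A.indicator (fun _ => 1) (dyadicPt K k) := by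
  have h1 : ∀ s : Finset (D K), ((∑ k ∈ s, ((x k).toNNReal / (Fintype.card (D K) : ℝ≥0)) •
      (diracProba (dyadicPt K k)).toFiniteMeasure : FiniteMeasure I) A : ℝ) =
      (Fintype.card (D K) : ℝ)⁻¹ *
      ∑ k ∈ s, max (x k) 0 * A.indicator (fun _ => 1) (dyadicPt K k) := fun s => by
    induction s using Finset.induction_on with
    | empty => simp
    | insert k s hk ih =>
      rw [Finset.sum_insert hk, Finset.sum_insert hk, FiniteMeasure.coeFn_add, Pi.add_apply,
        NNReal.coe_add, ih, mul_add]
      congr 1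
      rw [FiniteMeasure.coeFn_smul, Pi.smul_apply, ProbabilityMeasure.toFiniteMeasure_apply]
      have h2 : ((diracProba (dyadicPt K k) A : ℝ≥0) : ℝ) =
          A.indicator (fun _ => (1 : ℝ)) (dyadicPt K k) := by
        have h3 := diracProba_toMeasure_apply' (dyadicPt K k) hA
        rw [← ProbabilityMeasure.ennreal_coeFn_eq_coeFn_toMeasure] at h3
        rw [← ENNReal.coe_toReal, h3]
        by_cases hmem : dyadicPt K k ∈ A <;> simp [hmem]
      rw [smul_eq_mul, NNReal.coe_mul, h2, NNReal.coe_div, Real.coe_toNNReal',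
        NNReal.coe_natCast]
      ring
  exact h1 Finset.univ

lemma tv_nonneg (μ ν : FiniteMeasure I) : 0 ≤ tv μ ν :=
  Real.iSup_nonneg fun _ => abs_nonneg _

lemma tv_discMeasure_le (K : ℕ) (x y : D K → ℝ) :
    tv (discMeasure K x) (discMeasure K y) ≤ norm1 (x - y) := by
  refine Real.iSup_le (fun A => ?_) (norm1_nonneg _)
  rw [discMeasure_apply K x A.2, discMeasure_apply K y A.2, ← mul_sub,
    ← Finset.sum_sub_distrib, abs_mul, abs_of_nonneg (by positivity)]
  refine mul_le_mul_of_nonneg_left ?_ (by positivity)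
  refine (Finset.abs_sum_le_sum_abs _ _).trans (Finset.sum_le_sum fun k _ => ?_)
  rw [← sub_mul, abs_mul]
  have h1 : |A.1.indicator (fun _ => (1 : ℝ)) (dyadicPt K k)| ≤ 1 := by
    by_cases hmem : dyadicPt K k ∈ A.1 <;> simp [hmem]
  refine (mul_le_of_le_one_right (abs_nonneg _) h1).trans ?_
  exact abs_max_sub_max_le_abs _ _ _

lemma lipTV_nonneg (ψ : FiniteMeasure I → ℝ) : 0 ≤ lipTV ψ :=
  Real.iSup_nonneg fun _ => div_nonneg (abs_nonneg _) (tv_nonneg _ _)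

lemma abs_sub_le_lipTV {ψ : FiniteMeasure I → ℝ} (hψ : LipschitzTV ψ) (μ ν : FiniteMeasure I) :
    |ψ μ - ψ ν| ≤ lipTV ψ * tv μ ν := by
  obtain ⟨L, hL⟩ := hψ
  rcases (tv_nonneg μ ν).eq_or_lt with h | h
  · have := hL μ ν
    rw [← h, mul_zero] at this ⊢
    exact this
  · rw [← div_le_iff₀ h]
    refine le_ciSup (f := fun p : FiniteMeasure I × FiniteMeasure I =>
      |ψ p.1 - ψ p.2| / tv p.1 p.2) ⟨|L|, ?_⟩ (μ, ν)
    rintro _ ⟨p, rfl⟩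
    refine div_le_of_le_mul₀ (tv_nonneg _ _) (abs_nonneg _) ((hL p.1 p.2).trans ?_)
    exact mul_le_mul_of_nonneg_right (le_abs_self L) (tv_nonneg _ _)

lemma abs_projInit_sub_le {ψ : FiniteMeasure I → ℝ} (hψ : LipschitzTV ψ) (K : ℕ)
    (x y : D K → ℝ) : |projInit ψ K x - projInit ψ K y| ≤ lipTV ψ * norm1 (x - y) :=
  (abs_sub_le_lipTV hψ _ _).trans
    (mul_le_mul_of_nonneg_left (tv_discMeasure_le K x y) (lipTV_nonneg ψ))

lemma proj_mem (K : ℕ) (μ : FiniteMeasure I) : proj K μ ∈ closedOrthant (D K) := fun k => by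
  unfold proj; positivity

/-- A dyadic interval is the disjoint union of its descendants. -/
lemma avg_proj (K n : ℕ) (μ : FiniteMeasure I) : avg K n (proj (K + n) μ) = proj K μ := by
  ext k
  set J : ∀ N : ℕ, D N → Set I := fun N k =>
    {y : I | dyadic N k ≤ (y : ℝ) ∧ (y : ℝ) < dyadic N k + 1 / 2 ^ N} with hJ
  have hmeas : ∀ N k, MeasurableSet (J N k) := fun N k =>
    (measurableSet_le measurable_const measurable_subtype_coe).inter
      (measurableSet_lt measurable_subtype_coe measurable_const)
  have hpos : (0 : ℝ) < 2 ^ (K + n) := by positivity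
  have hmem : ∀ (j : Fin (2 ^ n)) (y : I), y ∈ J (K + n) (refineEquiv K n (k, j)) ↔
      (j : ℝ) ≤ ((y : ℝ) - dyadic K k) * 2 ^ (K + n) ∧
        ((y : ℝ) - dyadic K k) * 2 ^ (K + n) < j + 1 := fun j y => by
    simp only [hJ, Set.mem_ofPred_eq, dyadic_refine]
    rw [add_assoc, ← add_div, ← le_sub_iff_add_le', ← sub_lt_iff_lt_add', div_le_iff₀ hpos,
      lt_div_iff₀ hpos]
  have hunion : J K k = ⋃ j, J (K + n) (refineEquiv K n (k, j)) := by
    ext y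
    rw [Set.mem_iUnion]
    constructor
    · intro hy
      have h0 : 0 ≤ ((y : ℝ) - dyadic K k) * 2 ^ (K + n) :=
        mul_nonneg (sub_nonneg.2 hy.1) hpos.le
      have h1 : ((y : ℝ) - dyadic K k) * 2 ^ (K + n) < (2 ^ n : ℕ) := by
        have h2 : (y : ℝ) - dyadic K k < 1 / 2 ^ K := by linarith [hy.2]
        have h3 := mul_lt_mul_of_pos_right h2 hpos
        rw [pow_add] at h3 ⊢
        push_cast
        have h4 : (1 : ℝ) / 2 ^ K * (2 ^ K * 2 ^ n) = 2 ^ n := by field_simp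
        linarith
      refine ⟨⟨⌊((y : ℝ) - dyadic K k) * 2 ^ (K + n)⌋₊, (Nat.floor_lt h0).2 h1⟩, ?_⟩
      rw [hmem]
      exact ⟨Nat.floor_le h0, Nat.lt_floor_add_one _⟩
    · rintro ⟨j, hj⟩
      rw [hmem] at hj
      have h1 : (j : ℝ) + 1 ≤ 2 ^ n := by exact_mod_cast j.2
      have h0 : (0 : ℝ) ≤ j := Nat.cast_nonneg _
      constructor
      · have := nonneg_of_mul_nonneg_left (h0.trans hj.1) hpos
        linarith
      · have h2 := hj.2.trans_le h1
        rw [pow_add, ← mul_assoc] at h2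
        have h3 : ((y : ℝ) - dyadic K k) * 2 ^ K < 1 := by
          have : (0 : ℝ) < 2 ^ n := by positivity
          nlinarith
        rw [← lt_div_iff₀ (by positivity)] at h3
        linarith
  have hdisj : Pairwise (Function.onFun Disjoint fun j => J (K + n) (refineEquiv K n (k, j))) := by
    intro i j hij
    refine Set.disjoint_left.2 fun y hi hj => hij ?_
    rw [hmem] at hi hj
    have h1 : (i : ℝ) < j + 1 := hi.1.trans_lt hj.2
    have h2 : (j : ℝ) < i + 1 := hj.1.trans_lt hi.2
    have h1 : (i : ℕ) < j + 1 := by exact_mod_cast h1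
    have h2 : (j : ℕ) < i + 1 := by exact_mod_cast h2
    exact Fin.ext (by omega)
  have hreal : ∀ A : Set I, (μ A : ℝ) = (μ : Measure I).real A := fun A => rfl
  rw [avg_apply]
  have e1 : ∀ j, proj (K + n) μ (refineEquiv K n (k, j)) = (Fintype.card (D (K + n)) : ℝ) *
      (μ : Measure I).real (J (K + n) (refineEquiv K n (k, j))) := fun j => rfl
  have e2 : proj K μ k = (Fintype.card (D K) : ℝ) * (μ : Measure I).real (J K k) := rfl
  simp only [e1]
  rw [e2, hunion, measureReal_iUnion_fintype hdisj (fun j => hmeas _ _), ← Finset.mul_sum,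
    card_refine]
  field_simp

lemma norm1_proj (K : ℕ) (μ : FiniteMeasure I) : norm1 (proj K μ) = norm1 (proj 0 μ) := by
  have h := norm1_avg (K := 0) (n := K) (proj_mem (0 + K) μ)
  rw [avg_proj] at h
  rw [h, zero_add]

end Measures

/-! ### Existence, uniqueness and stability of solutions -/

section Stability

variable {ι : Type} [Fintype ι]

lemma contDiff_linear (c e : ℝ) :
    ContDiff ℝ ∞ fun q : ℝ × (ι → ℝ) => c * q.1 + ∑ k, e * q.2 k := by
  refine (contDiff_const.mul contDiff_fst).add (ContDiff.sum fun k _ => contDiff_const.mul ?_)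
  exact ((ContinuousLinearMap.proj (R := ℝ) (φ := fun _ : ι => ℝ) k).comp
    (ContinuousLinearMap.snd ℝ ℝ (ι → ℝ))).contDiff

variable [DecidableEq ι]

/-- Adding a linear function to a supersolution modifies the equation accordingly. -/
lemma IsViscositySupersolution.add_linear [Nonempty ι] {H H' : (ι → ℝ) → ℝ} {c e : ℝ}
    (hH : ∀ y, H (y + fun _ => e) ≤ H' y + c) {w : ℝ × (ι → ℝ) → ℝ}
    (hc : ContinuousOn w (Set.Ici 0 ×ˢ openOrthant ι)) (hw : IsViscositySupersolution H' w) :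
    IsViscositySupersolution H (fun q => w q + (c * q.1 + ∑ k, e * q.2 k)) := by
  have hlin := contDiff_linear (ι := ι) c e
  refine ⟨(hc.add hlin.continuous.continuousOn).lowerSemicontinuousOn, fun φ hφ p hp hmin => ?_⟩
  have hopen : IsOpen (Set.Ioi (0 : ℝ) ×ˢ openOrthant ι) := isOpen_Ioi.prod isOpen_openOrthant
  have hd : DifferentiableAt ℝ φ p :=
    (hφ.contDiffAt (hopen.mem_nhds hp)).differentiableAt (by simp)
  have hd' : DifferentiableAt ℝ (fun q : ℝ × (ι → ℝ) => c * q.1 + ∑ k, e * q.2 k) p :=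
    hlin.differentiable (by simp) p
  obtain ⟨e1, e2⟩ := dt_dx_separable (A := fun t => c * t) (B := fun (_ : ι) r => e * r) (p := p)
    (a' := c) (b' := fun _ => e) (by simpa using (hasDerivAt_id p.1).const_mul c)
    (fun k => by simpa using (hasDerivAt_id (p.2 k)).const_mul e)
  have h := hw.2 (fun q => φ q - (c * q.1 + ∑ k, e * q.2 k)) (hφ.sub hlin.contDiffOn) p hp
    (by
      have hfun : (fun q => w q - (φ q - (c * q.1 + ∑ k, e * q.2 k)))
          = fun q => w q + (c * q.1 + ∑ k, e * q.2 k) - φ q := by ext q; ring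
      rw [hfun]
      exact hmin)
  have hF := fderiv_fun_sub hd hd'
  have f1 : dt (fun q => φ q - (c * q.1 + ∑ k, e * q.2 k)) p = dt φ p - c := by
    unfold dt
    rw [hF]
    exact congrArg (fderiv ℝ φ p (1, 0) - ·) e1
  have f2 : dx (fun q => φ q - (c * q.1 + ∑ k, e * q.2 k)) p = dx φ p - fun _ => e := by
    ext k
    unfold dx
    rw [hF]
    exact congrArg (fderiv ℝ φ p (0, Pi.single k 1) - ·) (congrFun e2 k)
  rw [f1, f2] at h
  have := hH (dx φ p - fun _ => e)
  rw [sub_add_cancel] at this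
  linarith

/-- Quantitative comparison: an error `ε` in the equation and an error `ε₁ ‖x‖₁` in the initial
condition propagate linearly in time. -/
theorem le_of_perturbation [Nonempty ι] {H : (ι → ℝ) → ℝ} {V ε ε₁ : ℝ} (hmono : Monotone H)
    (hlip : ∀ y y', |H y - H y'| ≤ V * dualNorm1 (y - y')) (hε : 0 ≤ ε) (hε₁ : 0 ≤ ε₁)
    {u w : ℝ × (ι → ℝ) → ℝ} (hu : MemL u) (hw : MemL w)
    (huc : ContinuousOn u (Set.Ici 0 ×ˢ openOrthant ι))
    (hwc : ContinuousOn w (Set.Ici 0 ×ˢ openOrthant ι))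
    (hsub : IsViscositySubsolution H u) (hsup : IsViscositySupersolution (fun y => H y - ε) w)
    (h0 : ∀ x ∈ openOrthant ι, u (0, x) ≤ w (0, x) + ε₁ * norm1 x) {p : ℝ × (ι → ℝ)}
    (hp : p ∈ Set.Ici (0 : ℝ) ×ˢ openOrthant ι) :
    u p ≤ w p + (ε₁ * norm1 p.2 + (ε + V * ε₁) * p.1) := by
  have hd := card_pos_real ι
  have hV := lipschitz_const_nonneg hlip
  obtain ⟨-, Cu, hCu⟩ := hu
  obtain ⟨⟨Lw, hLw⟩, Cw, hCw⟩ := hw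
  set c := ε + V * ε₁ with hc
  have hc0 : 0 ≤ c := by positivity
  set e := ε₁ * (Fintype.card ι : ℝ)⁻¹ with he
  have hlin : ∀ x ∈ openOrthant ι, ∑ k, e * x k = ε₁ * norm1 x := fun x hx => by
    rw [norm1_of_nonneg (openOrthant_subset_closedOrthant hx), ← Finset.mul_sum, he, mul_assoc]
  have time : ∀ {v : ℝ × (ι → ℝ) → ℝ} {C : ℝ}, (∀ t : ℝ, 0 < t → ∀ x ∈ closedOrthant ι,
      |v (t, x) - v (0, x)| ≤ C * t) → ∀ q ∈ Set.Ici (0 : ℝ) ×ˢ openOrthant ι,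
      |v q - v (0, q.2)| ≤ |C| * q.1 := fun {v C} h q hq => by
    rcases (show (0 : ℝ) ≤ q.1 from hq.1).eq_or_lt with h1 | h1
    · have : q = (0, q.2) := Prod.ext h1.symm rfl
      rw [← h1, mul_zero, this]
      simp
    · refine (h q.1 h1 q.2 (openOrthant_subset_closedOrthant hq.2)).trans ?_
      exact mul_le_mul_of_nonneg_right (le_abs_self C) h1.le
  have hsup' : IsViscositySupersolution H (fun q => w q + (c * q.1 + ∑ k, e * q.2 k)) := by
    refine IsViscositySupersolution.add_linear (fun y => ?_) hwc hsup
    have h1 := (le_abs_self _).trans (hlip (y + fun _ => e) y)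
    have h2 : dualNorm1 (y + (fun _ => e) - y) ≤ ε₁ := by
      rw [add_sub_cancel_left]
      refine dualNorm1_le_iff.2 fun k => ?_
      rw [abs_of_nonneg (by positivity), he]
      field_simp
      exact le_rfl
    have h3 := mul_le_mul_of_nonneg_left h2 hV
    linarith
  have hC : 0 ≤ |Lw| + ε₁ + |Cu| + |Cw| := by positivity
  have h := comparison (w := fun q => w q + (c * q.1 + ∑ k, e * q.2 k)) hmono hlip hC huc
    (hwc.add (contDiff_linear (ι := ι) c e).continuous.continuousOn) hsub hsup'
    (fun p hp q hq => by
      have h1 := (abs_le.1 (time hCu p hp)).2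
      have h2 := (abs_le.1 (time hCw q hq)).1
      have h3 := h0 p.2 hp.2
      have h4 := (le_abs_self _).trans (hLw p.2 (openOrthant_subset_closedOrthant hp.2) q.2
        (openOrthant_subset_closedOrthant hq.2))
      have hp1 : 0 ≤ p.1 := hp.1
      have hq1 : 0 ≤ q.1 := hq.1
      have h5 : 0 ≤ c * q.1 := mul_nonneg hc0 hq1
      have h6 : norm1 p.2 ≤ norm1 (p.2 - q.2) + norm1 q.2 := by
        unfold norm1
        rw [← mul_add, ← Finset.sum_add_distrib]
        refine mul_le_mul_of_nonneg_left (Finset.sum_le_sum fun k _ => ?_) (by positivity)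
        simpa using abs_add_le (p.2 k - q.2 k) (q.2 k)
      have h7 := mul_le_mul_of_nonneg_left h6 hε₁
      have h8 : norm1 (p.2 - q.2) ≤ ∑ k, |p.2 k - q.2 k| := norm1_le_sum _
      have h9 : Lw * norm1 (p.2 - q.2) ≤ |Lw| * ∑ k, |p.2 k - q.2 k| :=
        mul_le_mul (le_abs_self _) h8 (norm1_nonneg _) (abs_nonneg _)
      have h10 := mul_le_mul_of_nonneg_left h8 hε₁
      have hs : 0 ≤ ∑ k, |p.2 k - q.2 k| := by positivity
      have i1 : 0 ≤ |Cu| * (∑ k, |p.2 k - q.2 k| + q.1) := by positivity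
      have i2 : 0 ≤ |Cw| * (∑ k, |p.2 k - q.2 k| + p.1) := by positivity
      have i3 : 0 ≤ (|Lw| + ε₁) * (p.1 + q.1) := by positivity
      rw [hlin q.2 hq.2]
      linarith) hp
  rw [hlin p.2 hp.2] at h
  linarith

/-- Uniqueness in `𝔏_unif`. -/
theorem IsSolution.eqOn [Nonempty ι] {H : (ι → ℝ) → ℝ} {V : ℝ} (hmono : Monotone H)
    (hlip : ∀ y y', |H y - H y'| ≤ V * dualNorm1 (y - y')) {u₀ : (ι → ℝ) → ℝ}
    {u v : ℝ × (ι → ℝ) → ℝ} (hu : IsSolution H u₀ u) (hv : IsSolution H u₀ v) :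
    Set.EqOn u v (Set.Ici 0 ×ˢ closedOrthant ι) := by
  have key : ∀ {u v : ℝ × (ι → ℝ) → ℝ}, IsSolution H u₀ u → IsSolution H u₀ v →
      ∀ p ∈ Set.Ici (0 : ℝ) ×ˢ openOrthant ι, u p ≤ v p := fun {u v} hu hv p hp => by
    have := le_of_perturbation hmono hlip le_rfl le_rfl hu.memLUnif.1 hv.memLUnif.1
      hu.viscosity.1 hv.viscosity.1 hu.viscosity.2.1 (by simpa using hv.viscosity.2.2)
      (fun x hx => by
        rw [hu.initial x (openOrthant_subset_closedOrthant hx),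
          hv.initial x (openOrthant_subset_closedOrthant hx)]
        simp) hp
    simpa using this
  rintro ⟨t, x⟩ ⟨ht, hx⟩
  -- Both functions are continuous in space up to the boundary.
  set path : ℝ → ι → ℝ := fun σ => x + fun _ => σ with hpath
  have hpos : ∀ σ > 0, path σ ∈ openOrthant ι := fun σ hσ k =>
    add_pos_of_nonneg_of_pos (hx k) hσ
  have hlim : ∀ {u : ℝ × (ι → ℝ) → ℝ}, IsSolution H u₀ u →
      Tendsto (fun σ => u (t, path σ)) (𝓝[>] 0) (𝓝 (u (t, x))) := fun {u} hu => by
    obtain ⟨-, C, hC⟩ := hu.memLUnif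
    have hb : Tendsto (fun σ : ℝ => C * norm1 (path σ - x)) (𝓝[>] 0) (𝓝 0) := by
      have h1 : Continuous fun σ : ℝ => C * norm1 (path σ - x) := by
        simp only [hpath, add_sub_cancel_left, norm1]
        fun_prop
      have h2 := h1.tendsto 0
      simp only [hpath, add_sub_cancel_left] at h2
      have h3 : norm1 (fun _ : ι => (0 : ℝ)) = 0 := by simp [norm1]
      rw [h3, mul_zero] at h2
      simp only [hpath, add_sub_cancel_left]
      exact h2.mono_left nhdsWithin_le_nhds
    rw [tendsto_iff_dist_tendsto_zero]
    refine squeeze_zero' (Eventually.of_forall fun _ => dist_nonneg) ?_ hb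
    filter_upwards [self_mem_nhdsWithin] with σ hσ
    exact hC t ht _ (openOrthant_subset_closedOrthant (hpos σ hσ)) x hx
  refine tendsto_nhds_unique (hlim hu) ((hlim hv).congr' ?_)
  filter_upwards [self_mem_nhdsWithin] with σ hσ
  exact le_antisymm (key hv hu _ ⟨ht, hpos σ hσ⟩) (key hu hv _ ⟨ht, hpos σ hσ⟩)

namespace IsSchemeLimit

variable {H : (ι → ℝ) → ℝ} {V L : ℝ} {u₀ : (ι → ℝ) → ℝ} {u : ℝ × (ι → ℝ) → ℝ}

lemma continuous [Nonempty ι] (h : IsSchemeLimit H V u₀ u) (hmono : Monotone H)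
    (hlip : ∀ y y', |H y - H y'| ≤ V * dualNorm1 (y - y')) (hV : 0 < V) (hL : 0 ≤ L)
    (hu : ∀ x y, |u₀ x - u₀ y| ≤ L * norm1 (x - y)) : Continuous u := by
  refine continuous_iff_continuousAt.2 fun p => ?_
  have hb : Continuous fun q : ℝ × (ι → ℝ) =>
      (|H 0| + V * L) * |q.1 - p.1| + L * norm1 (q.2 - p.2) := by
    unfold norm1; fun_prop
  have h2 := hb.tendsto p
  have h3 : norm1 (0 : ι → ℝ) = 0 := by simp [norm1]
  simp only [sub_self, abs_zero, mul_zero, h3, add_zero] at h2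
  exact tendsto_iff_dist_tendsto_zero.2 (squeeze_zero (fun _ => dist_nonneg)
    (fun q => h.abs_sub_le hmono hlip hV hL hu q p) h2)

lemma abs_sub_le_space [Nonempty ι] (h : IsSchemeLimit H V u₀ u) (hmono : Monotone H)
    (hlip : ∀ y y', |H y - H y'| ≤ V * dualNorm1 (y - y')) (hV : 0 < V) (hL : 0 ≤ L)
    (hu : ∀ x y, |u₀ x - u₀ y| ≤ L * norm1 (x - y)) (t : ℝ) (x y : ι → ℝ) :
    |u (t, x) - u (t, y)| ≤ L * norm1 (x - y) := by
  simpa using h.abs_sub_le hmono hlip hV hL hu (t, x) (t, y)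

lemma abs_sub_le_time [Nonempty ι] (h : IsSchemeLimit H V u₀ u) (hmono : Monotone H)
    (hlip : ∀ y y', |H y - H y'| ≤ V * dualNorm1 (y - y')) (hV : 0 < V) (hL : 0 ≤ L)
    (hu : ∀ x y, |u₀ x - u₀ y| ≤ L * norm1 (x - y)) {t : ℝ} (ht : 0 ≤ t) (x : ι → ℝ) :
    |u (t, x) - u (0, x)| ≤ (|H 0| + V * L) * t := by
  have := h.abs_sub_le hmono hlip hV hL hu (t, x) (0, x)
  simpa [norm1, abs_of_nonneg ht] using this

lemma ge_of_isSuperjet_neg [Nonempty ι] (h : IsSchemeLimit H V u₀ u) (hmono : Monotone H)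
    (hlip : ∀ y y', |H y - H y'| ≤ V * dualNorm1 (y - y')) (hV : 0 < V) (hL : 0 ≤ L)
    (hu : ∀ x y, |u₀ x - u₀ y| ≤ L * norm1 (x - y)) {p : ℝ × (ι → ℝ)} (hp : 0 < p.1)
    {a : ℝ} {b : ι → ℝ} (hab : IsSuperjet (-u) p (-a) (-b)) : H b ≤ a := by
  have := h.neg.le_of_isSuperjet (L := L) (fun x y hxy => neg_le_neg (hmono (neg_le_neg hxy)))
    (fun y y' => by
      rw [neg_sub_neg, abs_sub_comm]
      refine (hlip _ _).trans_eq ?_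
      rw [← dualNorm1_neg]
      congr 2
      abel) hV hL (fun x y => by
      rw [Pi.neg_apply, Pi.neg_apply, neg_sub_neg, abs_sub_comm]; exact hu x y) hp hab
  rw [neg_neg] at this
  linarith

/-- Limits of the scheme are solutions. -/
theorem isSolution [Nonempty ι] (h : IsSchemeLimit H V u₀ u) (hmono : Monotone H)
    (hlip : ∀ y y', |H y - H y'| ≤ V * dualNorm1 (y - y')) (hV : 0 < V) (hL : 0 ≤ L)
    (hu : ∀ x y, |u₀ x - u₀ y| ≤ L * norm1 (x - y)) : IsSolution H u₀ u where
  memLUnif := ⟨⟨⟨L, fun x _ y _ => h.abs_sub_le_space hmono hlip hV hL hu 0 x y⟩,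
    |H 0| + V * L, fun _ ht x _ => h.abs_sub_le_time hmono hlip hV hL hu ht.le x⟩,
    L, fun t _ x _ y _ => h.abs_sub_le_space hmono hlip hV hL hu t x y⟩
  viscosity := by
    have hc := (h.continuous hmono hlip hV hL hu).continuousOn
      (s := Set.Ici 0 ×ˢ openOrthant ι)
    exact ⟨hc, isViscositySubsolution_of_superjet hc fun p hp a b hab =>
        h.le_of_isSuperjet hmono hlip hV hL hu hp.1 hab,
      isViscositySupersolution_of_superjet hc fun p hp a b hab =>
        h.ge_of_isSuperjet_neg hmono hlip hV hL hu hp.1 hab⟩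
  initial x _ := h.initial x

end IsSchemeLimit

end Stability

/-! ### Convergence of the projected solutions -/

section Convergence

variable {g : ℝ → ℝ} {ψ : FiniteMeasure I → ℝ} {ℓ a : ℝ}

lemma IsExtension.mono {K : ℕ} {R V V' : ℝ} {H : (D K → ℝ) → ℝ} (h : IsExtension g K R V H)
    (hV : V ≤ V') : IsExtension g K R V' H :=
  ⟨h.monotone, h.agrees, fun y y' =>
    (h.lipschitz y y').trans (mul_le_mul_of_nonneg_right hV (dualNorm1_nonneg _))⟩

lemma convex_enlarge_Kset (g : ℝ → ℝ) (a : ℝ) (K : ℕ) : Convex ℝ (enlarge (Kset g a K)) := by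
  have hd := card_pos_real (D K)
  rintro y ⟨_, ⟨x, hx, hxa, rfl⟩, hy⟩ y' ⟨_, ⟨x', hx', hxa', rfl⟩, hy'⟩ s s' hs hs' hss
  refine ⟨_, ⟨s • x + s' • x', convex_closedOrthant _ hx hx' hs hs' hss, ?_, rfl⟩, ?_⟩
  · rw [norm1_of_nonneg (convex_closedOrthant _ hx hx' hs hs' hss)]
    rw [norm1_of_nonneg hx] at hxa
    rw [norm1_of_nonneg hx'] at hxa'
    simp only [Pi.add_apply, Pi.smul_apply, smul_eq_mul, Finset.sum_add_distrib,
      ← Finset.mul_sum]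
    have h1 := mul_le_mul_of_nonneg_left hxa hs
    have h2 := mul_le_mul_of_nonneg_left hxa' hs'
    have h3 : s * a + s' * a = a := by rw [← add_mul, hss, one_mul]
    linarith
  · rw [dualNorm1_le_iff] at hy hy' ⊢
    intro k
    have e : (s • y + s' • y' - (GMat g K).mulVec (s • x + s' • x')) k
        = s * (y - (GMat g K).mulVec x) k + s' * (y' - (GMat g K).mulVec x') k := by
      simp only [Matrix.mulVec_add, Matrix.mulVec_smul, Pi.sub_apply, Pi.add_apply,
        Pi.smul_apply, smul_eq_mul]
      ring
    rw [e]
    have h0 := abs_add_le (s * (y - (GMat g K).mulVec x) k) (s' * (y' - (GMat g K).mulVec x') k)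
    rw [abs_mul, abs_mul, abs_of_nonneg hs, abs_of_nonneg hs'] at h0
    have h1 := mul_le_mul_of_nonneg_left (hy k) hs
    have h2 := mul_le_mul_of_nonneg_left (hy' k) hs'
    have h3 := mul_le_mul_of_nonneg_left h0 hd.le
    have h4 : s * (1 / √(Fintype.card (D K) : ℝ)) + s' * (1 / √(Fintype.card (D K) : ℝ))
        = 1 / √(Fintype.card (D K) : ℝ) := by rw [← add_mul, hss, one_mul]
    linarith

lemma exists_of_mem_closure_enlarge {K : ℕ} {q : D K → ℝ}
    (hq : q ∈ closure (enlarge (Kset g a K))) : ∃ x ∈ closedOrthant (D K), norm1 x ≤ a ∧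
      dualNorm1 (q - (GMat g K).mulVec x) ≤ 2 / √(Fintype.card (D K) : ℝ) := by
  have hd := card_pos_real (D K)
  set d : ℝ := ((Fintype.card (D K) : ℕ) : ℝ) with hdd
  have hρ : 0 < 1 / √d / d := by positivity
  obtain ⟨y, ⟨_, ⟨x, hx, hxa, rfl⟩, hy⟩, hqy⟩ := Metric.mem_closure_iff.1 hq _ hρ
  refine ⟨x, hx, hxa, ?_⟩
  have h1 : dualNorm1 (q - y) ≤ d * (1 / √d / d) := dualNorm1_le_card_mul fun k =>
    ((norm_le_pi_norm (q - y) k).trans (by rw [← dist_eq_norm]; exact hqy.le))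
  rw [mul_div_cancel₀ _ hd.ne'] at h1
  have h2 := dualNorm1_add_le (q - y) (y - (GMat g K).mulVec x)
  rw [sub_add_sub_cancel] at h2
  have h3 : 2 / √d = 1 / √d + 1 / √d := by ring
  linarith

lemma dualNorm1_smul_spread_le (K n : ℕ) (q : D K → ℝ) :
    dualNorm1 (((2 : ℝ) ^ n)⁻¹ • spread K n q) ≤ dualNorm1 q := by
  refine dualNorm1_le_iff.2 fun k' => ?_
  obtain ⟨⟨k, j⟩, rfl⟩ := (refineEquiv K n).surjective k'
  rw [Pi.smul_apply, spread_refine, smul_eq_mul, card_refine, abs_mul,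
    abs_of_pos (by positivity)]
  refine le_trans (le_of_eq ?_) (le_dualNorm1 q k)
  field_simp

/-- The discretization error at level `K`. -/
noncomputable def discError (ℓ a : ℝ) (K : ℕ) : ℝ :=
  2 / √(Fintype.card (D K) : ℝ) + ℓ * (1 / 2 ^ K) * a

lemma discError_nonneg (hℓ : 0 ≤ ℓ) (ha : 0 ≤ a) (K : ℕ) : 0 ≤ discError ℓ a K := by
  unfold discError; positivity

lemma tendsto_discError (ℓ a : ℝ) : Tendsto (discError ℓ a) atTop (𝓝 0) := by
  have h1 : Tendsto (fun K : ℕ => (Fintype.card (D K) : ℝ)) atTop atTop := by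
    have : (fun K : ℕ => (Fintype.card (D K) : ℝ)) = fun K => (2 : ℝ) ^ (K + 1) := by
      ext K; simp
    rw [this]
    exact (tendsto_pow_atTop_atTop_of_one_lt one_lt_two).comp (tendsto_add_atTop_nat 1)
  have h2 : Tendsto (fun K : ℕ => 2 / √(Fintype.card (D K) : ℝ)) atTop (𝓝 0) :=
    tendsto_const_nhds.div_atTop (Real.tendsto_sqrt_atTop.comp h1)
  have h3 : Tendsto (fun K : ℕ => (1 : ℝ) / 2 ^ K) atTop (𝓝 0) :=
    tendsto_const_nhds.div_atTop (tendsto_pow_atTop_atTop_of_one_lt one_lt_two)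
  have := h2.add ((h3.const_mul ℓ).mul_const a)
  rw [mul_zero, zero_mul, add_zero] at this
  exact this

/-- Extensions at two levels nearly agree on gradients that are close to the cone: both are close
to the common value of the quadratic non-linearity at `x` and at its lift. -/
lemma abs_extension_sub_le (hg : ∀ x ∈ Set.Icc (-1 : ℝ) 1, ∀ y ∈ Set.Icc (-1 : ℝ) 1,
    |g x - g y| ≤ ℓ * |x - y|) (hℓ : 0 ≤ ℓ) (ha : 0 ≤ a) {K n : ℕ} {R₁ R₂ V₁ V₂ L : ℝ}
    {H₁ : (D K → ℝ) → ℝ} {H₂ : (D (K + n) → ℝ) → ℝ} (h₁ : IsExtension g K R₁ V₁ H₁)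
    (h₂ : IsExtension g (K + n) R₂ V₂ H₂) (hR₁ : L + discError ℓ a K ≤ R₁)
    (hR₂ : L + discError ℓ a K ≤ R₂) {q : D K → ℝ} (hqL : dualNorm1 q ≤ L)
    (hq : q ∈ closure (enlarge (Kset g a K))) :
    |H₁ q - H₂ (((2 : ℝ) ^ n)⁻¹ • spread K n q)| ≤ (V₁ + V₂) * discError ℓ a K := by
  obtain ⟨x, hx, hxa, hqx⟩ := exists_of_mem_closure_enlarge hq
  have hV₁ := lipschitz_const_nonneg h₁.lipschitz
  have hV₂ := lipschitz_const_nonneg h₂.lipschitz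
  set y := (GMat g K).mulVec x with hy
  set y' := (GMat g (K + n)).mulVec (lift K n x) with hy'
  set b := ((2 : ℝ) ^ n)⁻¹ • spread K n q with hb
  have e1 : dualNorm1 (q - y) ≤ discError ℓ a K := by
    have : 0 ≤ ℓ * (1 / 2 ^ K) * a := by positivity
    unfold discError
    linarith
  have e2 : dualNorm1 (b - y') ≤ discError ℓ a K := by
    have h3 := dualNorm1_add_le (((2 : ℝ) ^ n)⁻¹ • spread K n (q - y))
      (((2 : ℝ) ^ n)⁻¹ • spread K n y - y')
    have h4 : ((2 : ℝ) ^ n)⁻¹ • spread K n (q - y) + (((2 : ℝ) ^ n)⁻¹ • spread K n y - y')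
        = b - y' := by
      rw [map_sub, smul_sub, hb]; abel
    rw [h4] at h3
    have h5 := dualNorm1_smul_spread_le K n (q - y)
    have h6 := dualNorm1_spread_sub_le hg hℓ K n hx
    have h7 : ℓ * (1 / 2 ^ K) * norm1 x ≤ ℓ * (1 / 2 ^ K) * a :=
      mul_le_mul_of_nonneg_left hxa (by positivity)
    unfold discError
    linarith
  have e3 : dualNorm1 y ≤ R₁ := by
    have := dualNorm1_add_le (-(q - y)) q
    rw [dualNorm1_neg, neg_sub, sub_add_cancel] at this
    linarith
  have e4 : dualNorm1 y' ≤ R₂ := by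
    have := dualNorm1_add_le (-(b - y')) b
    rw [dualNorm1_neg, neg_sub, sub_add_cancel] at this
    have := dualNorm1_smul_spread_le K n q
    linarith
  have f1 := h₁.lipschitz q y
  have f2 := h₂.lipschitz b y'
  rw [h₁.agrees x hx e3] at f1
  rw [h₂.agrees _ (lift_mem hx) e4, CVal_lift] at f2
  have f3 := mul_le_mul_of_nonneg_left e1 hV₁
  have f4 := mul_le_mul_of_nonneg_left e2 hV₂
  rw [abs_le] at *
  constructor <;> linarith

/-- The initial conditions at two levels are close. The gradient condition at the finer level
makes `ψ` insensitive to displacements of mass by `2^{-K}`. -/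
lemma abs_projInit_avg_sub_le (hg : ∀ x ∈ Set.Icc (-1 : ℝ) 1, ∀ y ∈ Set.Icc (-1 : ℝ) 1,
    |g x - g y| ≤ ℓ * |x - y|) (hℓ : 0 ≤ ℓ) (hψ : LipschitzTV ψ) {K n : ℕ}
    (hgrad : HasGradientIn (projInit ψ (K + n)) (enlarge (Kset g a (K + n))))
    {x : D (K + n) → ℝ} (hx : x ∈ closedOrthant (D (K + n))) :
    |projInit ψ K (avg K n x) - projInit ψ (K + n) x| ≤ discError ℓ a K * norm1 x := by
  have hd := card_pos_real (D K)
  have hd' := card_pos_real (D (K + n))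
  set x' := lift K n (avg K n x) with hx'
  have hx'mem : x' ∈ closedOrthant (D (K + n)) := lift_mem (avg_mem hx)
  have hx'n : norm1 x' = norm1 x := by rw [hx', norm1_lift (avg_mem hx), norm1_avg hx]
  have hinit : projInit ψ K (avg K n x) = projInit ψ (K + n) x' := by
    unfold projInit; rw [hx', discMeasure_lift]
  have hdiff : norm1 (x - x') ≤ 2 * norm1 x := by
    have : norm1 (x - x') ≤ norm1 x + norm1 x' := by
      unfold norm1
      rw [← mul_add, ← Finset.sum_add_distrib]
      refine mul_le_mul_of_nonneg_left (Finset.sum_le_sum fun k _ => ?_) (by positivity)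
      exact abs_sub (x k) (x' k)
    linarith
  have hdot : ∀ s ∈ enlarge (Kset g a (K + n)), |s ⬝ᵥ (x - x')| ≤ discError ℓ a K * norm1 x := by
    rintro s ⟨_, ⟨z, hz, hza, rfl⟩, hs⟩
    have hsplit : s ⬝ᵥ (x - x') = (s - (GMat g (K + n)).mulVec z) ⬝ᵥ (x - x')
        + (GMat g (K + n)).mulVec (x - x') ⬝ᵥ z := by
      rw [sub_dotProduct, GMat_mulVec_dotProduct_comm g (K + n) (x - x') z]; ring
    have h1 := abs_dotProduct_le (s - (GMat g (K + n)).mulVec z) (x - x')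
    have h2 := abs_dotProduct_le ((GMat g (K + n)).mulVec (x - x')) z
    have h3 : dualNorm1 (s - (GMat g (K + n)).mulVec z) ≤ 1 / √(Fintype.card (D K) : ℝ) := by
      refine hs.trans (one_div_le_one_div_of_le (by positivity) (Real.sqrt_le_sqrt ?_))
      rw [card_refine]
      exact le_mul_of_one_le_right hd.le (one_le_pow₀ one_le_two)
    have h4 := mul_le_mul h3 hdiff (norm1_nonneg _) (by positivity)
    have h5 := mul_le_mul (dualNorm1_GMat_sub_lift_avg_le hg hℓ K n hx) hza (norm1_nonneg _)
      (mul_nonneg (by positivity) (norm1_nonneg x))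
    rw [hsplit]
    refine (abs_add_le _ _).trans ?_
    have h6 : discError ℓ a K * norm1 x = 1 / √(Fintype.card (D K) : ℝ) * (2 * norm1 x)
        + ℓ * (1 / 2 ^ K) * norm1 x * a := by unfold discError; ring
    linarith
  have hL := lipTV_nonneg ψ
  have hlip := abs_projInit_sub_le hψ (K + n)
  have up := le_add_of_hasGradientIn hL hlip hgrad (z := x - x')
    (fun s hs => (abs_le.1 (hdot s hs)).2) hx'mem (by simpa using hx)
  have down := le_add_of_hasGradientIn hL hlip hgrad (z := x' - x)
    (c := discError ℓ a K * norm1 x) (fun s hs => by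
      have := (abs_le.1 (hdot s hs)).1
      rw [← neg_sub x x', dotProduct_neg]; linarith) hx (by simpa using hx'mem)
  rw [add_sub_cancel] at up down
  rw [hinit]
  exact abs_le.2 ⟨by linarith, by linarith⟩

/-- Superjets of a function of the averages are spread from superjets of the function. -/
lemma IsSuperjet.exists_of_avg {K n : ℕ} {u : ℝ × (D K → ℝ) → ℝ} {p : ℝ × (D (K + n) → ℝ)}
    {α : ℝ} {b : D (K + n) → ℝ} (h : IsSuperjet (fun q => u (q.1, avg K n q.2)) p α b) :
    ∃ b', IsSuperjet u (p.1, avg K n p.2) α b' ∧ b = ((2 : ℝ) ^ n)⁻¹ • spread K n b' := by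
  obtain ⟨h1, h2⟩ := h.of_comp (avg K n) (spread K n) (avg_spread K n)
    (b' := fun k => ∑ j, b (refineEquiv K n (k, j))) fun z => by
      simp only [dotProduct]
      rw [sum_refine]
      simp only [spread_refine, Finset.sum_mul]
  exact ⟨_, h1, dotProduct_eq _ _ fun w => by rw [h2, dotProduct_avg]⟩

/-- Comparison of the solutions at levels `K` and `K + n`, for possibly different extensions. -/
theorem abs_sub_avg_le (hg : ∀ x ∈ Set.Icc (-1 : ℝ) 1, ∀ y ∈ Set.Icc (-1 : ℝ) 1,
    |g x - g y| ≤ ℓ * |x - y|) (hℓ : 0 ≤ ℓ) (ha : 0 ≤ a) (hψ : LipschitzTV ψ)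
    (hgrad : ∀ K : ℕ, 1 ≤ K → HasGradientIn (projInit ψ K) (enlarge (Kset g a K)))
    {K n : ℕ} (hK : 1 ≤ K) {R₁ R₂ V₁ V₂ : ℝ} (hV₁ : 0 < V₁) (hV₂ : 0 < V₂)
    {H₁ : (D K → ℝ) → ℝ} {H₂ : (D (K + n) → ℝ) → ℝ} (h₁ : IsExtension g K R₁ V₁ H₁)
    (h₂ : IsExtension g (K + n) R₂ V₂ H₂) (hR₁ : lipTV ψ + discError ℓ a K ≤ R₁)
    (hR₂ : lipTV ψ + discError ℓ a K ≤ R₂)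
    {u₁ : ℝ × (D K → ℝ) → ℝ} {u₂ : ℝ × (D (K + n) → ℝ) → ℝ}
    (hu₁ : IsSchemeLimit H₁ V₁ (projInit ψ K) u₁)
    (hu₂ : IsSchemeLimit H₂ V₂ (projInit ψ (K + n)) u₂) {t : ℝ} (ht : 0 ≤ t)
    {x : D (K + n) → ℝ} (hx : x ∈ closedOrthant (D (K + n))) :
    |u₁ (t, avg K n x) - u₂ (t, x)| ≤ discError ℓ a K * (norm1 x + (V₁ + 2 * V₂) * t) := by
  set e := discError ℓ a K with he
  have he0 : 0 ≤ e := discError_nonneg hℓ ha K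
  set E := (V₁ + V₂) * e with hE
  have hE0 : 0 ≤ E := by positivity
  have hL := lipTV_nonneg ψ
  have hlip₁ := abs_projInit_sub_le hψ K
  have hlip₂ := abs_projInit_sub_le hψ (K + n)
  have hsol₂ := hu₂.isSolution h₂.monotone h₂.lipschitz hV₂ hL hlip₂
  have hspace := hu₁.abs_sub_le_space h₁.monotone h₁.lipschitz hV₁ hL hlip₁
  have hinc : ∀ t, IncrementsIn (enlarge (Kset g a K)) fun x => u₁ (t, x) := fun t z c hc =>
    hu₁.add_le h₁.monotone h₁.lipschitz hV₁ (fun x hx hxz =>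
      le_add_of_hasGradientIn hL hlip₁ (hgrad K hK) hc (openOrthant_subset_closedOrthant hx)
        (openOrthant_subset_closedOrthant hxz)) t
  have hconv := convex_enlarge_Kset g a K
  set w : ℝ × (D (K + n) → ℝ) → ℝ := fun q => u₁ (q.1, avg K n q.2) with hw
  have hwcont : Continuous w :=
    (hu₁.continuous h₁.monotone h₁.lipschitz hV₁ hL hlip₁).comp (by fun_prop)
  have hu₂cont := hu₂.continuous h₂.monotone h₂.lipschitz hV₂ hL hlip₂
  have hwL : MemL w := by
    refine ⟨⟨lipTV ψ, fun x _ x' _ => ?_⟩, |H₁ 0| + V₁ * lipTV ψ, fun t ht x _ =>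
      hu₁.abs_sub_le_time h₁.monotone h₁.lipschitz hV₁ hL hlip₁ ht.le _⟩
    refine (hspace 0 _ _).trans (mul_le_mul_of_nonneg_left ?_ hL)
    rw [← map_sub]
    exact norm1_avg_le K n _
  have hwsub : IsViscositySubsolution (fun y => H₂ y + E) w := by
    refine isViscositySubsolution_of_superjet hwcont.continuousOn fun p hp α b hab => ?_
    obtain ⟨b', hb', rfl⟩ := hab.exists_of_avg
    have i1 := hu₁.le_of_isSuperjet h₁.monotone h₁.lipschitz hV₁ hL hlip₁
      (p := (p.1, avg K n p.2)) hp.1 hb'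
    have i2 := (hinc p.1).mem_closure_of_isSuperjet hconv (avg_mem_openOrthant hp.2) hb'
    have i3 := (abs_le.1 (abs_extension_sub_le hg hℓ ha h₁ h₂ hR₁ hR₂
      (hb'.dualNorm1_le (hspace p.1)) i2)).2
    linarith
  have hwsup : IsViscositySupersolution (fun y => H₂ y - E) w := by
    refine isViscositySupersolution_of_superjet hwcont.continuousOn fun p hp α b hab => ?_
    obtain ⟨b', hb', hbb'⟩ := IsSuperjet.exists_of_avg (u := -u₁) hab
    obtain ⟨b'', rfl⟩ : ∃ b'', b' = -b'' := ⟨-b', (neg_neg b').symm⟩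
    have hb : b = ((2 : ℝ) ^ n)⁻¹ • spread K n b'' := by
      rw [map_neg, smul_neg, neg_inj] at hbb'
      exact hbb'
    have i1 := hu₁.ge_of_isSuperjet_neg h₁.monotone h₁.lipschitz hV₁ hL hlip₁
      (p := (p.1, avg K n p.2)) hp.1 hb'
    have i2 := (hinc p.1).mem_closure_of_isSuperjet_neg hconv (avg_mem_openOrthant hp.2) hb'
    have i3 : dualNorm1 b'' ≤ lipTV ψ := by
      rw [← dualNorm1_neg]
      refine hb'.dualNorm1_le fun x y => ?_
      rw [Pi.neg_apply, Pi.neg_apply, neg_sub_neg, abs_sub_comm]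
      exact hspace p.1 x y
    have i4 := (abs_le.1 (abs_extension_sub_le hg hℓ ha h₁ h₂ hR₁ hR₂ i3 i2)).1
    rw [hb]
    linarith
  have hinit : ∀ y ∈ openOrthant (D (K + n)), |w (0, y) - u₂ (0, y)| ≤ e * norm1 y := fun y hy => by
    simp only [hw]
    rw [hu₁.initial, hu₂.initial]
    exact abs_projInit_avg_sub_le hg hℓ hψ (hgrad _ (by omega))
      (openOrthant_subset_closedOrthant hy)
  have hopen : ∀ y ∈ openOrthant (D (K + n)),
      |w (t, y) - u₂ (t, y)| ≤ e * (norm1 y + (V₁ + 2 * V₂) * t) := fun y hy => by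
    have c1 := le_of_perturbation h₂.monotone h₂.lipschitz hE0 he0 hsol₂.memLUnif.1 hwL
      hu₂cont.continuousOn hwcont.continuousOn hsol₂.viscosity.2.1 hwsup
      (fun x hx => by linarith [(abs_le.1 (hinit x hx)).1]) (p := (t, y)) ⟨ht, hy⟩
    have c2 := le_of_perturbation (H := fun y => H₂ y + E) (V := V₂)
      (fun y y' hyy' => add_le_add_left (h₂.monotone hyy') E)
      (fun y y' => by rw [add_sub_add_right_eq_sub]; exact h₂.lipschitz y y') hE0 he0 hwL
      hsol₂.memLUnif.1 hwcont.continuousOn hu₂cont.continuousOn hwsub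
      (by simpa using hsol₂.viscosity.2.2)
      (fun x hx => by linarith [(abs_le.1 (hinit x hx)).2]) (p := (t, y)) ⟨ht, hy⟩
    have : e * norm1 y + (E + V₂ * e) * t = e * (norm1 y + (V₁ + 2 * V₂) * t) := by
      rw [hE]; ring
    exact abs_le.2 ⟨by linarith, by linarith⟩
  -- The estimate extends to the boundary of the orthant by continuity.
  have hpath : Continuous fun σ : ℝ => x + fun _ => σ := by fun_prop
  have hF : Continuous fun y : D (K + n) → ℝ =>
      e * (norm1 y + (V₁ + 2 * V₂) * t) - |w (t, y) - u₂ (t, y)| := by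
    unfold norm1; fun_prop
  have hlim := (hF.comp hpath).tendsto 0
  have hx0 : (x + fun _ => (0 : ℝ)) = x := by ext; simp
  simp only [Function.comp_apply, hx0] at hlim
  have hge := ge_of_tendsto (hlim.mono_left (nhdsWithin_le_nhds (s := Set.Ioi 0)))
    (b := 0) (by
      filter_upwards [self_mem_nhdsWithin] with σ hσ
      have := hopen (x + fun _ => σ) fun k => add_pos_of_nonneg_of_pos (hx k) hσ
      simpa using this)
  linarith

/-- Existence of solutions at every level, as limits of the scheme. The constant `max V 1` is
positive, as the time step requires, and it is still a Lipschitz constant. -/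
lemma exists_forall_isSchemeLimit (hψ : LipschitzTV ψ) {R V : ℝ} {H : ∀ K : ℕ, (D K → ℝ) → ℝ}
    (hH : ∀ K : ℕ, 1 ≤ K → IsExtension g K R V (H K)) :
    ∃ u : ∀ K : ℕ, ℝ × (D K → ℝ) → ℝ, ∀ K : ℕ, 1 ≤ K →
      IsSchemeLimit (H K) (max V 1) (projInit ψ K) (u K) := by
  have : ∀ K : ℕ, ∃ u : ℝ × (D K → ℝ) → ℝ, 1 ≤ K →
      IsSchemeLimit (H K) (max V 1) (projInit ψ K) u := fun K => by
    by_cases hK : 1 ≤ K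
    · have h := (hH K hK).mono (le_max_left V 1)
      obtain ⟨u, hu⟩ := exists_isSchemeLimit h.monotone h.lipschitz
        (lt_max_of_lt_right one_pos) (lipTV_nonneg ψ) (abs_projInit_sub_le hψ K)
      exact ⟨u, fun _ => hu⟩
    · exact ⟨fun _ => 0, fun h => absurd h hK⟩
  choose u hu using this
  exact ⟨u, hu⟩

end Convergence

end SparseHJ

theorem theorem1p2 (g : ℝ → ℝ) (ψ : FiniteMeasure I → ℝ) (m : ℝ)
    (hg : ContDiffOn ℝ 1 g (Set.Icc (-1) 1))
    (hm : 0 < m) (hgm : ∀ x ∈ Set.Icc (-1 : ℝ) 1, m ≤ g x)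
    (hTV : LipschitzTV ψ)
    (hgrad : GradientCondition g ψ)
    (hW : LipschitzW ψ) :
    (∀ R : ℝ, 0 < R → ∀ M : ℝ, (∀ x ∈ Set.Icc (-1 : ℝ) 1, g x ≤ M) →
      ∀ K : ℕ, 1 ≤ K → IsExtension g K R (8 * R * M / m ^ 2) (HKR g m K R)) ∧
    ∃ f : ℝ → FiniteMeasure I → ℝ,
      ∀ R : ℝ, lipTV ψ < R →
        ∀ (V : ℝ) (H : ∀ K : ℕ, (D K → ℝ) → ℝ),
          (∀ K : ℕ, 1 ≤ K → IsExtension g K R V (H K)) →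
          ∃ u : ∀ K : ℕ, ℝ × (D K → ℝ) → ℝ,
            (∀ K : ℕ, 1 ≤ K → IsSolution (H K) (projInit ψ K) (u K) ∧
              ∀ v : ℝ × (D K → ℝ) → ℝ, IsSolution (H K) (projInit ψ K) v →
                Set.EqOn v (u K) (Set.Ici 0 ×ˢ closedOrthant (D K))) ∧
            ∀ (t : ℝ) (μ : FiniteMeasure I), 0 ≤ t →
              Tendsto (fun K : ℕ => u K (t, proj K μ)) atTop (𝓝 (f t μ)) := by
  refine ⟨fun R hR M hM K _ => isExtension_HKR hR hm hgm hM K, ?_⟩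
  obtain ⟨a, ha, hgrad⟩ := hgrad
  obtain ⟨ℓ, hℓ⟩ := hg.exists_lipschitzOnWith one_ne_zero (convex_Icc _ _) isCompact_Icc
  have hglip : ∀ x ∈ Set.Icc (-1 : ℝ) 1, ∀ y ∈ Set.Icc (-1 : ℝ) 1,
      |g x - g y| ≤ (ℓ : ℝ) * |x - y| := fun x hx y hy => hℓ.dist_le_mul x hx y hy
  obtain ⟨M, hM⟩ := isCompact_Icc.bddAbove_image hg.continuousOn
  have hgM : ∀ x ∈ Set.Icc (-1 : ℝ) 1, g x ≤ M := fun x hx => hM ⟨x, hx, rfl⟩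
  have hL := lipTV_nonneg ψ
  have hR₀ : 0 < lipTV ψ + 1 := by linarith
  obtain ⟨u₀, hu₀⟩ := exists_forall_isSchemeLimit (g := g) hTV fun K _ =>
    isExtension_HKR hR₀ hm hgm hgM K
  set V₀ := max (8 * (lipTV ψ + 1) * M / m ^ 2) 1 with hV₀
  have hV₀0 : 0 < V₀ := lt_max_of_lt_right one_pos
  have hext₀ : ∀ K, IsExtension g K (lipTV ψ + 1) V₀ (HKR g m K (lipTV ψ + 1)) := fun K =>
    (isExtension_HKR hR₀ hm hgm hgM K).mono (le_max_left _ _)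
  set e := discError ℓ a with he
  have he0 : ∀ K, 0 ≤ e K := discError_nonneg ℓ.2 ha.le
  -- Any admissible family is compared with the reference family `H_{K,R₀}`.
  have compare : ∀ (R V : ℝ) (H : ∀ K : ℕ, (D K → ℝ) → ℝ) (u : ∀ K : ℕ, ℝ × (D K → ℝ) → ℝ),
      lipTV ψ < R → 0 < V → (∀ K : ℕ, 1 ≤ K → IsExtension g K R V (H K)) →
      (∀ K : ℕ, 1 ≤ K → IsSchemeLimit (H K) V (projInit ψ K) (u K)) →
      ∃ K₀ : ℕ, ∀ K, K₀ ≤ K → ∀ n t (μ : FiniteMeasure I), 0 ≤ t →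
        |u₀ K (t, proj K μ) - u (K + n) (t, proj (K + n) μ)| ≤
          e K * (norm1 (proj 0 μ) + (V₀ + 2 * V) * t) := by
    intro R V H u hR hV hH hu
    have hsmall : ∀ᶠ K in atTop, e K < min 1 (R - lipTV ψ) :=
      (tendsto_discError ℓ a).eventually_lt_const (lt_min one_pos (by linarith))
    obtain ⟨K₀, hK₀⟩ := (hsmall.and (eventually_ge_atTop 1)).exists_forall_of_atTop
    refine ⟨K₀, fun K hK n t μ ht => ?_⟩
    obtain ⟨hs, hK1⟩ := hK₀ K hK
    have h1 := min_le_left 1 (R - lipTV ψ)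
    have h2 := min_le_right 1 (R - lipTV ψ)
    have := abs_sub_avg_le hglip ℓ.2 ha.le hTV hgrad hK1 hV₀0 hV (hext₀ K)
      (hH (K + n) (by omega)) (by linarith) (by linarith) (hu₀ K hK1) (hu (K + n) (by omega)) ht
      (proj_mem (K + n) μ)
    rwa [avg_proj, norm1_proj] at this
  have hconv : ∀ t (μ : FiniteMeasure I), ∃ y, 0 ≤ t →
      Tendsto (fun K : ℕ => u₀ K (t, proj K μ)) atTop (𝓝 y) := by
    intro t μ
    by_cases ht : 0 ≤ t
    swap
    · exact ⟨0, fun h => absurd h ht⟩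
    obtain ⟨K₀, hK₀⟩ := compare _ V₀ _ u₀ (by linarith) hV₀0 (fun K _ => hext₀ K) hu₀
    have hcauchy : CauchySeq fun K : ℕ => u₀ K (t, proj K μ) := by
      rw [Metric.cauchySeq_iff']
      intro ε hε
      have hlim := (tendsto_discError ℓ a).mul_const (norm1 (proj 0 μ) + (V₀ + 2 * V₀) * t)
      rw [zero_mul] at hlim
      obtain ⟨N, hN, hNK⟩ := ((hlim.eventually_lt_const hε).and (eventually_ge_atTop K₀)).exists
      refine ⟨N, fun K hK => ?_⟩
      obtain ⟨n, rfl⟩ := Nat.exists_eq_add_of_le hK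
      rw [dist_comm, Real.dist_eq]
      exact (hK₀ N hNK n t μ ht).trans_lt hN
    obtain ⟨y, hy⟩ := cauchySeq_tendsto_of_complete hcauchy
    exact ⟨y, fun _ => hy⟩
  choose f hf using hconv
  refine ⟨f, fun R hR V H hH => ?_⟩
  obtain ⟨u, hu⟩ := exists_forall_isSchemeLimit hTV hH
  have hV : 0 < max V 1 := lt_max_of_lt_right one_pos
  have hH' : ∀ K : ℕ, 1 ≤ K → IsExtension g K R (max V 1) (H K) := fun K hK =>
    (hH K hK).mono (le_max_left _ _)
  have hsol : ∀ K : ℕ, 1 ≤ K → IsSolution (H K) (projInit ψ K) (u K) := fun K hK =>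
    (hu K hK).isSolution (hH' K hK).monotone (hH' K hK).lipschitz hV hL
      (abs_projInit_sub_le hTV K)
  refine ⟨u, fun K hK => ⟨hsol K hK, fun v hv =>
    hv.eqOn (hH' K hK).monotone (hH' K hK).lipschitz (hsol K hK)⟩, fun t μ ht => ?_⟩
  obtain ⟨K₀, hK₀⟩ := compare R _ H u hR hV hH' hu
  have hlim := (tendsto_discError ℓ a).mul_const (norm1 (proj 0 μ) + (V₀ + 2 * max V 1) * t)
  rw [zero_mul] at hlim
  have hdiff : Tendsto (fun K : ℕ => u₀ K (t, proj K μ) - u K (t, proj K μ)) atTop (𝓝 0) := by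
    refine squeeze_zero_norm' ?_ hlim
    filter_upwards [eventually_ge_atTop K₀] with K hK
    exact hK₀ K hK 0 t μ ht
  simpa using (hf t μ ht).sub hdiff
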